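/- Let $\mathcal S$ be the complex Lie algebra with basis $f,q,h,e,p,z$ and brackets $[h,e]=2e$, $[e,f]=h$, $[h,f]=-2f$, $[e,q]=p$, $[e,p]=0$, $[h,p]=p$, $[f,p]=q$, $[f,q]=0$, $[h,q]=-q$, $[p,q]=z$, $[z,\mathcal S]=0$. Let $\mathfrak a=\langle e,h,p,q,z\rangle$, $\mathcal H=\langle p,q,z\rangle$, $\mathfrak{sl}_2=\langle e,f,h\rangle$. An $\mathfrak a$-module is a weight module if all elements of $\langle h,z\rangle$ act diagonalizably on it. A highest weight module over $\mathfrak a$ or $\mathcal S$ is a module generated by a nonzero common eigenvector of $h$ and $z$ that is annihilated by $e$ and $p$. For an $\mathfrak a$-module $V$ put $H(V)=\mathrm{Ind}_{\mathfrak a}^{\mathcal S}V=U(\mathcal S)\otimes_{U(\mathfrak a)}V$. Notation for modules, where $\dot z,\dot h,\dot c,\lambda,\mu\in\mathbb C$: * $\bar M^-_{\mathfrak a}(\dot z,\dot h)$ is the unique simple quotient of the lowest weight Verma module $\mathrm{Ind}_{\langle h,z,q\rangle}^{\mathfrak a}\mathbb C w$ with $hw=\dot h w$, $zw=\dot z w$,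 $qw=0$; $M^-_{\mathcal H}(\dot z)=\mathrm{Ind}_{\langle q,z\rangle}^{\mathcal H}\mathbb C w$ with $qw=0$, $zw=\dot zw$; $M_{\mathfrak{sl}_2}(\mu)$ is the Verma module with highest weight $\mu$ (generated by $w$ with $ew=0$, $hw=\mu w$), and $\bar M_{\mathfrak{sl}_2}(\mu)$ is its unique simple quotient. * $Q(\lambda,\dot h)=\mathbb C[x,x^{-1}]$ with $zx^i=px^i=0$, $qx^i=x^{i+1}$, $ex^i=\lambda x^{i-2}$, $hx^i=(\dot h-i)x^i$. * $Q'(\dot z,\dot h,\lambda)=\mathbb C[x,x^{-1}]$ with $qx^i=x^{i+1}$, $px^i=\dot z(\lambda+i)x^{i-1}$, $zx^i=\dot zx^i$, $hx^i=(\dot h-i)x^i$, $ex^i=\frac{\dot z}{2}(\lambda+i)(\lambda+i-1)x^{i-2}$; $G(\dot z,\lambda)=\mathbb C[x,x^{-1}]$ is the $\mathcal H$-module with the same action of $q,p,z$. * For an $\mathcal H$-module $W$ on which $z$ acts as $\dot z\neq 0$, $W^{\mathcal S}$ is the $\mathcal S$-module $W$ with $e=\frac1{2\dot z}p^2$, $f=-\frac1{2\dot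 z}q^2$, $h=-\frac{pq}{\dot z}+\frac12$. For an $\mathfrak{sl}_2$-module $W$, $W^{\mathcal S}$ is $W$ with $\mathcal H$ acting as zero. * $R_{\dot z}$ is the subalgebra of the first Weyl algebra $\mathbb C\langle t,\frac d{dt}\rangle$ generated by $t$ and $t^2\frac d{dt}$ if $\dot z=0$, and by $t$ and $t\frac d{dt}$ if $\dot z\ne0$. For an $R_{\dot z}$-module $N$ let $X=t$, $Y=t^2\frac d{dt}$ if $\dot z=0$, and $X=2\dot zt\frac d{dt}$, $Y=t+\dot zt\frac d{dt}+2\dot z(t\frac d{dt})^2$ if $\dot z\neq0$. Then $N_{\dot z,\dot h}=N\otimes\mathbb C[x,x^{-1}]$ is the $\mathfrak a$-module with $h(v\otimes x^i)=(\dot h-i)v\otimes x^i$, $z(v\otimes x^i)=\dot z v\otimes x^i$, $q(v\otimes x^i)=v\otimes x^{i+1}$, $p(v\otimes x^i)=\big((X+(i-1)\dot z)v\big)\otimes x^{i-1}$, $e(v\otimes x^i)=\big((Y+(i-2)X+\frac{(i-1)(i-2)}2\dot z)v\big)\otimes x^{i-2}$. * If $N$ is an infinite-dimensional simple $R_{\dot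 z}$-module, then $t$ acts bijectively on $N$, so $\frac d{dt}$ and $t^{-1}$ act on $N$, and $N_{\dot c,\dot z,\dot h}$ is the $\mathcal S$-module extending $N_{\dot z,\dot h}$ by $f(v\otimes x^i)=(Fv)\otimes x^{i+2}$ with $F=\frac d{dt}+(\dot h-2)t^{-1}+\dot ct^{-2}$ if $\dot z=0$, and $F=-\frac1{2\dot z}-(\dot h-\frac12)\frac d{dt}-t(\frac d{dt})^2-\big(\frac{(\dot h-1)(\dot h-2)}4+\frac{\dot c}{2\dot z}\big)t^{-1}$ if $\dot z\ne0$. **Theorem.** Let $V$ be a simple weight $\mathfrak a$-module. (a) If $V$ is a highest weight module, then $H(V)$ is a highest weight $\mathcal S$-module, and it has a unique simple quotient. (b) If $V\cong\bar M^-_{\mathfrak a}(\dot z,\dot h)$ with $\dot z\neq0$, then $H(V)\cong M^-_{\mathcal H}(\dot z)^{\mathcal S}\otimes M_{\mathfrak{sl}_2}(\dot h-\frac12)^{\mathcal S}$. The latter module has a unique simple quotient, and this quotient is isomorphic to $M^-_{\mathcal H}(\dot z)^{\mathcal S}\otimes\bar M_{\mathfrak{sl}_2}(\dot h-\frac12)^{\mathcal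 S}$. (c) If $V\cong Q(\lambda,\dot h)$ with $\dot h\in\mathbb C$ and $\lambda\in\mathbb C\setminus\{0\}$, then $H(V)$ is simple. (d) If $V\cong Q'(\dot z,\dot h,\lambda)$ with $\dot h\in\mathbb C$, $\dot z\in\mathbb C\setminus\{0\}$, $\lambda\in\mathbb C\setminus\mathbb Z$, then $H(V)\cong G(\dot z,\lambda)^{\mathcal S}\otimes M_{\mathfrak{sl}_2}(\lambda+\dot h+\frac12)^{\mathcal S}$. The latter module has a unique simple quotient, and this quotient is isomorphic to $G(\dot z,\lambda)^{\mathcal S}\otimes\bar M_{\mathfrak{sl}_2}(\lambda+\dot h+\frac12)^{\mathcal S}$. (e) If $V\cong N_{\dot z,\dot h}$, where $N$ is an infinite-dimensional simple $R_{\dot z}$-module, then every simple quotient of $H(V)$ is isomorphic to $N_{\dot c,\dot z,\dot h}$ for some $\dot c\in\mathbb C$. -/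

import Mathlib

open scoped TensorProduct

set_option linter.unusedSimpArgs false
set_option linter.unusedSectionVars false
set_option linter.unnecessarySeqFocus false

noncomputable section

namespace Schroedinger

/-! ## The extended Schrödinger algebra in dimension (1+1) -/

/-- Labels of the standard basis of the Schrödinger algebra. -/
inductive Gen
  | e | f | h | p | q | z
  deriving DecidableEq

instance : Fintype Gen := ⟨{.e, .f, .h, .p, .q, .z}, fun x => by cases x <;> decide⟩

lemma sum_gen {M : Type*} [AddCommMonoid M] (F : Gen → M) :
    ∑ g, F g = F .e + F .f + F .h + F .p + F .q + F .z := by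
  have : (Finset.univ : Finset Gen) = {.e, .f, .h, .p, .q, .z} := rfl
  rw [this]
  simp [add_assoc]

/-- The extended Schrödinger algebra: an element is its tuple of coordinates with respect
to the basis `e, f, h, p, q, z`. -/
def Schr : Type := Gen → ℂ

instance : AddCommGroup Schr := inferInstanceAs (AddCommGroup (Gen → ℂ))
instance : Module ℂ Schr := inferInstanceAs (Module ℂ (Gen → ℂ))

/-- The basis vector with label `g`. -/
def gen (g : Gen) : Schr := fun k => if k = g then 1 else 0

@[ext] lemma Schr.ext {x y : Schr} (H : ∀ g : Gen, x g = y g) : x = y := funext H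

@[simp] lemma add_coord (x y : Schr) (g : Gen) : (x + y) g = x g + y g := rfl
@[simp] lemma smul_coord (c : ℂ) (x : Schr) (g : Gen) : (c • x) g = c * x g := rfl
@[simp] lemma zero_coord (g : Gen) : (0 : Schr) g = 0 := rfl
@[simp] lemma neg_coord (x : Schr) (g : Gen) : (-x) g = -x g := rfl
@[simp] lemma sub_coord (x y : Schr) (g : Gen) : (x - y) g = x g - y g := rfl
lemma gen_coord (g k : Gen) : gen g k = if k = g then 1 else 0 := rfl

/-- The Lie bracket in coordinates. -/
def bracket (x y : Schr) : Schr
  | .e => 2 * (x .h * y .e - x .e * y .h)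
  | .f => -2 * (x .h * y .f - x .f * y .h)
  | .h => x .e * y .f - x .f * y .e
  | .p => (x .e * y .q - x .q * y .e) + (x .h * y .p - x .p * y .h)
  | .q => (x .f * y .p - x .p * y .f) - (x .h * y .q - x .q * y .h)
  | .z => x .p * y .q - x .q * y .p

instance : LieRing Schr where
  bracket := bracket
  add_lie x y w := by
    change bracket (x + y) w = bracket x w + bracket y w
    ext g; cases g <;> simp [bracket] <;> ring
  lie_add x y w := by
    change bracket x (y + w) = bracket x y + bracket x w
    ext g; cases g <;> simp [bracket] <;> ring
  lie_self x := by
    change bracket x x = 0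
    ext g; cases g <;> simp [bracket] <;> ring
  leibniz_lie x y w := by
    change bracket x (bracket y w) = bracket (bracket x y) w + bracket y (bracket x w)
    ext g; cases g <;> simp [bracket] <;> ring

lemma lie_def (x y : Schr) : ⁅x, y⁆ = bracket x y := rfl

instance : LieAlgebra ℂ Schr where
  lie_smul c x y := by
    rw [lie_def, lie_def]
    ext g; cases g <;> simp [bracket] <;> ring

lemma lie_relations :
    ⁅gen .h, gen .e⁆ = (2 : ℂ) • gen .e ∧ ⁅gen .e, gen .f⁆ = gen .h ∧
    ⁅gen .h, gen .f⁆ = (-2 : ℂ) • gen .f ∧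
    ⁅gen .e, gen .q⁆ = gen .p ∧ ⁅gen .e, gen .p⁆ = 0 ∧ ⁅gen .h, gen .p⁆ = gen .p ∧
    ⁅gen .f, gen .p⁆ = gen .q ∧ ⁅gen .f, gen .q⁆ = 0 ∧ ⁅gen .h, gen .q⁆ = -gen .q ∧
    ⁅gen .p, gen .q⁆ = gen .z ∧ ∀ x : Schr, ⁅gen .z, x⁆ = 0 := by
  refine ⟨?_, ?_, ?_, ?_, ?_, ?_, ?_, ?_, ?_, ?_, fun x => ?_⟩ <;>
  · rw [lie_def]; ext g; cases g <;> simp [bracket, gen_coord]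

lemma lie_coord (x y : Schr) (k : Gen) :
    ⁅x, y⁆ k = ∑ i, ∑ j, x i * y j * (⁅gen i, gen j⁆ : Schr) k := by
  simp only [lie_def]
  cases k <;> simp [sum_gen, bracket, gen_coord] <;> ring

lemma sum_lie_gen {M : Type*} [AddCommGroup M] [Module ℂ M] (B : Gen → M) (g g' : Gen) :
    ∑ k, (⁅gen g, gen g'⁆ : Schr) k • B k =
      match g with
      | .e => match g' with
        | .e => 0 | .f => B .h | .h => (-2 : ℂ) • B .e | .p => 0 | .q => B .p | .z => 0
      | .f => match g' with
        | .e => -B .h | .f => 0 | .h => (2 : ℂ) • B .f | .p => B .q | .q => 0 | .z => 0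
      | .h => match g' with
        | .e => (2 : ℂ) • B .e | .f => (-2 : ℂ) • B .f | .h => 0 | .p => B .p | .q => -B .q
        | .z => 0
      | .p => match g' with
        | .e => 0 | .f => -B .q | .h => -B .p | .p => 0 | .q => B .z | .z => 0
      | .q => match g' with
        | .e => -B .p | .f => 0 | .h => B .q | .p => -B .z | .q => 0 | .z => 0
      | .z => 0 := by
  rw [sum_gen, lie_def]
  cases g <;> cases g' <;> simp [bracket, gen_coord]

/-- The subspace of the Schrödinger algebra spanned by the basis vectors with labels in `T`,
when it is closed under the bracket. -/
def coordSub (T : Finset Gen)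
    (hT : ∀ i ∈ T, ∀ j ∈ T, ∀ k, k ∉ T → (⁅gen i, gen j⁆ : Schr) k = 0) :
    LieSubalgebra ℂ Schr where
  carrier := {x | ∀ k, k ∉ T → x k = 0}
  add_mem' hx hy k hk := by simp [hx k hk, hy k hk]
  zero_mem' k _ := rfl
  smul_mem' c x hx k hk := by simp [hx k hk]
  lie_mem' := by
    intro x y hx hy k hk
    rw [lie_coord]
    refine Finset.sum_eq_zero fun i _ => Finset.sum_eq_zero fun j _ => ?_
    by_cases hi : i ∈ T
    · by_cases hj : j ∈ T
      · rw [hT i hi j hj k hk, mul_zero]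
      · rw [hy j hj]; simp
    · rw [hx i hi]; simp

lemma gen_mem_coordSub {T : Finset Gen}
    {hT : ∀ i ∈ T, ∀ j ∈ T, ∀ k, k ∉ T → (⁅gen i, gen j⁆ : Schr) k = 0} {g : Gen} (hg : g ∈ T) :
    gen g ∈ coordSub T hT := by
  intro k hk
  rw [gen_coord, if_neg]
  rintro rfl
  exact hk hg

/-- The ageing algebra, spanned by `e, h, p, q, z`. -/
def ageing : LieSubalgebra ℂ Schr := coordSub {.e, .h, .p, .q, .z} (by
  intro i hi j hj k hk
  rw [lie_def]
  cases i <;> cases j <;> cases k <;> simp [bracket, gen_coord] at *)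

/-- The Heisenberg algebra, spanned by `p, q, z`. -/
def heis : LieSubalgebra ℂ Schr := coordSub {.p, .q, .z} (by
  intro i hi j hj k hk
  rw [lie_def]
  cases i <;> cases j <;> cases k <;> simp [bracket, gen_coord] at *)

/-- The copy of `sl₂` spanned by `e, f, h`. -/
def sl2 : LieSubalgebra ℂ Schr := coordSub {.e, .f, .h} (by
  intro i hi j hj k hk
  rw [lie_def]
  cases i <;> cases j <;> cases k <;> simp [bracket, gen_coord] at *)

/-- The subalgebra of the ageing algebra spanned by `h, z, q`, from which lowest weight Verma
modules are induced. -/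
def ageingLow : LieSubalgebra ℂ Schr := coordSub {.h, .q, .z} (by
  intro i hi j hj k hk
  rw [lie_def]
  cases i <;> cases j <;> cases k <;> simp [bracket, gen_coord] at *)

/-- The subalgebra of the Heisenberg algebra spanned by `q, z`. -/
def heisLow : LieSubalgebra ℂ Schr := coordSub {.q, .z} (by
  intro i hi j hj k hk
  rw [lie_def]
  cases i <;> cases j <;> cases k <;> simp [bracket, gen_coord] at *)

/-- The Borel subalgebra of `sl₂` spanned by `e, h`. -/
def sl2Borel : LieSubalgebra ℂ Schr := coordSub {.e, .h} (by
  intro i hi j hj k hk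
  rw [lie_def]
  cases i <;> cases j <;> cases k <;> simp [bracket, gen_coord] at *)

lemma coordSub_mono {T T' : Finset Gen} {hT hT'} (H : T ⊆ T') :
    coordSub T hT ≤ coordSub T' hT' := fun _ hx k hk => hx k fun hk' => hk (H hk')

lemma ageingLow_le : ageingLow ≤ ageing := coordSub_mono (by decide)
lemma heisLow_le : heisLow ≤ heis := coordSub_mono (by decide)
lemma sl2Borel_le : sl2Borel ≤ sl2 := coordSub_mono (by decide)

lemma e_mem_ageing : gen .e ∈ ageing := gen_mem_coordSub (by decide)
lemma h_mem_ageing : gen .h ∈ ageing := gen_mem_coordSub (by decide)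
lemma p_mem_ageing : gen .p ∈ ageing := gen_mem_coordSub (by decide)
lemma q_mem_ageing : gen .q ∈ ageing := gen_mem_coordSub (by decide)
lemma z_mem_ageing : gen .z ∈ ageing := gen_mem_coordSub (by decide)
lemma p_mem_heis : gen .p ∈ heis := gen_mem_coordSub (by decide)
lemma q_mem_heis : gen .q ∈ heis := gen_mem_coordSub (by decide)
lemma z_mem_heis : gen .z ∈ heis := gen_mem_coordSub (by decide)
lemma z_mem_heisLow : gen .z ∈ heisLow := gen_mem_coordSub (by decide)

/-- The projection of the Schrödinger algebra onto `sl₂` with kernel the Heisenberg algebra. -/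
def projSl2 : Schr →ₗ⁅ℂ⁆ sl2 where
  toFun x := ⟨x .e • gen .e + x .f • gen .f + x .h • gen .h, by
    refine add_mem (add_mem ?_ ?_) ?_ <;>
      exact Submodule.smul_mem _ _ (gen_mem_coordSub (by decide))⟩
  map_add' x y := by
    ext g; cases g <;> simp [gen_coord]
  map_smul' c x := by
    ext g; cases g <;> simp [gen_coord]
  map_lie' := by
    intro x y
    ext g; cases g <;> simp [gen_coord, lie_def, bracket] <;> ring

/-! ## Representations and modules -/

section Rep

variable (L : Type*) [LieRing L] [LieAlgebra ℂ L] (V : Type*) [AddCommGroup V] [Module ℂ V]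

/-- A representation of a complex Lie algebra `L` on a vector space `V`. -/
structure Rep where
  /-- The action map. -/
  act : L →ₗ[ℂ] Module.End ℂ V
  map_lie : ∀ x y, act ⁅x, y⁆ = act x * act y - act y * act x

end Rep

section RepSpace

variable {L : Type*} [LieRing L] [LieAlgebra ℂ L] {V : Type*} [AddCommGroup V] [Module ℂ V]

/-- The representation space of `ρ`, as an `L`-module. -/
def Rep.Space (_ρ : Rep L V) : Type _ := V

variable (ρ : Rep L V)

instance : AddCommGroup ρ.Space := inferInstanceAs (AddCommGroup V)
instance : Module ℂ ρ.Space := inferInstanceAs (Module ℂ V)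

instance : LieRingModule L ρ.Space where
  bracket x v := ρ.act x v
  add_lie x y v := by
    change ρ.act (x + y) v = ρ.act x v + ρ.act y v
    rw [map_add]; rfl
  lie_add x v w := map_add (ρ.act x) v w
  leibniz_lie x y v := by
    change ρ.act x (ρ.act y v) = ρ.act ⁅x, y⁆ v + ρ.act y (ρ.act x v)
    rw [ρ.map_lie]
    change _ = (ρ.act x (ρ.act y v) - ρ.act y (ρ.act x v)) + _
    rw [sub_add_cancel]

instance : LieModule ℂ L ρ.Space where
  smul_lie c x v := by
    change ρ.act (c • x) v = c • ρ.act x v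
    rw [map_smul]; rfl
  lie_smul c x v := map_smul (ρ.act x) c v

end RepSpace

/-- A representation given by operators `A g` for the basis vectors with labels `g ∈ T`
satisfying the commutation relations; `φ` is the inclusion of the Lie algebra spanned by the
basis vectors with labels in `T`. -/
def repOfOps {K : Type*} [LieRing K] [LieAlgebra ℂ K] {V : Type*} [AddCommGroup V] [Module ℂ V]
    (φ : K →ₗ⁅ℂ⁆ Schr) (T : Finset Gen) (hφ : ∀ x k, k ∉ T → φ x k = 0)
    (A : Gen → Module.End ℂ V)
    (hA : ∀ i ∈ T, ∀ j ∈ T,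
      A i * A j - A j * A i = ∑ k, (⁅gen i, gen j⁆ : Schr) k • A k) : Rep K V where
  act :=
    { toFun := fun x => ∑ g, φ x g • A g
      map_add' := fun x y => by simp [add_smul, Finset.sum_add_distrib]
      map_smul' := fun c x => by simp [mul_smul, Finset.smul_sum] }
  map_lie x y := by
    have key : ∀ i j, (φ x i * φ y j) • (A i * A j - A j * A i) =
        ∑ k, (φ x i * φ y j * (⁅gen i, gen j⁆ : Schr) k) • A k := by
      intro i j
      by_cases hi : i ∈ T
      · by_cases hj : j ∈ T
        · rw [hA i hi j hj, Finset.smul_sum]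
          simp only [mul_smul]
        · simp [hφ y j hj]
      · simp [hφ x i hi]
    change ∑ k, φ ⁅x, y⁆ k • A k = (∑ g, φ x g • A g) * (∑ g, φ y g • A g)
      - (∑ g, φ y g • A g) * (∑ g, φ x g • A g)
    have h1 : (∑ g, φ x g • A g) * (∑ g, φ y g • A g)
        - (∑ g, φ y g • A g) * (∑ g, φ x g • A g)
        = ∑ i, ∑ j, (φ x i * φ y j) • (A i * A j - A j * A i) := by
      rw [Finset.sum_mul_sum, Finset.sum_mul_sum, Finset.sum_comm (γ := Gen)
        (f := fun i j => (φ y i • A i) * (φ x j • A j)), ← Finset.sum_sub_distrib]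
      refine Finset.sum_congr rfl fun i _ => ?_
      rw [← Finset.sum_sub_distrib]
      refine Finset.sum_congr rfl fun j _ => ?_
      rw [smul_mul_smul_comm, smul_mul_smul_comm, mul_comm (φ y j), smul_sub]
    rw [h1]
    simp only [key, LieHom.map_lie]
    simp_rw [lie_coord (φ x) (φ y), Finset.sum_smul]
    rw [Finset.sum_comm]
    refine Finset.sum_congr rfl fun i _ => ?_
    rw [Finset.sum_comm]

/-- Commutation relations for all labels give a representation of the Schrödinger algebra. -/
def schrRep {V : Type*} [AddCommGroup V] [Module ℂ V] (A : Gen → Module.End ℂ V)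
    (hA : ∀ i j, A i * A j - A j * A i = ∑ k, (⁅gen i, gen j⁆ : Schr) k • A k) : Rep Schr V :=
  repOfOps LieHom.id Finset.univ (fun _ k hk => absurd (Finset.mem_univ k) hk) A
    (fun i _ j _ => hA i j)

/-- Operators on a one-dimensional space: `h` acts as `μ`, `z` acts as `ζ`, and all other
basis vectors act as zero. -/
def charOps (μ ζ : ℂ) : Gen → Module.End ℂ ℂ
  | .h => μ • 1
  | .z => ζ • 1
  | _ => 0

lemma charOps_comm (μ ζ : ℂ) (i j : Gen) :
    charOps μ ζ i * charOps μ ζ j - charOps μ ζ j * charOps μ ζ i = 0 := by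
  cases i <;> cases j <;> simp [charOps, smul_comm μ ζ]

/-! ### Induced modules -/

section Induced

variable {K L : Type*} [LieRing K] [LieAlgebra ℂ K] [LieRing L] [LieAlgebra ℂ L]
  (φ : K →ₗ⁅ℂ⁆ L) (V : Type*) [AddCommGroup V] [Module ℂ V] [LieRingModule K V] [LieModule ℂ K V]

/-- The `U(L)`-submodule of `U(L) ⊗ V` generated by all `φ(y) ⊗ v - 1 ⊗ y v`. -/
def indRel : Submodule (UniversalEnvelopingAlgebra ℂ L) (UniversalEnvelopingAlgebra ℂ L ⊗[ℂ] V) :=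
  Submodule.span _ {w | ∃ (y : K) (v : V),
    w = UniversalEnvelopingAlgebra.ι ℂ (φ y) ⊗ₜ[ℂ] v - 1 ⊗ₜ[ℂ] ⁅y, v⁆}

/-- The induced module `U(L) ⊗_{U(K)} V`. -/
def Ind : Type _ := (UniversalEnvelopingAlgebra ℂ L ⊗[ℂ] V) ⧸ indRel φ V

instance : AddCommGroup (Ind φ V) :=
  inferInstanceAs (AddCommGroup ((UniversalEnvelopingAlgebra ℂ L ⊗[ℂ] V) ⧸ indRel φ V))

instance : Module ℂ (Ind φ V) :=
  inferInstanceAs (Module ℂ ((UniversalEnvelopingAlgebra ℂ L ⊗[ℂ] V) ⧸ indRel φ V))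

instance : Module (UniversalEnvelopingAlgebra ℂ L) (Ind φ V) :=
  inferInstanceAs (Module (UniversalEnvelopingAlgebra ℂ L)
    ((UniversalEnvelopingAlgebra ℂ L ⊗[ℂ] V) ⧸ indRel φ V))

instance : IsScalarTower ℂ (UniversalEnvelopingAlgebra ℂ L) (Ind φ V) :=
  inferInstanceAs (IsScalarTower ℂ (UniversalEnvelopingAlgebra ℂ L)
    ((UniversalEnvelopingAlgebra ℂ L ⊗[ℂ] V) ⧸ indRel φ V))

lemma ι_lie (x y : L) : UniversalEnvelopingAlgebra.ι ℂ ⁅x, y⁆ =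
    UniversalEnvelopingAlgebra.ι ℂ x * UniversalEnvelopingAlgebra.ι ℂ y -
    UniversalEnvelopingAlgebra.ι ℂ y * UniversalEnvelopingAlgebra.ι ℂ x := by
  let _ : LieRing (UniversalEnvelopingAlgebra ℂ L) := LieRing.ofAssociativeRing
  exact (UniversalEnvelopingAlgebra.ι ℂ).map_lie x y

instance : LieRingModule L (Ind φ V) where
  bracket x m := UniversalEnvelopingAlgebra.ι ℂ x • m
  add_lie x y m := by
    change UniversalEnvelopingAlgebra.ι ℂ (x + y) • m = _
    rw [map_add, add_smul]
  lie_add x m n := smul_add _ m n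
  leibniz_lie x y m := by
    change UniversalEnvelopingAlgebra.ι ℂ x • UniversalEnvelopingAlgebra.ι ℂ y • m =
      UniversalEnvelopingAlgebra.ι ℂ ⁅x, y⁆ • m +
      UniversalEnvelopingAlgebra.ι ℂ y • UniversalEnvelopingAlgebra.ι ℂ x • m
    rw [ι_lie, sub_smul, mul_smul, mul_smul]
    abel

lemma ind_lie_def (x : L) (m : Ind φ V) : ⁅x, m⁆ = UniversalEnvelopingAlgebra.ι ℂ x • m := rfl

instance : LieModule ℂ L (Ind φ V) where
  smul_lie c x m := by
    rw [ind_lie_def, ind_lie_def, map_smul, smul_assoc]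
  lie_smul c x m := by
    rw [ind_lie_def, ind_lie_def, smul_algebra_smul_comm]

variable {V} in
/-- The class of `1 ⊗ v`. -/
def Ind.of (v : V) : Ind φ V := Submodule.Quotient.mk (1 ⊗ₜ[ℂ] v)

lemma ind_of_lie (y : K) (v : V) : ⁅φ y, Ind.of φ v⁆ = Ind.of φ ⁅y, v⁆ := by
  rw [ind_lie_def]
  change Submodule.Quotient.mk (UniversalEnvelopingAlgebra.ι ℂ (φ y) • (1 ⊗ₜ[ℂ] v)) =
    Submodule.Quotient.mk _
  rw [Submodule.Quotient.eq, TensorProduct.smul_tmul', smul_eq_mul, mul_one]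
  exact Submodule.subset_span ⟨y, v, rfl⟩

lemma ind_of_smul (c : ℂ) (v : V) : Ind.of φ (c • v) = c • Ind.of φ v := by
  change Submodule.Quotient.mk (1 ⊗ₜ[ℂ] (c • v)) = Submodule.Quotient.mk (c • 1 ⊗ₜ[ℂ] v)
  rw [TensorProduct.tmul_smul]

/-- A central element acting as a scalar on `V` acts as this scalar on the induced module. -/
lemma ind_central (y : K) (hy : ∀ x : L, ⁅x, φ y⁆ = 0) (c : ℂ) (hc : ∀ v : V, ⁅y, v⁆ = c • v)
    (m : Ind φ V) : ⁅φ y, m⁆ = c • m := by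
  have hcomm : ∀ u : UniversalEnvelopingAlgebra ℂ L,
      u * UniversalEnvelopingAlgebra.ι ℂ (φ y) = UniversalEnvelopingAlgebra.ι ℂ (φ y) * u := by
    set w := UniversalEnvelopingAlgebra.ι ℂ (φ y) with hw
    let C : Subalgebra ℂ (UniversalEnvelopingAlgebra ℂ L) := Subalgebra.centralizer ℂ {w}
    have hmem : ∀ x : L, UniversalEnvelopingAlgebra.ι ℂ x ∈ C := by
      intro x
      rw [Subalgebra.mem_centralizer_iff]
      rintro _ rfl
      have := ι_lie (L := L) x (φ y)
      rw [hy x, map_zero] at this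
      exact (sub_eq_zero.mp this.symm).symm
    let _ : LieRing (UniversalEnvelopingAlgebra ℂ L) := LieRing.ofAssociativeRing
    let _ : LieRing C := LieRing.ofAssociativeRing
    let g : L →ₗ⁅ℂ⁆ C :=
      { toFun := fun x => ⟨UniversalEnvelopingAlgebra.ι ℂ x, hmem x⟩
        map_add' := fun a b => Subtype.ext (map_add _ a b)
        map_smul' := fun a b => Subtype.ext (map_smul _ a b)
        map_lie' := fun {a b} => Subtype.ext (ι_lie a b) }
    have hid : C.val.comp (UniversalEnvelopingAlgebra.lift ℂ g) = AlgHom.id ℂ _ := by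
      apply UniversalEnvelopingAlgebra.hom_ext
      refine LieHom.ext fun x => ?_
      have := UniversalEnvelopingAlgebra.lift_ι_apply ℂ g x
      change C.val (UniversalEnvelopingAlgebra.lift ℂ g (UniversalEnvelopingAlgebra.ι ℂ x)) =
        UniversalEnvelopingAlgebra.ι ℂ x
      rw [this]
      rfl
    intro u
    have hu : u ∈ C := by
      have := DFunLike.congr_fun hid u
      change ((UniversalEnvelopingAlgebra.lift ℂ g u : C) : _) = u at this
      rw [← this]
      exact Subtype.property _
    exact ((Subalgebra.mem_centralizer_iff ℂ).mp hu w rfl).symm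
  obtain ⟨t, rfl⟩ := Submodule.Quotient.mk_surjective _ m
  induction t using TensorProduct.induction_on with
  | zero =>
    change ⁅φ y, (0 : Ind φ V)⁆ = c • (0 : Ind φ V)
    rw [lie_zero, smul_zero]
  | add a b ha hb =>
    have : (Submodule.Quotient.mk (a + b) : Ind φ V) =
      (Submodule.Quotient.mk a : Ind φ V) + (Submodule.Quotient.mk b : Ind φ V) := rfl
    rw [this]
    exact (lie_add _ _ _).trans ((congrArg₂ (· + ·) ha hb).trans (smul_add _ _ _).symm)
  | tmul u v =>
    have : (Submodule.Quotient.mk (u ⊗ₜ[ℂ] v) : Ind φ V) = u • Ind.of φ v := by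
      change _ = Submodule.Quotient.mk (u • (1 ⊗ₜ[ℂ] v))
      rw [TensorProduct.smul_tmul', smul_eq_mul, mul_one]
    rw [this, ind_lie_def, ← mul_smul, ← hcomm u, mul_smul, ← ind_lie_def, ind_of_lie, hc,
      ind_of_smul, smul_algebra_smul_comm]

end Induced

/-! ### Simple quotients, weight modules, highest weight modules -/

section Generic

variable (L : Type*) [LieRing L] [LieAlgebra ℂ L] (M : Type*) [AddCommGroup M] [Module ℂ M]
  [LieRingModule L M] [LieModule ℂ L M]

/-- The sum of all proper submodules of `M`. -/
def sumProper : LieSubmodule ℂ L M := sSup {N | N ≠ ⊤}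

/-- The quotient of `M` by the sum of all its proper submodules. When this sum is proper, as for
Verma modules, it is the unique maximal submodule, and this is the unique simple quotient. -/
abbrev SimpleTop : Type _ := M ⧸ sumProper L M

/-- `M` has exactly one submodule with simple quotient. -/
def HasUniqueSimpleQuotient : Prop :=
  ∃! N : LieSubmodule ℂ L M, LieModule.IsIrreducible ℂ L (M ⧸ N)

/-- `M` has exactly one submodule with simple quotient, and this quotient is isomorphic
to `X`. -/
def HasUniqueSimpleQuotientIso (X : Type*) [AddCommGroup X] [Module ℂ X] [LieRingModule L X]
    [LieModule ℂ L X] : Prop :=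
  ∃ N : LieSubmodule ℂ L M, (∀ N' : LieSubmodule ℂ L M,
    LieModule.IsIrreducible ℂ L (M ⧸ N') ↔ N' = N) ∧ Nonempty ((M ⧸ N) ≃ₗ⁅ℂ, L⁆ X)

variable {L} in
/-- `M` is generated by a nonzero vector which is annihilated by `e` and `p` and is
a common eigenvector of `h` and `z`. -/
def GeneratedByHighestWeight (e p h z : L) : Prop :=
  ∃ v : M, v ≠ 0 ∧ ⁅e, v⁆ = 0 ∧ ⁅p, v⁆ = 0 ∧ (∃ μ : ℂ, ⁅h, v⁆ = μ • v) ∧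
    (∃ ζ : ℂ, ⁅z, v⁆ = ζ • v) ∧ LieSubmodule.lieSpan ℂ L {v} = ⊤

end Generic

section Weight

variable (V : Type*) [AddCommGroup V] [Module ℂ V] [LieRingModule ageing V] [LieModule ℂ ageing V]

/-- A weight module over the ageing algebra: every element of the Cartan subalgebra, which is
spanned by `h` and `z`, acts diagonalizably. -/
def IsWeightModule : Prop :=
  ∀ a b : ℂ, ⨆ μ : ℂ, Module.End.eigenspace
    (LieModule.toEnd ℂ ageing V (a • ⟨gen .h, h_mem_ageing⟩ + b • ⟨gen .z, z_mem_ageing⟩)) μ = ⊤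

/-- Highest weight modules over the ageing algebra. -/
def IsHighestWeightAgeing : Prop :=
  GeneratedByHighestWeight V (⟨gen .e, e_mem_ageing⟩ : ageing) ⟨gen .p, p_mem_ageing⟩
    ⟨gen .h, h_mem_ageing⟩ ⟨gen .z, z_mem_ageing⟩

/-- The Schrödinger module induced from a module over the ageing algebra. -/
abbrev InducedSchr : Type _ := Ind ageing.incl V

end Weight

/-- Highest weight modules over the Schrödinger algebra. -/
def IsHighestWeightSchr (M : Type*) [AddCommGroup M] [Module ℂ M] [LieRingModule Schr M]
    [LieModule ℂ Schr M] : Prop :=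
  GeneratedByHighestWeight M (gen .e) (gen .p) (gen .h) (gen .z)

/-! ### Verma modules -/

/-- The one-dimensional module over `span {h, q, z}` with `h ↦ μ`, `z ↦ ζ`, `q ↦ 0`. -/
def ageingLowChar (ζ μ : ℂ) : Rep ageingLow ℂ :=
  repOfOps ageingLow.incl {.h, .q, .z} (fun x k hk => x.2 k hk) (charOps μ ζ) (by
    intro i hi j hj
    rw [charOps_comm, lie_def]
    cases i <;> cases j <;> simp [sum_gen, bracket, gen_coord, charOps] at *)

/-- The one-dimensional module over `span {q, z}` with `z ↦ ζ`, `q ↦ 0`. -/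
def heisLowChar (ζ : ℂ) : Rep heisLow ℂ :=
  repOfOps heisLow.incl {.q, .z} (fun x k hk => x.2 k hk) (charOps 0 ζ) (by
    intro i hi j hj
    rw [charOps_comm, lie_def]
    cases i <;> cases j <;> simp [sum_gen, bracket, gen_coord, charOps] at *)

/-- The one-dimensional module over `span {e, h}` with `h ↦ μ`, `e ↦ 0`. -/
def sl2BorelChar (μ : ℂ) : Rep sl2Borel ℂ :=
  repOfOps sl2Borel.incl {.e, .h} (fun x k hk => x.2 k hk) (charOps μ 0) (by
    intro i hi j hj
    rw [charOps_comm, lie_def]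
    cases i <;> cases j <;> simp [sum_gen, bracket, gen_coord, charOps] at *)

/-- The lowest weight Verma module over the ageing algebra with central charge `ζ` and lowest
weight `μ`. -/
abbrev vermaAgeingLow (ζ μ : ℂ) : Type :=
  Ind (LieSubalgebra.inclusion ageingLow_le) (ageingLowChar ζ μ).Space

/-- Its simple quotient. -/
abbrev simpleAgeingLow (ζ μ : ℂ) : Type := SimpleTop ageing (vermaAgeingLow ζ μ)

/-- The lowest weight Verma module over the Heisenberg algebra with central charge `ζ`. -/
abbrev vermaHeisLow (ζ : ℂ) : Type :=
  Ind (LieSubalgebra.inclusion heisLow_le) (heisLowChar ζ).Space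

/-- The Verma module over `sl₂` with highest weight `μ`. -/
abbrev vermaSl2 (μ : ℂ) : Type :=
  Ind (LieSubalgebra.inclusion sl2Borel_le) (sl2BorelChar μ).Space

/-- Its simple quotient. -/
abbrev simpleSl2 (μ : ℂ) : Type := SimpleTop sl2 (vermaSl2 μ)

lemma vermaHeisLow_central (ζ : ℂ) (m : vermaHeisLow ζ) :
    ⁅(⟨gen .z, z_mem_heis⟩ : heis), m⁆ = ζ • m := by
  refine ind_central (LieSubalgebra.inclusion heisLow_le) (heisLowChar ζ).Space
    ⟨gen .z, z_mem_heisLow⟩ ?_ ζ ?_ m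
  · intro x
    apply Subtype.ext
    change ⁅(x : Schr), gen .z⁆ = 0
    rw [← lie_skew, lie_relations.2.2.2.2.2.2.2.2.2.2, neg_zero]
  · intro v
    change (∑ g, (gen .z : Schr) g • charOps 0 ζ g) v = _
    simp [gen_coord, charOps]
    rfl

/-! ### Extending modules over the Heisenberg algebra and over `sl₂` -/

/-- The operators of the Schrödinger algebra on a module over the Heisenberg algebra with nonzero
central charge `ζ`: `e = p² / (2ζ)`, `f = -q² / (2ζ)`, `h = -pq / ζ + 1 / 2`. -/
def heisOps (ζ : ℂ) {A : Type*} [Ring A] [Algebra ℂ A] (P Q Z : A) : Gen → A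
  | .e => (1 / (2 * ζ)) • (P * P)
  | .f => (-(1 / (2 * ζ))) • (Q * Q)
  | .h => (-(1 / ζ)) • (P * Q) + (1 / 2 : ℂ) • 1
  | .p => P
  | .q => Q
  | .z => Z

lemma heisOps_comm (ζ : ℂ) (hζ : ζ ≠ 0) {A : Type*} [Ring A] [Algebra ℂ A]
    (P Q Z : A) (hZ : Z = ζ • 1) (hPQ : P * Q - Q * P = Z) (i j : Gen) :
    heisOps ζ P Q Z i * heisOps ζ P Q Z j - heisOps ζ P Q Z j * heisOps ζ P Q Z i =
      ∑ k, (⁅gen i, gen j⁆ : Schr) k • heisOps ζ P Q Z k := by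
  subst hZ
  have h1 : Q * P = P * Q - ζ • 1 := by rw [← hPQ]; abel
  have h2 : ∀ X, Q * (P * X) = P * (Q * X) - ζ • X := by
    intro X
    rw [← mul_assoc, h1, sub_mul, mul_assoc, smul_mul_assoc, one_mul]
  rw [sum_lie_gen]
  cases i <;> cases j <;>
    simp only [heisOps, bracket, gen_coord, mul_add, add_mul, mul_sub, sub_mul, smul_mul_assoc,
      mul_smul_comm, mul_assoc, h1, h2, mul_one, one_mul, reduceCtorEq, if_true, if_false,
      mul_zero, zero_mul, sub_zero, zero_sub, zero_smul, add_zero, zero_add] <;>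
    match_scalars <;> (try field_simp) <;> ring

section HeisExt

variable (ζ : ℂ) (hζ : ζ ≠ 0) (V : Type*) [AddCommGroup V] [Module ℂ V] [LieRingModule heis V]
  [LieModule ℂ heis V] (hV : ∀ v : V, ⁅(⟨gen .z, z_mem_heis⟩ : heis), v⁆ = ζ • v)

/-- The extension of a module `V` over the Heisenberg algebra with nonzero central charge `ζ` to
the Schrödinger algebra. -/
def heisExt : Rep Schr V :=
  schrRep (heisOps ζ (LieModule.toEnd ℂ heis V ⟨gen .p, p_mem_heis⟩)
    (LieModule.toEnd ℂ heis V ⟨gen .q, q_mem_heis⟩)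
    (LieModule.toEnd ℂ heis V ⟨gen .z, z_mem_heis⟩)) (by
    refine heisOps_comm ζ hζ _ _ _ ?_ ?_
    · ext v
      exact hV v
    · ext v
      have : (⟨gen .z, z_mem_heis⟩ : heis) =
          ⁅(⟨gen .p, p_mem_heis⟩ : heis), (⟨gen .q, q_mem_heis⟩ : heis)⁆ :=
        Subtype.ext lie_relations.2.2.2.2.2.2.2.2.2.1.symm
      rw [this]
      simp)

end HeisExt

/-- The extension of an `sl₂`-module to the Schrödinger algebra on which the Heisenberg algebra
acts as zero. -/
def sl2Ext (W : Type*) [AddCommGroup W] [Module ℂ W] [LieRingModule sl2 W]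
    [LieModule ℂ sl2 W] : Rep Schr W where
  act := (LieModule.toEnd ℂ sl2 W : sl2 →ₗ[ℂ] Module.End ℂ W) ∘ₗ (projSl2 : Schr →ₗ[ℂ] sl2)
  map_lie x y := by
    ext w
    simp

/-! ## Modules on Laurent polynomials -/

section Graded

variable {N : Type*} [AddCommGroup N] [Module ℂ N]

/-- The space `N ⊗ ℂ[x, x⁻¹]` is realized as `ℤ →₀ N`, where `Finsupp.single i v` stands for
`v ⊗ xⁱ`. This is the operator `v ⊗ xⁱ ↦ (A i v) ⊗ x^(i + d)`. -/
def shiftOp (d : ℤ) (A : ℤ → Module.End ℂ N) : Module.End ℂ (ℤ →₀ N) :=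
  Finsupp.lsum ℂ fun i => Finsupp.lsingle (i + d) ∘ₗ A i

lemma shiftOp_single (d : ℤ) (A : ℤ → Module.End ℂ N) (i : ℤ) (v : N) :
    shiftOp d A (Finsupp.single i v) = Finsupp.single (i + d) (A i v) := by
  simp [shiftOp]

/-- The `x`-degree of the action of each basis vector. -/
def deg : Gen → ℤ
  | .e => -2
  | .f => 2
  | .h => 0
  | .p => -1
  | .q => 1
  | .z => 0

/-- The operators `v ⊗ xⁱ ↦ (B g i v) ⊗ x^(i + deg g)`. -/
def gradedOps (B : Gen → ℤ → Module.End ℂ N) (g : Gen) : Module.End ℂ (ℤ →₀ N) :=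
  shiftOp (deg g) (B g)

lemma gradedOps_comm (B : Gen → ℤ → Module.End ℂ N) (g g' : Gen)
    (H : ∀ i, B g (i + deg g') * B g' i - B g' (i + deg g) * B g i =
      ∑ k, (⁅gen g, gen g'⁆ : Schr) k • B k i) :
    gradedOps B g * gradedOps B g' - gradedOps B g' * gradedOps B g =
      ∑ k, (⁅gen g, gen g'⁆ : Schr) k • gradedOps B k := by
  have hdeg : ∀ k, (⁅gen g, gen g'⁆ : Schr) k ≠ 0 → deg k = deg g + deg g' := by
    intro k hk
    rw [lie_def] at hk
    cases g <;> cases g' <;> cases k <;> simp [bracket, gen_coord, deg] at *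
  refine Finsupp.lhom_ext fun i v => ?_
  have H' := DFunLike.congr_fun (H i) v
  have hsum : ∀ (j : ℤ) (F : Gen → N),
      Finsupp.single j (∑ k, F k) = ∑ k, Finsupp.single j (F k) := fun j F =>
    map_sum (Finsupp.singleAddHom j) F Finset.univ
  simp only [LinearMap.sub_apply, Module.End.mul_apply, LinearMap.sum_apply,
    LinearMap.smul_apply] at H' ⊢
  simp only [gradedOps, shiftOp_single]
  have e1 : i + deg g' + deg g = i + (deg g + deg g') := by ring
  have e2 : i + deg g + deg g' = i + (deg g + deg g') := by ring
  rw [e1, e2, ← Finsupp.single_sub, H', hsum]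
  refine Finset.sum_congr rfl fun k _ => ?_
  by_cases hk : (⁅gen g, gen g'⁆ : Schr) k = 0
  · simp [hk]
  · rw [hdeg k hk, Finsupp.smul_single]

end Graded

/-- The action on `ℂ[x, x⁻¹]` defining `Q(lam, η)`: `z` and `p` act as zero,
`q xⁱ = x^(i+1)`, `e xⁱ = lam x^(i-2)`, `h xⁱ = (η - i) xⁱ`. -/
def qOps (lam η : ℂ) : Gen → ℤ → Module.End ℂ ℂ
  | .e, _ => lam • 1
  | .h, i => (η - i) • 1
  | .q, _ => 1
  | _, _ => 0

/-- The module `Q(lam, η)` over the ageing algebra. -/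
def modQ (lam η : ℂ) : Rep ageing (ℤ →₀ ℂ) :=
  repOfOps ageing.incl {.e, .h, .p, .q, .z} (fun x k hk => x.2 k hk) (gradedOps (qOps lam η)) (by
    intro g hg g' hg'
    refine gradedOps_comm _ _ _ fun i => ?_
    rw [sum_lie_gen]
    cases g <;> cases g' <;> simp at hg hg' <;>
      simp only [qOps, deg, smul_mul_assoc, mul_smul_comm, mul_one, one_mul,
        reduceCtorEq, if_true, if_false, mul_zero, zero_mul, sub_zero, zero_sub, zero_smul,
        add_zero, zero_add, smul_zero] <;>
      first
      | done
      | (match_scalars <;> push_cast <;> ring))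

/-- The action on `ℂ[x, x⁻¹]` defining `Q'(ζ, η, lam)`: `q xⁱ = x^(i+1)`,
`p xⁱ = ζ (lam + i) x^(i-1)`, `z xⁱ = ζ xⁱ`, `h xⁱ = (η - i) xⁱ`,
`e xⁱ = (ζ / 2) (lam + i) (lam + i - 1) x^(i-2)`. -/
def qOps' (ζ η lam : ℂ) : Gen → ℤ → Module.End ℂ ℂ
  | .e, i => (ζ / 2 * (lam + i) * (lam + i - 1)) • 1
  | .f, _ => 0
  | .h, i => (η - i) • 1
  | .p, i => (ζ * (lam + i)) • 1
  | .q, _ => 1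
  | .z, _ => ζ • 1

lemma qOps'_comm (ζ η lam : ℂ) (g g' : Gen) (hg : g ≠ .f) (hg' : g' ≠ .f) :
    gradedOps (qOps' ζ η lam) g * gradedOps (qOps' ζ η lam) g' -
      gradedOps (qOps' ζ η lam) g' * gradedOps (qOps' ζ η lam) g =
      ∑ k, (⁅gen g, gen g'⁆ : Schr) k • gradedOps (qOps' ζ η lam) k := by
  refine gradedOps_comm _ _ _ fun i => ?_
  rw [sum_lie_gen]
  cases g <;> cases g' <;> simp at hg hg' <;>
    simp only [qOps', deg, smul_mul_assoc, mul_smul_comm, mul_one, one_mul,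
      reduceCtorEq, if_true, if_false, mul_zero, zero_mul, sub_zero, zero_sub, zero_smul,
      add_zero, zero_add, smul_zero] <;>
    match_scalars <;> push_cast <;> ring

/-- The module `Q'(ζ, η, lam)` over the ageing algebra. -/
def modQ' (ζ η lam : ℂ) : Rep ageing (ℤ →₀ ℂ) :=
  repOfOps ageing.incl {.e, .h, .p, .q, .z} (fun x k hk => x.2 k hk)
    (gradedOps (qOps' ζ η lam)) (by
    intro g hg g' hg'
    exact qOps'_comm ζ η lam g g' (by rintro rfl; simp at hg) (by rintro rfl; simp at hg'))

/-- The module `G(ζ, lam)` over the Heisenberg algebra: `q xⁱ = x^(i+1)`,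
`p xⁱ = ζ (lam + i) x^(i-1)`, `z xⁱ = ζ xⁱ`. -/
def modG (ζ lam : ℂ) : Rep heis (ℤ →₀ ℂ) :=
  repOfOps heis.incl {.p, .q, .z} (fun x k hk => x.2 k hk)
    (gradedOps (qOps' ζ 0 lam)) (by
    intro g hg g' hg'
    exact qOps'_comm ζ 0 lam g g' (by rintro rfl; simp at hg) (by rintro rfl; simp at hg'))

lemma modG_central (ζ lam : ℂ) (v : (modG ζ lam).Space) :
    ⁅(⟨gen .z, z_mem_heis⟩ : heis), v⁆ = ζ • v := by
  change (∑ g, (gen .z : Schr) g • gradedOps (qOps' ζ 0 lam) g) v = _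
  have : gradedOps (qOps' ζ 0 lam) .z = ζ • 1 := by
    refine Finsupp.lhom_ext fun i a => ?_
    simp [gradedOps, shiftOp_single, qOps', deg]
  simp [gen_coord, this]
  rfl

/-! ## Modules obtained from subalgebras of the Weyl algebra -/

open Polynomial in
/-- Multiplication by `t` on `ℂ[t]`. -/
def weylT : Module.End ℂ ℂ[X] := LinearMap.mulLeft ℂ X

open Polynomial in
/-- The derivative on `ℂ[t]`. -/
def weylD : Module.End ℂ ℂ[X] := Polynomial.derivative

lemma weyl_comm : weylD * weylT = weylT * weylD + 1 := by
  refine LinearMap.ext fun f => ?_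
  simp [weylD, weylT, add_comm]

/-- `t² d/dt` if `ζ = 0`, and `t d/dt` if `ζ ≠ 0`. -/
def weylS (ζ : ℂ) : Module.End ℂ (Polynomial ℂ) :=
  if ζ = 0 then weylT ^ 2 * weylD else weylT * weylD

/-- The subalgebra of the first Weyl algebra, acting on `ℂ[t]`, generated by `t` and `t² d/dt`
if `ζ = 0`, and by `t` and `t d/dt` if `ζ ≠ 0`. -/
def R (ζ : ℂ) : Subalgebra ℂ (Module.End ℂ (Polynomial ℂ)) :=
  Algebra.adjoin ℂ {weylT, weylS ζ}

/-- The generator `t` of `R ζ`. -/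
def R.t (ζ : ℂ) : R ζ := ⟨weylT, Algebra.subset_adjoin (by simp)⟩

/-- The generator `t² d/dt` or `t d/dt` of `R ζ`. -/
def R.s (ζ : ℂ) : R ζ := ⟨weylS ζ, Algebra.subset_adjoin (by simp)⟩

lemma R.s_mul_t (ζ : ℂ) :
    R.s ζ * R.t ζ = R.t ζ * R.s ζ + if ζ = 0 then R.t ζ * R.t ζ else R.t ζ := by
  apply Subtype.ext
  split_ifs with h
  · simp only [R.s, R.t, weylS, h, if_true, Subalgebra.coe_mul, Subalgebra.coe_add]
    rw [mul_assoc, weyl_comm]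
    noncomm_ring
  · simp only [R.s, R.t, weylS, h, if_false, Subalgebra.coe_mul, Subalgebra.coe_add]
    rw [mul_assoc, weyl_comm]
    noncomm_ring

/-- The element of `R ζ` representing `pq`: `t` if `ζ = 0`, and `2ζ t d/dt` otherwise. -/
def R.pq (ζ : ℂ) : R ζ := if ζ = 0 then R.t ζ else (2 * ζ) • R.s ζ

/-- The element of `R ζ` representing `eq²`: `t² d/dt` if `ζ = 0`, and
`t + ζ t d/dt + 2ζ (t d/dt)²` otherwise. -/
def R.eqq (ζ : ℂ) : R ζ := if ζ = 0 then R.s ζ else R.t ζ + ζ • R.s ζ + (2 * ζ) • R.s ζ ^ 2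

lemma R.eqq_mul_pq (ζ : ℂ) : R.eqq ζ * R.pq ζ =
    R.pq ζ * R.eqq ζ + R.pq ζ * R.pq ζ + ζ • R.pq ζ + (-2 * ζ) • R.eqq ζ := by
  have h1 := R.s_mul_t ζ
  by_cases h : ζ = 0
  · simp only [R.eqq, R.pq, h, if_true] at h1 ⊢
    rw [h1]; simp
  · simp only [R.eqq, R.pq, h, if_false] at h1 ⊢
    simp only [mul_add, add_mul, smul_mul_assoc, mul_smul_comm, h1, pow_two, mul_assoc, smul_add,
      smul_smul]
    match_scalars <;> ring

section WeylIdentities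
variable {A : Type*} [Ring A] {a b d : A}

lemma weyl_inv (hab : a * b = 1) (hba : b * a = 1) (hda : d * a = a * d + 1) : d * b = b * d - b * b := by
  have hab' : ∀ X, a * (b * X) = X := fun X => by rw [← mul_assoc, hab, one_mul]
  have hba' : ∀ X, b * (a * X) = X := fun X => by rw [← mul_assoc, hba, one_mul]
  have h : a * (d * b) = a * (b * d - b * b) := by
    rw [mul_sub, hab', hab', ← mul_assoc, eq_sub_of_add_eq hda.symm, sub_mul, mul_assoc, hab]
    simp
  have := congrArg (b * ·) h
  simpa only [hba'] using this

variable [Algebra ℂ A]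

lemma weyl_zero (hab : a * b = 1) (hba : b * a = 1) (hda : d * a = a * d + 1) (η c : ℂ) {X Y F : A} (hX : X = a) (hY : Y = a * (a * d))
    (hF : F = d + (η - 2) • b + c • (b * b)) :
    F * X - X * F = 1 ∧ Y * F - F * Y + (2 : ℂ) • (F * X) = η • 1 := by
  have hdb := weyl_inv hab hba hda
  have hab' : ∀ X, a * (b * X) = X := fun X => by rw [← mul_assoc, hab, one_mul]
  have hba' : ∀ X, b * (a * X) = X := fun X => by rw [← mul_assoc, hba, one_mul]
  have hda' : ∀ X, d * (a * X) = a * (d * X) + X := fun X => by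
    rw [← mul_assoc, hda, add_mul, mul_assoc, one_mul]
  have hdb' : ∀ X, d * (b * X) = b * (d * X) - b * (b * X) := fun X => by
    rw [← mul_assoc, hdb, sub_mul, mul_assoc, mul_assoc]
  subst hX hY hF
  constructor <;>
  · simp only [mul_add, add_mul, mul_sub, sub_mul, smul_mul_assoc, mul_smul_comm, mul_assoc,
      hab, hba, hda, hdb, hab', hba', hda', hdb', mul_one]
    match_scalars <;> ring

lemma weyl_nonzero (hab : a * b = 1) (hba : b * a = 1) (hda : d * a = a * d + 1) (ζ η c : ℂ) (hζ : ζ ≠ 0) {X Y F : A}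
    (hX : X = (2 * ζ) • (a * d))
    (hY : Y = a + ζ • (a * d) + (2 * ζ) • (a * d * (a * d)))
    (hF : F = -((1 / (2 * ζ)) • (1 : A)) - (η - 1 / 2) • d - a * (d * d)
      - ((η - 1) * (η - 2) / 4 + c / (2 * ζ)) • b) :
    F * X - X * F = 1 + (2 * ζ) • F ∧ Y * F - F * Y + (2 : ℂ) • (F * X) = η • 1 + ζ • F := by
  have hdb := weyl_inv hab hba hda
  have hab' : ∀ X, a * (b * X) = X := fun X => by rw [← mul_assoc, hab, one_mul]
  have hba' : ∀ X, b * (a * X) = X := fun X => by rw [← mul_assoc, hba, one_mul]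
  have hda' : ∀ X, d * (a * X) = a * (d * X) + X := fun X => by
    rw [← mul_assoc, hda, add_mul, mul_assoc, one_mul]
  have hdb' : ∀ X, d * (b * X) = b * (d * X) - b * (b * X) := fun X => by
    rw [← mul_assoc, hdb, sub_mul, mul_assoc, mul_assoc]
  subst hX hY hF
  constructor <;>
  · simp only [mul_add, add_mul, mul_sub, sub_mul, smul_mul_assoc, mul_smul_comm, mul_assoc,
      neg_mul, mul_neg, hab, hba, hda, hdb, hab', hba', hda', hdb', mul_one, one_mul]
    match_scalars <;> field_simp <;> ring
/-- The coefficient at `x^(i + deg g)` of the action of the basis vector `g` on `v ⊗ xⁱ`, where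
`X`, `Y` are the operators representing `pq` and `eq²`, and `F` is the operator for `f`. -/
def laurentOps (ζ η : ℂ) (X Y F : A) : Gen → ℤ → A
  | .e, i => Y + (i - 2 : ℂ) • X + ((i - 1 : ℂ) * (i - 2) / 2 * ζ) • 1
  | .f, _ => F
  | .h, i => (η - i) • 1
  | .p, i => X + ((i - 1 : ℂ) * ζ) • 1
  | .q, _ => 1
  | .z, _ => ζ • 1

lemma laurentOps_comm (ζ η : ℂ) {X Y F : A}
    (hYX : Y * X = X * Y + X * X + ζ • X + (-2 * ζ) • Y) (g g' : Gen)
    (H : (F * X = X * F + 1 + (2 * ζ) • F ∧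
      Y * F = F * Y - (2 : ℂ) • (X * F) + (η - 2) • 1 - (3 * ζ) • F) ∨ (g ≠ .f ∧ g' ≠ .f))
    (i : ℤ) :
    laurentOps ζ η X Y F g (i + deg g') * laurentOps ζ η X Y F g' i -
      laurentOps ζ η X Y F g' (i + deg g) * laurentOps ζ η X Y F g i =
      ∑ k, (⁅gen g, gen g'⁆ : Schr) k • laurentOps ζ η X Y F k i := by
  rw [sum_lie_gen]
  cases g <;> cases g' <;>
    simp only [ne_eq, reduceCtorEq, not_true, not_false_eq_true, and_true, and_false, or_true,
      or_false] at H <;>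
    simp only [laurentOps, deg, mul_add, add_mul, mul_sub, smul_mul_assoc,
      mul_smul_comm, hYX, H, mul_one, one_mul, reduceCtorEq, if_true, if_false, mul_zero, zero_mul,
      sub_zero, zero_sub, zero_smul, add_zero, zero_add, smul_zero] <;>
    match_scalars <;> push_cast <;> ring

end WeylIdentities

section WeylModules

variable (ζ η : ℂ) (N : Type*) [AddCommGroup N] [Module ℂ N] [Module (R ζ) N]
  [IsScalarTower ℂ (R ζ) N]

/-- The operator by which an element of `R ζ` acts on `N`. -/
def opN : R ζ →ₐ[ℂ] Module.End ℂ N := Algebra.lsmul ℂ ℂ N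

/-- The action of the ageing algebra on `N ⊗ ℂ[x, x⁻¹]`. -/
def nOps : Gen → ℤ → Module.End ℂ N :=
  laurentOps ζ η (opN ζ N (R.pq ζ)) (opN ζ N (R.eqq ζ)) 0

lemma opN_eqq_mul_pq : opN ζ N (R.eqq ζ) * opN ζ N (R.pq ζ) =
    opN ζ N (R.pq ζ) * opN ζ N (R.eqq ζ) + opN ζ N (R.pq ζ) * opN ζ N (R.pq ζ)
      + ζ • opN ζ N (R.pq ζ) + (-2 * ζ) • opN ζ N (R.eqq ζ) := by
  have h3 := congrArg (opN ζ N) (R.eqq_mul_pq ζ)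
  simp only [map_mul, map_add, map_smul] at h3
  exact h3

/-- The module `N_{ζ,η}` over the ageing algebra. -/
def modN : Rep ageing (ℤ →₀ N) :=
  repOfOps ageing.incl {.e, .h, .p, .q, .z} (fun x k hk => x.2 k hk)
    (gradedOps (nOps ζ η N)) (by
    intro g hg g' hg'
    exact gradedOps_comm _ _ _ (laurentOps_comm ζ η (opN_eqq_mul_pq ζ N) g g'
      (Or.inr ⟨by rintro rfl; simp at hg, by rintro rfl; simp at hg'⟩)))

section Simple

variable {N} [IsSimpleModule (R ζ) N]

lemma stable_trivial (W : Submodule ℂ N) (ht : ∀ w ∈ W, R.t ζ • w ∈ W)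
    (hs : ∀ w ∈ W, R.s ζ • w ∈ W) : W = ⊥ ∨ W = ⊤ := by
  have hr : ∀ (r : Module.End ℂ (Polynomial ℂ)) (hr : r ∈ R ζ), ∀ w ∈ W,
      (⟨r, hr⟩ : R ζ) • w ∈ W := by
    intro r hr
    induction hr using Algebra.adjoin_induction with
    | mem x hx =>
      rcases hx with rfl | rfl
      · exact ht
      · exact hs
    | algebraMap c =>
      intro w hw
      have : (⟨algebraMap ℂ _ c, Subalgebra.algebraMap_mem _ c⟩ : R ζ) = c • (1 : R ζ) :=
        (Algebra.algebraMap_eq_smul_one (A := R ζ) c)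
      rw [this, smul_assoc, one_smul]
      exact W.smul_mem c hw
    | add x y hx hy h1 h2 =>
      intro w hw
      have := W.add_mem (h1 w hw) (h2 w hw)
      rw [← add_smul] at this
      exact this
    | mul x y hx hy h1 h2 =>
      intro w hw
      have := h1 _ (h2 w hw)
      rw [← mul_smul] at this
      exact this
  let W' : Submodule (R ζ) N :=
    { W with smul_mem' := fun r w hw => hr r.1 r.2 w hw }
  have : IsSimpleOrder (Submodule (R ζ) N) := (‹IsSimpleModule (R ζ) N›).toIsSimpleOrder
  rcases eq_bot_or_eq_top W' with h | h
  · left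
    ext w
    have : w ∈ W' ↔ w ∈ (⊥ : Submodule (R ζ) N) := by rw [h]
    rw [Submodule.mem_bot] at this ⊢
    exact this
  · right
    ext w
    have : w ∈ W' ↔ w ∈ (⊤ : Submodule (R ζ) N) := by rw [h]
    exact ⟨fun _ => Submodule.mem_top, fun _ => this.2 Submodule.mem_top⟩

lemma finite_of_t_eq_zero (ht : ∀ w : N, R.t ζ • w = 0) : Module.Finite ℂ N := by
  have hnt : Nontrivial N := IsSimpleModule.nontrivial (R ζ) N
  obtain ⟨v, hv⟩ := exists_ne (0 : N)
  let D : Module.End ℂ N := opN ζ N (R.s ζ)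
  have hD : ∀ w, R.s ζ • w = D w := fun _ => rfl
  let F : Polynomial ℂ →ₗ[ℂ] N :=
    (LinearMap.applyₗ v).comp (Polynomial.aeval D).toLinearMap
  have hF : ∀ f, F f = Polynomial.aeval D f v := fun _ => rfl
  have hFX : ∀ f, F (Polynomial.X * f) = D (F f) := by
    intro f
    simp [hF]
  have hstab : ∀ W : Submodule ℂ N, (∀ w ∈ W, D w ∈ W) → W = ⊥ ∨ W = ⊤ := fun W hW =>
    stable_trivial ζ W (fun w _ => by rw [ht]; exact W.zero_mem) hW
  have htop : LinearMap.range F = ⊤ := by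
    refine (hstab (LinearMap.range F) ?_).resolve_left ?_
    · rintro _ ⟨f, rfl⟩
      exact ⟨Polynomial.X * f, hFX f⟩
    · intro h
      have : F 1 ∈ LinearMap.range F := ⟨1, rfl⟩
      rw [h, Submodule.mem_bot] at this
      exact hv (by simpa [hF] using this)
  obtain ⟨f, hf0, hf⟩ : ∃ f : Polynomial ℂ, f ≠ 0 ∧ F f = 0 := by
    let W : Submodule ℂ N := LinearMap.range (F.comp (LinearMap.mulLeft ℂ Polynomial.X))
    rcases hstab W (by
      rintro _ ⟨f, rfl⟩
      refine ⟨Polynomial.X * f, ?_⟩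
      change F (Polynomial.X * (Polynomial.X * f)) = D (F (Polynomial.X * f))
      rw [hFX]) with h | h
    · refine ⟨Polynomial.X, Polynomial.X_ne_zero, ?_⟩
      have : F (Polynomial.X * 1) ∈ W := ⟨1, rfl⟩
      rw [h, Submodule.mem_bot, mul_one] at this
      exact this
    · have : F 1 ∈ W := by rw [h]; trivial
      obtain ⟨g, hg⟩ := this
      change F (Polynomial.X * g) = F 1 at hg
      refine ⟨Polynomial.X * g - 1, ?_, by rw [map_sub, hg, sub_self]⟩
      intro h0
      have := congrArg (Polynomial.eval 0) h0
      simp at this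
  have hmod : ∀ g, F g = F (g % f) := by
    intro g
    conv_lhs => rw [← EuclideanDomain.mod_add_div g f]
    rw [map_add, mul_comm f]
    have : F (g / f * f) = 0 := by
      have h0 : Polynomial.aeval D f v = 0 := hf
      rw [hF, map_mul, Module.End.mul_apply, h0, map_zero]
    rw [this, add_zero]
  let E := Polynomial.degreeLT ℂ f.natDegree
  have : Module.Finite ℂ E := Module.Finite.equiv (Polynomial.degreeLTEquiv ℂ f.natDegree).symm
  refine Module.Finite.of_surjective (F.comp E.subtype) fun w => ?_
  have hw : w ∈ LinearMap.range F := by rw [htop]; trivial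
  obtain ⟨g, rfl⟩ := hw
  refine ⟨⟨g % f, ?_⟩, (hmod g).symm⟩
  rw [Polynomial.mem_degreeLT, ← Polynomial.degree_eq_natDegree hf0]
  exact EuclideanDomain.mod_lt g hf0

/-- On an infinite-dimensional simple `R ζ`-module the generator `t` acts bijectively. -/
lemma t_bijective (hN : ¬ Module.Finite ℂ N) : Function.Bijective (opN ζ N (R.t ζ)) := by
  have hcomm : ∀ w : N, R.s ζ • R.t ζ • w = R.t ζ • (R.s ζ • w + if ζ = 0 then R.t ζ • w else w) := by
    intro w
    rw [← mul_smul, R.s_mul_t, add_smul, smul_add, mul_smul]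
    split_ifs <;> simp [mul_smul]
  have hop : ∀ w, opN ζ N (R.t ζ) w = R.t ζ • w := fun _ => rfl
  have hne : ¬ ∀ w : N, R.t ζ • w = 0 := fun h => hN (finite_of_t_eq_zero ζ h)
  constructor
  · rw [← LinearMap.ker_eq_bot]
    refine (stable_trivial ζ (LinearMap.ker (opN ζ N (R.t ζ))) ?_ ?_).resolve_right ?_
    · intro w hw
      rw [LinearMap.mem_ker, hop] at *
      rw [hw, smul_zero]
    · intro w hw
      rw [LinearMap.mem_ker, hop] at *
      have := hcomm w
      rw [hw, smul_zero, smul_add] at this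
      split_ifs at this
      · rw [smul_zero, add_zero] at this
        exact this.symm
      · rw [hw, add_zero] at this
        exact this.symm
    · intro h
      refine hne fun w => ?_
      have : w ∈ LinearMap.ker (opN ζ N (R.t ζ)) := by rw [h]; trivial
      exact this
  · rw [← LinearMap.range_eq_top]
    refine (stable_trivial ζ (LinearMap.range (opN ζ N (R.t ζ))) ?_ ?_).resolve_left ?_
    · rintro _ ⟨w, rfl⟩
      exact ⟨R.t ζ • w, rfl⟩
    · rintro _ ⟨w, rfl⟩
      exact ⟨_, (hcomm w).symm⟩
    · intro h
      refine hne fun w => ?_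
      have : R.t ζ • w ∈ LinearMap.range (opN ζ N (R.t ζ)) := ⟨w, rfl⟩
      rwa [h, Submodule.mem_bot] at this

variable (N) (hN : ¬ Module.Finite ℂ N)

/-- The inverse of the action of `t` on an infinite-dimensional simple `R ζ`-module. -/
def tInv : Module.End ℂ N := (LinearEquiv.ofBijective _ (t_bijective ζ hN)).symm

/-- The action of `d/dt` on an infinite-dimensional simple `R ζ`-module, where `t` is invertible:
`t⁻² (t² d/dt)` if `ζ = 0`, and `t⁻¹ (t d/dt)` otherwise. -/
def dN : Module.End ℂ N :=
  if ζ = 0 then tInv ζ N hN ^ 2 * opN ζ N (R.s ζ) else tInv ζ N hN * opN ζ N (R.s ζ)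

lemma t_mul_tInv : opN ζ N (R.t ζ) * tInv ζ N hN = 1 :=
  LinearMap.ext fun w => (LinearEquiv.ofBijective _ (t_bijective ζ hN)).apply_symm_apply w

lemma tInv_mul_t : tInv ζ N hN * opN ζ N (R.t ζ) = 1 :=
  LinearMap.ext fun w => (LinearEquiv.ofBijective _ (t_bijective ζ hN)).symm_apply_apply w

lemma opN_s : opN ζ N (R.s ζ) = if ζ = 0 then opN ζ N (R.t ζ) * (opN ζ N (R.t ζ) * dN ζ N hN)
    else opN ζ N (R.t ζ) * dN ζ N hN := by
  have h := t_mul_tInv ζ N hN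
  have h2 : ∀ X, opN ζ N (R.t ζ) * (tInv ζ N hN * X) = X := fun X => by
    rw [← mul_assoc, h, one_mul]
  unfold dN
  split_ifs <;> simp [pow_two, mul_assoc, h2]

lemma dN_mul_t : dN ζ N hN * opN ζ N (R.t ζ) = opN ζ N (R.t ζ) * dN ζ N hN + 1 := by
  have h1 := congrArg (opN ζ N) (R.s_mul_t ζ)
  have h3 := t_mul_tInv ζ N hN
  have h4 := tInv_mul_t ζ N hN
  have h2 : ∀ X, opN ζ N (R.t ζ) * (tInv ζ N hN * X) = X := fun X => by
    rw [← mul_assoc, h3, one_mul]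
  have h5 : ∀ X, tInv ζ N hN * (opN ζ N (R.t ζ) * X) = X := fun X => by
    rw [← mul_assoc, h4, one_mul]
  unfold dN
  split_ifs at h1 ⊢
  · simp only [map_mul, map_add] at h1
    simp only [pow_two, mul_assoc, h1, mul_add, h2, h5, h4]
  · simp only [map_mul, map_add] at h1
    simp only [mul_assoc, h1, mul_add, h2, h5, h4]

/-- The action of `f` on the extension of `N_{ζ,η}` with parameter `c`. -/
def fOp (c : ℂ) : Module.End ℂ N :=
  if ζ = 0 then
    dN ζ N hN + (η - 2) • tInv ζ N hN + c • tInv ζ N hN ^ 2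
  else
    -((1 / (2 * ζ)) • (1 : Module.End ℂ N)) - (η - 1 / 2) • dN ζ N hN
      - opN ζ N (R.t ζ) * dN ζ N hN ^ 2
      - ((η - 1) * (η - 2) / 4 + c / (2 * ζ)) • tInv ζ N hN

/-- The action of the Schrödinger algebra on `N ⊗ ℂ[x, x⁻¹]` extending that of the
ageing algebra. -/
def nOpsC (c : ℂ) : Gen → ℤ → Module.End ℂ N :=
  laurentOps ζ η (opN ζ N (R.pq ζ)) (opN ζ N (R.eqq ζ)) (fOp ζ η N hN c)

lemma fOp_comm (c : ℂ) :
    fOp ζ η N hN c * opN ζ N (R.pq ζ) =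
      opN ζ N (R.pq ζ) * fOp ζ η N hN c + 1 + (2 * ζ) • fOp ζ η N hN c ∧
    opN ζ N (R.eqq ζ) * fOp ζ η N hN c =
      fOp ζ η N hN c * opN ζ N (R.eqq ζ) - (2 : ℂ) • (opN ζ N (R.pq ζ) * fOp ζ η N hN c)
        + (η - 2) • 1 - (3 * ζ) • fOp ζ η N hN c := by
  have hab := t_mul_tInv ζ N hN
  have hba := tInv_mul_t ζ N hN
  have hda := dN_mul_t ζ N hN
  have hs := opN_s ζ N hN
  have hpq : opN ζ N (R.pq ζ) =
      if ζ = 0 then opN ζ N (R.t ζ) else (2 * ζ) • opN ζ N (R.s ζ) := by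
    unfold R.pq; split_ifs <;> simp
  have heqq : opN ζ N (R.eqq ζ) = if ζ = 0 then opN ζ N (R.s ζ) else
      opN ζ N (R.t ζ) + ζ • opN ζ N (R.s ζ) +
        (2 * ζ) • (opN ζ N (R.s ζ) * opN ζ N (R.s ζ)) := by
    unfold R.eqq; split_ifs <;> simp [pow_two]
  by_cases h0 : ζ = 0
  · rw [if_pos h0] at hs hpq heqq
    have hF : fOp ζ η N hN c = dN ζ N hN + (η - 2) • tInv ζ N hN
        + c • (tInv ζ N hN * tInv ζ N hN) := by
      unfold fOp; rw [if_pos h0, pow_two]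
    rw [hs] at heqq
    obtain ⟨h1, h2⟩ := weyl_zero hab hba hda η c hpq heqq hF
    have hz : ∀ (k : ℂ) (Z : Module.End ℂ N), (k * ζ) • Z = 0 := by simp [h0]
    have h1' := eq_add_of_sub_eq h1
    rw [h1'] at h2 ⊢
    refine ⟨?_, ?_⟩
    · rw [hz]; abel
    · rw [hz, sub_zero, ← sub_eq_zero]
      rw [← sub_eq_zero] at h2
      rw [← h2]
      module
  · rw [if_neg h0] at hs hpq heqq
    have hF : fOp ζ η N hN c = -((1 / (2 * ζ)) • (1 : Module.End ℂ N))
        - (η - 1 / 2) • dN ζ N hN - opN ζ N (R.t ζ) * (dN ζ N hN * dN ζ N hN)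
        - ((η - 1) * (η - 2) / 4 + c / (2 * ζ)) • tInv ζ N hN := by
      unfold fOp; rw [if_neg h0, pow_two]
    rw [hs] at hpq heqq
    obtain ⟨h1, h2⟩ := weyl_nonzero hab hba hda ζ η c h0 hpq heqq hF
    have h1' := eq_add_of_sub_eq h1
    rw [h1'] at h2 ⊢
    refine ⟨?_, ?_⟩
    · abel
    · rw [← sub_eq_zero]
      rw [← sub_eq_zero] at h2
      rw [← h2]
      module

/-- The Schrödinger module `N_{c,ζ,η}`. -/
def modNC (c : ℂ) : Rep Schr (ℤ →₀ N) :=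
  schrRep (gradedOps (nOpsC ζ η N hN c)) fun g g' =>
    gradedOps_comm _ _ _ (laurentOps_comm ζ η (opN_eqq_mul_pq ζ N) g g'
      (Or.inl (fOp_comm ζ η N hN c)))

end Simple

end WeylModules

end Schroedinger

end

noncomputable section

namespace Schroedinger

/-! ## Simple quotients and coatoms -/

section LieModules

variable {L : Type*} [LieRing L] [LieAlgebra ℂ L] {M : Type*} [AddCommGroup M] [Module ℂ M]
  [LieRingModule L M] [LieModule ℂ L M]

/-! Everything rests on two facts about H(V). The vectors fᵏv span it (`fPowMap_surjective`), and V
embeds in it (`ind_of_injective`), because ℂ[x] ⊗ V carries a Schrödinger action with f acting as x.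

(a) If V is generated by a highest weight vector v of weight μ, then q and f applied to v give
vectors of weight μ - n spanning H(V), and only n = 0 has weight μ. A proper submodule is h-stable,
so it has no v-component. Hence the sum of all proper submodules is still proper
(`sumProper_ne_top`), and it gives the unique simple quotient.

(b), (d) The Heisenberg module extends to a Schrödinger module X, and V is the restriction of X
twisted by a character h ↦ μ. The tensor identity (`induced_equiv_tensor`) then gives H(V) ≅ X ⊗
M(μ), with M(μ) the Verma module over sl₂ and the Heisenberg algebra acting on the left factor only.
The operator pq is diagonal on X with distinct eigenvalues, and X has no proper nonzero
Heisenberg-stable subspace. So a submodule of X ⊗ M(μ) contains the components xᵢ ⊗ yᵢ of each of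
its elements, and together with xᵢ ⊗ yᵢ ≠ 0 also X ⊗ yᵢ. Proper submodules therefore lie in X ⊗
(maximal submodule of M(μ)) (`le_ker_tensorMk`).

(c) On Q(λ, ḣ) p is zero and q is injective, and p fᵏv = -k fᵏ⁻¹ qv. A suitable power of p sends a
nonzero element of H(V) to a nonzero element of V, which generates everything
(`induced_isIrreducible`).

(e) Since V is simple, it embeds in every simple quotient M of H(V). A cubic Casimir element
commutes with the whole action (`casimir_comm`). As M has countable dimension, Schur's lemma in
Dixmier's form (`exists_eq_smul_of_commute`) makes it a scalar c. Read as an equation for f, this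
says f(p² - 2ze) = c + eq² + hpq + (z/2)(h² + h). On N ⊗ ℂ[x, x⁻¹] the operator p² - 2ze is, up to a
shift, t² or -2żt, which is invertible. So f is determined on V, it is the operator F with parameter
c (`fOp_mul_nDisc`), and M is the corresponding extension (`exists_equiv_modNC`). -/

lemma isIrreducible_quotient_iff (N : LieSubmodule ℂ L M) :
    LieModule.IsIrreducible ℂ L (M ⧸ N) ↔ IsCoatom N := by
  have hsurj := LieSubmodule.Quotient.surjective_mk' N
  constructor
  · intro hirr
    refine ⟨?_, fun P hP => ?_⟩
    · rintro rfl
      have := LieModule.nontrivial_of_isIrreducible ℂ L (M ⧸ (⊤ : LieSubmodule ℂ L M))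
      obtain ⟨a, b, hab⟩ := exists_pair_ne (M ⧸ (⊤ : LieSubmodule ℂ L M))
      obtain ⟨a, rfl⟩ := hsurj a
      obtain ⟨b, rfl⟩ := hsurj b
      apply hab
      rw [← sub_eq_zero, ← map_sub, LieSubmodule.Quotient.mk_eq_zero]
      trivial
    · rcases hirr.eq_bot_or_eq_top (P.map (LieSubmodule.Quotient.mk' N)) with h | h
      · rw [LieSubmodule.Quotient.map_mk'_eq_bot_le] at h
        exact absurd h hP.not_ge
      · rw [eq_top_iff]
        intro m _
        have hm : LieSubmodule.Quotient.mk' N m ∈ P.map (LieSubmodule.Quotient.mk' N) := by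
          rw [h]; trivial
        obtain ⟨m', hm', he⟩ := (LieSubmodule.mem_map _).1 hm
        rw [eq_comm, ← sub_eq_zero, ← map_sub, LieSubmodule.Quotient.mk_eq_zero] at he
        have := P.add_mem (hP.le he) hm'
        rwa [sub_add_cancel] at this
  · intro hN
    have : Nontrivial (M ⧸ N) := by
      obtain ⟨m, hm⟩ : ∃ m, m ∉ N := by
        by_contra! h
        exact hN.1 (eq_top_iff.2 fun m _ => h m)
      refine ⟨LieSubmodule.Quotient.mk' N m, 0, ?_⟩
      rwa [Ne, LieSubmodule.Quotient.mk_eq_zero]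
    refine LieModule.IsIrreducible.mk fun P hP => ?_
    have hle : N ≤ P.comap (LieSubmodule.Quotient.mk' N) := by
      intro m hm
      rw [LieSubmodule.mem_comap, (LieSubmodule.Quotient.mk_eq_zero N).2 hm]
      exact P.zero_mem
    rcases hle.lt_or_eq with h | h
    · have h2 := hN.2 _ h
      rw [eq_top_iff]
      intro y _
      obtain ⟨m, rfl⟩ := hsurj y
      have : m ∈ P.comap (LieSubmodule.Quotient.mk' N) := by rw [h2]; trivial
      exact LieSubmodule.mem_comap.1 this
    · exfalso
      apply hP
      rw [eq_bot_iff]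
      intro y hy
      obtain ⟨m, rfl⟩ := hsurj y
      have : m ∈ N := by rw [h]; exact LieSubmodule.mem_comap.2 hy
      rw [LieSubmodule.mem_bot]
      exact (LieSubmodule.Quotient.mk_eq_zero N).2 this

/-- Simple quotients belong to coatoms, and a largest proper submodule is the only coatom. -/
lemma isIrreducible_quotient_iff_eq {N₀ : LieSubmodule ℂ L M} (h₀ : N₀ ≠ ⊤)
    (h : ∀ N : LieSubmodule ℂ L M, N ≠ ⊤ → N ≤ N₀) (N : LieSubmodule ℂ L M) :
    LieModule.IsIrreducible ℂ L (M ⧸ N) ↔ N = N₀ := by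
  rw [isIrreducible_quotient_iff]
  constructor
  · intro hN
    by_contra hne
    exact h₀ (hN.2 _ (lt_of_le_of_ne (h N hN.1) hne))
  · rintro rfl
    refine ⟨h₀, fun P hP => ?_⟩
    by_contra hne
    exact (h P hne).not_gt hP

lemma le_sumProper {N : LieSubmodule ℂ L M} (hN : N ≠ ⊤) : N ≤ sumProper L M :=
  le_sSup hN

lemma hasUniqueSimpleQuotient_of_sumProper_ne_top (h : sumProper L M ≠ ⊤) :
    HasUniqueSimpleQuotient L M :=
  ⟨sumProper L M, (isIrreducible_quotient_iff_eq h (fun _ => le_sumProper) _).2 rfl,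
    fun N hN => (isIrreducible_quotient_iff_eq h (fun _ => le_sumProper) N).1 hN⟩

variable {X : Type*} [AddCommGroup X] [Module ℂ X] [LieRingModule L X] [LieModule ℂ L X]

/-- A bijective homomorphism of Lie modules, as an equivalence. -/
def lieModuleEquivOfBijective (φ : M →ₗ⁅ℂ,L⁆ X) (h : Function.Bijective φ) : M ≃ₗ⁅ℂ,L⁆ X :=
  { LinearEquiv.ofBijective (φ : M →ₗ[ℂ] X) h with
    map_lie' := fun {x m} => φ.map_lie x m }

/-- The homomorphism induced on the quotient by the kernel. -/
def kerLift (φ : M →ₗ⁅ℂ,L⁆ X) : (M ⧸ φ.ker) →ₗ⁅ℂ,L⁆ X :=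
  { φ.ker.toSubmodule.liftQ (φ : M →ₗ[ℂ] X) (fun m hm => hm) with
    map_lie' := by
      intro x m
      obtain ⟨m, rfl⟩ := LieSubmodule.Quotient.surjective_mk' φ.ker m
      exact φ.map_lie x m }

lemma kerLift_mk (φ : M →ₗ⁅ℂ,L⁆ X) (m : M) :
    kerLift φ (LieSubmodule.Quotient.mk' φ.ker m) = φ m := rfl

lemma nonempty_quotient_ker_equiv (φ : M →ₗ⁅ℂ,L⁆ X) (h : Function.Surjective φ) :
    Nonempty ((M ⧸ φ.ker) ≃ₗ⁅ℂ,L⁆ X) := by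
  refine ⟨lieModuleEquivOfBijective (kerLift φ) ⟨?_, fun x => ?_⟩⟩
  · rw [injective_iff_map_eq_zero]
    intro m hm
    obtain ⟨m, rfl⟩ := LieSubmodule.Quotient.surjective_mk' φ.ker m
    rw [LieSubmodule.Quotient.mk_eq_zero]
    exact hm
  · obtain ⟨m, rfl⟩ := h x
    exact ⟨_, kerLift_mk φ m⟩

lemma ker_ne_top {φ : M →ₗ⁅ℂ,L⁆ X} (h : ∃ m, φ m ≠ 0) : φ.ker ≠ ⊤ := by
  obtain ⟨m, hm⟩ := h
  intro h
  have : m ∈ φ.ker := by rw [h]; trivial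
  exact hm this

lemma injective_of_isIrreducible [hM : LieModule.IsIrreducible ℂ L M] {φ : M →ₗ⁅ℂ,L⁆ X}
    (h : ∃ m, φ m ≠ 0) : Function.Injective φ := by
  have h1 := (hM.eq_bot_or_eq_top φ.ker).resolve_right (ker_ne_top h)
  rw [injective_iff_map_eq_zero]
  intro m hm
  have : m ∈ φ.ker := hm
  rwa [h1, LieSubmodule.mem_bot] at this

lemma surjective_of_isIrreducible [hX : LieModule.IsIrreducible ℂ L X] {φ : M →ₗ⁅ℂ,L⁆ X}
    (h : ∃ m, φ m ≠ 0) : Function.Surjective φ := by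
  rcases hX.eq_bot_or_eq_top φ.range with h1 | h1
  · obtain ⟨m, hm⟩ := h
    have : φ m ∈ φ.range := ⟨m, rfl⟩
    rw [h1, LieSubmodule.mem_bot] at this
    exact absurd this hm
  · intro x
    have : x ∈ φ.range := by rw [h1]; trivial
    exact this

end LieModules

/-! ## Eigenvectors in stable subspaces -/

section Eigen

variable {M : Type*} [AddCommGroup M] [Module ℂ M]

lemma aeval_apply_of_apply_eq_smul {T : Module.End ℂ M} {α : ℂ} {m : M} (h : T m = α • m)
    (P : Polynomial ℂ) : Polynomial.aeval T P m = P.eval α • m := by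
  induction P using Polynomial.induction_on' with
  | add P Q hP hQ => simp [hP, hQ, add_smul]
  | monomial n a =>
    have : ∀ n, (T ^ n) m = α ^ n • m := by
      intro n
      induction n with
      | zero => simp
      | succ n ih => rw [pow_succ', Module.End.mul_apply, ih, map_smul, h, smul_smul, pow_succ]
    simp [Polynomial.aeval_monomial, this, mul_smul, Algebra.algebraMap_eq_smul_one]

lemma aeval_mem_of_stable {T : Module.End ℂ M} {W : Submodule ℂ M} (hW : ∀ w ∈ W, T w ∈ W)
    (P : Polynomial ℂ) {w : M} (hw : w ∈ W) : Polynomial.aeval T P w ∈ W := by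
  induction P using Polynomial.induction_on' with
  | add P Q hP hQ => simpa using W.add_mem hP hQ
  | monomial n a =>
    have : ∀ n, (T ^ n) w ∈ W := by
      intro n
      induction n with
      | zero => simpa
      | succ n ih => rw [pow_succ', Module.End.mul_apply]; exact hW _ ih
    simpa [Polynomial.aeval_monomial, Algebra.algebraMap_eq_smul_one] using W.smul_mem a (this n)

/-- A subspace stable under `T` contains the components of its elements in a sum of eigenvectors
with distinct eigenvalues. -/
lemma mem_of_sum_eigenvectors_mem {T : Module.End ℂ M} {W : Submodule ℂ M}
    (hW : ∀ w ∈ W, T w ∈ W) {ι : Type*} (s : Finset ι) (α : ι → ℂ) (hα : Function.Injective α)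
    (m : ι → M) (hm : ∀ i ∈ s, T (m i) = α i • m i) (h : ∑ i ∈ s, m i ∈ W) {i : ι} (hi : i ∈ s) :
    m i ∈ W := by
  classical
  -- The Lagrange basis polynomial of the node `α i`, evaluated at `T`, projects the sum onto its
  -- `i`-th term.
  have h1 := aeval_mem_of_stable hW (Lagrange.basis s α i) h
  rw [map_sum, Finset.sum_eq_single i] at h1
  · rwa [aeval_apply_of_apply_eq_smul (hm i hi), Lagrange.eval_basis_self hα.injOn hi,
      one_smul] at h1
  · intro j hj hji
    rw [aeval_apply_of_apply_eq_smul (hm j hj), Lagrange.eval_basis_of_ne hji.symm hj, zero_smul]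
  · exact fun h => absurd hi h

/-- Since `y` is a finite sum of eigenvectors with eigenvalues other than `μ`, the previous lemma
applies; in the index type `Option`, `none` labels `v`. -/
lemma mem_of_add_mem_of_eigenvector {T : Module.End ℂ M} {W : Submodule ℂ M}
    (hW : ∀ w ∈ W, T w ∈ W) {μ : ℂ} {v y : M} (hv : T v = μ • v)
    (hy : y ∈ ⨆ ν : {ν : ℂ // ν ≠ μ}, T.eigenspace ν) (h : v + y ∈ W) : v ∈ W := by
  classical
  rw [Submodule.mem_iSup_iff_exists_finsupp] at hy
  obtain ⟨f, hf, rfl⟩ := hy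
  let m : Option {ν : ℂ // ν ≠ μ} → M := fun o => o.elim v f
  let α : Option {ν : ℂ // ν ≠ μ} → ℂ := fun o => o.elim μ Subtype.val
  have hα : Function.Injective α := by
    rintro (_ | a) (_ | b) hab
    · rfl
    · exact absurd hab.symm b.2
    · exact absurd hab a.2
    · exact congrArg some (Subtype.ext hab)
  refine mem_of_sum_eigenvectors_mem hW (insert none (f.support.map Function.Embedding.some))
    α hα m ?_ ?_ (i := none) (Finset.mem_insert_self _ _)
  · rintro (_ | a) -
    · exact hv
    · exact Module.End.mem_eigenspace_iff.1 (hf a)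
  · rw [Finset.sum_insert (by simp), Finset.sum_map]
    exact h

end Eigen

/-! ## Induced modules -/

section UEA

variable {L : Type*} [LieRing L] [LieAlgebra ℂ L]

/-- The inclusion of `L` into the subalgebra it generates lifts to the enveloping algebra. Followed
by the inclusion, the lift is the identity by uniqueness, so every element lies in the subalgebra.
-/
lemma adjoin_range_ι :
    Algebra.adjoin ℂ (Set.range (UniversalEnvelopingAlgebra.ι ℂ : L → _)) = ⊤ := by
  set C := Algebra.adjoin ℂ (Set.range (UniversalEnvelopingAlgebra.ι ℂ : L → _)) with hC
  let _ : LieRing (UniversalEnvelopingAlgebra ℂ L) := LieRing.ofAssociativeRing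
  let _ : LieRing C := LieRing.ofAssociativeRing
  let g : L →ₗ⁅ℂ⁆ C :=
    { toFun := fun x => ⟨UniversalEnvelopingAlgebra.ι ℂ x, Algebra.subset_adjoin ⟨x, rfl⟩⟩
      map_add' := fun a b => Subtype.ext (map_add _ a b)
      map_smul' := fun a b => Subtype.ext (map_smul _ a b)
      map_lie' := fun {a b} => Subtype.ext (ι_lie a b) }
  have hid : C.val.comp (UniversalEnvelopingAlgebra.lift ℂ g) = AlgHom.id ℂ _ := by
    apply UniversalEnvelopingAlgebra.hom_ext
    refine LieHom.ext fun x => ?_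
    have := UniversalEnvelopingAlgebra.lift_ι_apply ℂ g x
    change C.val (UniversalEnvelopingAlgebra.lift ℂ g (UniversalEnvelopingAlgebra.ι ℂ x)) =
      UniversalEnvelopingAlgebra.ι ℂ x
    rw [this]
    rfl
  rw [eq_top_iff]
  intro u _
  have := DFunLike.congr_fun hid u
  change ((UniversalEnvelopingAlgebra.lift ℂ g u : C) : _) = u at this
  rw [← this]
  exact Subtype.property _

end UEA

section Induced

variable {K L : Type*} [LieRing K] [LieAlgebra ℂ K] [LieRing L] [LieAlgebra ℂ L]
  {φ : K →ₗ⁅ℂ⁆ L} {V : Type*} [AddCommGroup V] [Module ℂ V] [LieRingModule K V] [LieModule ℂ K V]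

lemma smul_mem_of_lieSubmodule (N : LieSubmodule ℂ L (Ind φ V))
    (u : UniversalEnvelopingAlgebra ℂ L) {m : Ind φ V} (hm : m ∈ N) : u • m ∈ N := by
  have hu : u ∈ Algebra.adjoin ℂ (Set.range (UniversalEnvelopingAlgebra.ι ℂ : L → _)) := by
    rw [adjoin_range_ι]; trivial
  induction hu using Algebra.adjoin_induction generalizing m with
  | mem x hx =>
    obtain ⟨x, rfl⟩ := hx
    exact N.lie_mem hm
  | algebraMap c => rw [algebraMap_smul]; exact N.smul_mem c hm
  | add x y _ _ hx hy => rw [add_smul]; exact N.add_mem (hx hm) (hy hm)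
  | mul x y _ _ hx hy => rw [mul_smul]; exact hx (hy hm)

lemma smul_ind_of (u : UniversalEnvelopingAlgebra ℂ L) (v : V) :
    (Submodule.Quotient.mk (u ⊗ₜ[ℂ] v) : Ind φ V) = u • Ind.of φ v := by
  change _ = Submodule.Quotient.mk (u • (1 ⊗ₜ[ℂ] v))
  rw [TensorProduct.smul_tmul', smul_eq_mul, mul_one]

/-- The form in which generation of induced modules by the inducing module is used throughout. -/
lemma eq_top_of_ind_of_mem {N : LieSubmodule ℂ L (Ind φ V)} (h : ∀ v, Ind.of φ v ∈ N) :
    N = ⊤ := by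
  rw [eq_top_iff]
  intro m _
  obtain ⟨t, rfl⟩ := Submodule.Quotient.mk_surjective _ m
  induction t using TensorProduct.induction_on with
  | zero => exact N.zero_mem
  | add a b ha hb => exact N.add_mem (ha trivial) (hb trivial)
  | tmul u v =>
    have := smul_mem_of_lieSubmodule N u (h v)
    rwa [← smul_ind_of] at this

lemma ind_of_add (v w : V) : Ind.of φ (v + w) = Ind.of φ v + Ind.of φ w := by
  change Submodule.Quotient.mk (1 ⊗ₜ[ℂ] (v + w)) =
    Submodule.Quotient.mk (1 ⊗ₜ[ℂ] v + 1 ⊗ₜ[ℂ] w)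
  rw [TensorProduct.tmul_add]

variable (φ V) in
/-- The canonical map from a module to its induced module. -/
def indOf : V →ₗ[ℂ] Ind φ V where
  toFun := Ind.of φ
  map_add' := ind_of_add
  map_smul' := ind_of_smul φ V

variable {M : Type*} [AddCommGroup M] [Module ℂ M] [LieRingModule L M] [LieModule ℂ L M]

variable (L M) in
/-- The action of the enveloping algebra on a Lie module. -/
def envAct : UniversalEnvelopingAlgebra ℂ L →ₐ[ℂ] Module.End ℂ M :=
  UniversalEnvelopingAlgebra.lift ℂ (LieModule.toEnd ℂ L M)

lemma envAct_ι (x : L) (m : M) : envAct L M (UniversalEnvelopingAlgebra.ι ℂ x) m = ⁅x, m⁆ := by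
  unfold envAct
  rw [UniversalEnvelopingAlgebra.lift_ι_apply]
  rfl

/-- The universal property of the induced module. -/
def indLift (g : V →ₗ[ℂ] M) (hg : ∀ (y : K) (v : V), g ⁅y, v⁆ = ⁅φ y, g v⁆) :
    Ind φ V →ₗ⁅ℂ,L⁆ M :=
  let G : UniversalEnvelopingAlgebra ℂ L ⊗[ℂ] V →ₗ[ℂ] M :=
    TensorProduct.lift ((LinearMap.llcomp ℂ V M M).flip g ∘ₗ (envAct L M).toLinearMap)
  have hG : ∀ u v, G (u ⊗ₜ v) = envAct L M u (g v) := fun _ _ => rfl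
  have hsmul : ∀ u t, G (u • t) = envAct L M u (G t) := by
    intro u t
    induction t using TensorProduct.induction_on with
    | zero => simp
    | add a b ha hb => simp [ha, hb]
    | tmul u' v => simp [TensorProduct.smul_tmul', hG]
  have hker : (indRel φ V).restrictScalars ℂ ≤ LinearMap.ker G := by
    intro t ht
    rw [LinearMap.mem_ker]
    rw [Submodule.restrictScalars_mem] at ht
    induction ht using Submodule.span_induction with
    | mem x hx =>
      obtain ⟨y, v, rfl⟩ := hx
      rw [map_sub, hG, hG, envAct_ι, hg, map_one, Module.End.one_apply, sub_self]
    | zero => simp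
    | add a b _ _ ha hb => rw [map_add, ha, hb, add_zero]
    | smul u t _ ht => rw [hsmul, ht, map_zero]
  { ((indRel φ V).restrictScalars ℂ).liftQ G hker with
    map_lie' := by
      intro x m
      obtain ⟨t, rfl⟩ := Submodule.Quotient.mk_surjective _ m
      change G (UniversalEnvelopingAlgebra.ι ℂ x • t) = ⁅x, G t⁆
      rw [hsmul, envAct_ι] }

lemma indLift_of (g : V →ₗ[ℂ] M) (hg : ∀ (y : K) (v : V), g ⁅y, v⁆ = ⁅φ y, g v⁆) (v : V) :
    indLift g hg (Ind.of φ v) = g v := by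
  change envAct L M 1 (g v) = g v
  rw [map_one, Module.End.one_apply]

/-- The kernel of the difference contains the inducing module, hence is everything. -/
lemma ind_hom_ext {F G : Ind φ V →ₗ⁅ℂ,L⁆ M} (h : ∀ v, F (Ind.of φ v) = G (Ind.of φ v)) :
    F = G := by
  have : (F - G).ker = ⊤ := eq_top_of_ind_of_mem fun v => by
    rw [LieModuleHom.mem_ker, LieModuleHom.sub_apply, h, sub_self]
  ext m
  have hm : m ∈ (F - G).ker := by rw [this]; trivial
  rw [LieModuleHom.mem_ker, LieModuleHom.sub_apply] at hm
  exact sub_eq_zero.1 hm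

end Induced

/-! ## Modules in terms of the action of the basis vectors -/

lemma eq_sum_gen (x : Schr) : x = ∑ g, x g • gen g := by
  rw [sum_gen]
  ext g
  cases g <;> simp [gen_coord]

section Coordinates

variable {K : LieSubalgebra ℂ Schr} {T : Finset Gen} (hK : ∀ x ∈ K, ∀ k ∉ T, x k = 0)
  (hT : ∀ g ∈ T, gen g ∈ K)
  {M N : Type*} [AddCommGroup M] [Module ℂ M] [LieRingModule K M] [LieModule ℂ K M]
  [AddCommGroup N] [Module ℂ N] [LieRingModule K N] [LieModule ℂ K N]

/-- `T` only has to contain the support of `y`, not span `K`, so the formula also serves elements of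
a smaller coordinate subalgebra regarded inside `K`. -/
lemma eq_sum_attach (y : K) (hy : ∀ k ∉ T, (y : Schr) k = 0) :
    y = ∑ g ∈ T.attach, (y : Schr) g • (⟨gen g, hT g g.2⟩ : K) := by
  apply Subtype.ext
  rw [AddSubmonoidClass.coe_finsetSum]
  change (y : Schr) = ∑ g ∈ T.attach, (y : Schr) g • gen g
  rw [Finset.sum_attach T (fun g => (y : Schr) g • gen g)]
  conv_lhs => rw [eq_sum_gen (y : Schr)]
  refine (Finset.sum_subset (Finset.subset_univ _) fun g _ hg => ?_).symm
  rw [hy g hg, zero_smul]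

lemma lie_eq_sum_attach_of_coord (y : K) (hy : ∀ k ∉ T, (y : Schr) k = 0) (m : M) :
    ⁅y, m⁆ = ∑ g ∈ T.attach, (y : Schr) g • ⁅(⟨gen g, hT g g.2⟩ : K), m⁆ := by
  conv_lhs => rw [eq_sum_attach hT y hy]
  have := congrArg (fun A : Module.End ℂ M => A m) (map_sum (LieModule.toEnd ℂ K M)
    (fun g : T => (y : Schr) g • (⟨gen g, hT g g.2⟩ : K)) T.attach)
  refine this.trans ?_
  simp only [LinearMap.sum_apply, map_smul, LinearMap.smul_apply, LieModule.toEnd_apply_apply]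

lemma lie_eq_smul_of_gen (y : K) (hy : ∀ k ∉ T, (y : Schr) k = 0) {m : M} {χ : Gen → ℂ}
    (h : ∀ g (hg : g ∈ T), ⁅(⟨gen g, hT g hg⟩ : K), m⁆ = χ g • m) :
    ⁅y, m⁆ = (∑ g, (y : Schr) g * χ g) • m := by
  rw [lie_eq_sum_attach_of_coord hT y hy, Finset.sum_smul,
    ← Finset.sum_subset (Finset.subset_univ T) (fun g _ hg => by rw [hy g hg, zero_mul, zero_smul]),
    ← Finset.sum_attach T]
  exact Finset.sum_congr rfl fun g _ => by rw [h g g.2, smul_smul]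

include hK in
lemma lie_eq_sum_attach (y : K) (m : M) :
    ⁅y, m⁆ = ∑ g ∈ T.attach, (y : Schr) g • ⁅(⟨gen g, hT g g.2⟩ : K), m⁆ :=
  lie_eq_sum_attach_of_coord hT y (hK y y.2) m

include hK in
lemma map_lie_of_gen (F : M →ₗ[ℂ] N)
    (h : ∀ g (hg : g ∈ T) (m : M), F ⁅(⟨gen g, hT g hg⟩ : K), m⁆ = ⁅(⟨gen g, hT g hg⟩ : K), F m⁆)
    (y : K) (m : M) : F ⁅y, m⁆ = ⁅y, F m⁆ := by
  rw [lie_eq_sum_attach hK hT, lie_eq_sum_attach hK hT, map_sum]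
  exact Finset.sum_congr rfl fun g _ => by rw [map_smul, h g g.2]

include hK in
lemma lie_mem_of_gen (W : Submodule ℂ M)
    (h : ∀ g (hg : g ∈ T), ∀ m ∈ W, ⁅(⟨gen g, hT g hg⟩ : K), m⁆ ∈ W) (y : K) {m : M} (hm : m ∈ W) :
    ⁅y, m⁆ ∈ W := by
  rw [lie_eq_sum_attach hK hT]
  exact W.sum_mem fun g _ => W.smul_mem _ (h g g.2 m hm)

end Coordinates

lemma ageing_coord : ∀ x ∈ ageing, ∀ k ∉ ({.e, .h, .p, .q, .z} : Finset Gen), x k = 0 :=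
  fun _ hx => hx

lemma gen_mem_ageing : ∀ g ∈ ({.e, .h, .p, .q, .z} : Finset Gen), gen g ∈ ageing :=
  fun _ hg => gen_mem_coordSub hg

lemma heis_coord : ∀ x ∈ heis, ∀ k ∉ ({.p, .q, .z} : Finset Gen), x k = 0 :=
  fun _ hx => hx

lemma gen_mem_heis : ∀ g ∈ ({.p, .q, .z} : Finset Gen), gen g ∈ heis :=
  fun _ hg => gen_mem_coordSub hg

lemma sl2_coord : ∀ x ∈ sl2, ∀ k ∉ ({.e, .f, .h} : Finset Gen), x k = 0 :=
  fun _ hx => hx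

lemma gen_mem_sl2 : ∀ g ∈ ({.e, .f, .h} : Finset Gen), gen g ∈ sl2 :=
  fun _ hg => gen_mem_coordSub hg

section SchrModules

variable {M N : Type*} [AddCommGroup M] [Module ℂ M] [LieRingModule Schr M] [LieModule ℂ Schr M]
  [AddCommGroup N] [Module ℂ N] [LieRingModule Schr N] [LieModule ℂ Schr N]

lemma schr_lie_eq_sum (x : Schr) (m : M) : ⁅x, m⁆ = ∑ g, x g • ⁅gen g, m⁆ := by
  conv_lhs => rw [eq_sum_gen x]
  have := congrArg (fun A : Module.End ℂ M => A m) (map_sum (LieModule.toEnd ℂ Schr M)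
    (fun g : Gen => x g • gen g) Finset.univ)
  refine this.trans ?_
  simp only [LinearMap.sum_apply, map_smul, LinearMap.smul_apply, LieModule.toEnd_apply_apply]

lemma schr_map_lie_of_gen (F : M →ₗ[ℂ] N) (h : ∀ g m, F ⁅gen g, m⁆ = ⁅gen g, F m⁆)
    (x : Schr) (m : M) : F ⁅x, m⁆ = ⁅x, F m⁆ := by
  rw [schr_lie_eq_sum, schr_lie_eq_sum, map_sum]
  exact Finset.sum_congr rfl fun g _ => by rw [map_smul, h g]

/-- A linear map commuting with the basis vectors is a homomorphism. -/
def schrHom (F : M →ₗ[ℂ] N) (h : ∀ g m, F ⁅gen g, m⁆ = ⁅gen g, F m⁆) : M →ₗ⁅ℂ,Schr⁆ N :=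
  { F with map_lie' := fun {x m} => schr_map_lie_of_gen F h x m }

/-- A subspace stable under the basis vectors is a submodule. -/
def schrSub (W : Submodule ℂ M) (h : ∀ g, ∀ m ∈ W, ⁅gen g, m⁆ ∈ W) : LieSubmodule ℂ Schr M :=
  { W with
    lie_mem := by
      intro x m hm
      have : ⁅x, m⁆ ∈ W := by
        rw [schr_lie_eq_sum]
        exact W.sum_mem fun g _ => W.smul_mem _ (h g m hm)
      exact this }

lemma gen_lie_lie (g g' : Gen) (m : M) :
    ⁅gen g, ⁅gen g', m⁆⁆ = ⁅gen g', ⁅gen g, m⁆⁆ + ⁅(⁅gen g, gen g'⁆ : Schr), m⁆ := by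
  rw [leibniz_lie, add_comm]

lemma repOfOps_gen {K : LieSubalgebra ℂ Schr} {V : Type*} [AddCommGroup V] [Module ℂ V]
    {T : Finset Gen} {hφ : ∀ (x : K) k, k ∉ T → K.incl x k = 0}
    {A : Gen → Module.End ℂ V}
    {hA : ∀ i ∈ T, ∀ j ∈ T, A i * A j - A j * A i = ∑ k, (⁅gen i, gen j⁆ : Schr) k • A k}
    {g : Gen} (hg : gen g ∈ K) (v : (repOfOps K.incl T hφ A hA).Space) :
    ⁅(⟨gen g, hg⟩ : K), v⁆ = A g v := by
  change (∑ k, (gen g) k • A k) v = _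
  rw [Finset.sum_eq_single g]
  · simp [gen_coord]
  · intro b _ hb; simp [gen_coord, hb]
  · simp

lemma schrRep_gen {V : Type*} [AddCommGroup V] [Module ℂ V] {A : Gen → Module.End ℂ V}
    {hA : ∀ i j, A i * A j - A j * A i = ∑ k, (⁅gen i, gen j⁆ : Schr) k • A k} (g : Gen)
    (v : (schrRep A hA).Space) : ⁅gen g, v⁆ = A g v := by
  change (∑ k, (gen g) k • A k) v = _
  rw [Finset.sum_eq_single g]
  · simp [gen_coord]
  · intro b _ hb; simp [gen_coord, hb]
  · simp

end SchrModules

/-! ## The space of an induced module -/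

section PBW

/-- The operators of the Schrödinger algebra on `ℂ[x] ⊗ V`, with `f` acting as `x`, in terms of the
multiplication by `x`, the derivative `d`, and the action `B` of the ageing algebra on `V`. -/
def pbwOps {A : Type*} [Ring A] [Algebra ℂ A] (x d : A) (B : Gen → A) : Gen → A
  | .e => B .e + d * B .h - x * (d * d)
  | .f => x
  | .h => B .h - (2 : ℂ) • (x * d)
  | .p => B .p - d * B .q
  | .q => B .q
  | .z => B .z

/-- The operators encode how basis vectors move past powers of f: e fᵏ = fᵏe + k fᵏ⁻¹h - k(k-1)
fᵏ⁻¹, h fᵏ = fᵏ(h - 2k), p fᵏ = fᵏp - k fᵏ⁻¹q, with `x` for f and `d` for the derivative. The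
relations are then checked by normal ordering. -/
lemma pbwOps_comm {A : Type*} [Ring A] [Algebra ℂ A] {x d : A} {B : Gen → A}
    (hdx : d * x = x * d + 1) (hx : ∀ g, B g * x = x * B g) (hd : ∀ g, B g * d = d * B g)
    (hB : ∀ g g', g ≠ .f → g' ≠ .f →
      B g * B g' - B g' * B g = ∑ k, (⁅gen g, gen g'⁆ : Schr) k • B k) (g g' : Gen) :
    pbwOps x d B g * pbwOps x d B g' - pbwOps x d B g' * pbwOps x d B g =
      ∑ k, (⁅gen g, gen g'⁆ : Schr) k • pbwOps x d B k := by
  have hdx' : ∀ X, d * (x * X) = x * (d * X) + X := fun X => by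
    rw [← mul_assoc, hdx, add_mul, mul_assoc, one_mul]
  have hx' : ∀ g X, B g * (x * X) = x * (B g * X) := fun g X => by
    rw [← mul_assoc, hx, mul_assoc]
  have hd' : ∀ g X, B g * (d * X) = d * (B g * X) := fun g X => by
    rw [← mul_assoc, hd, mul_assoc]
  have key : ∀ g g', g ≠ .f → g' ≠ .f →
      B g * B g' = B g' * B g + ∑ k, (⁅gen g, gen g'⁆ : Schr) k • B k := fun g g' hg hg' => by
    rw [← hB g g' hg hg']; abel
  -- The relations of the ageing algebra are oriented so that rewriting puts products in the order
  -- e, h, p, q, z.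
  have he := fun g hg => key g .e hg (by decide)
  have hh := fun g hg => key g .h hg (by decide)
  have hp := fun g hg => key g .p hg (by decide)
  have hq := fun g hg => key g .q hg (by decide)
  simp only [sum_lie_gen] at he hh hp hq
  have h1 := he .h (by decide)
  have h2 := he .p (by decide)
  have h3 := he .q (by decide)
  have h4 := he .z (by decide)
  have h5 := hh .p (by decide)
  have h6 := hh .q (by decide)
  have h7 := hh .z (by decide)
  have h8 := hp .q (by decide)
  have h9 := hp .z (by decide)
  have h10 := hq .z (by decide)
  clear he hh hp hq key hB
  dsimp only at h1 h2 h3 h4 h5 h6 h7 h8 h9 h10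
  rw [sum_lie_gen]
  cases g <;> cases g' <;>
    simp only [pbwOps, mul_add, add_mul, mul_sub, sub_mul, smul_mul_assoc,
      mul_smul_comm, mul_assoc, hdx, hdx', hx, hx', hd, hd', h1, h2, h3, h4, h5, h6, h7, h8, h9,
      h10, mul_one, one_mul, mul_zero, add_zero] <;>
    match_scalars <;> ring

variable (V : Type*) [AddCommGroup V] [Module ℂ V] [LieRingModule ageing V] [LieModule ℂ ageing V]

open Classical in
/-- The action on `V` of the basis vectors of the ageing algebra. -/
def ageingOp (g : Gen) : Module.End ℂ V :=
  if hg : gen g ∈ ageing then LieModule.toEnd ℂ ageing V ⟨gen g, hg⟩ else 0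

variable {V} in
lemma ageingOp_apply {g : Gen} (hg : gen g ∈ ageing) (v : V) :
    ageingOp V g v = ⁅(⟨gen g, hg⟩ : ageing), v⁆ := by
  rw [ageingOp, dif_pos hg]; rfl

lemma gen_mem_ageing_of_ne {g : Gen} (hg : g ≠ .f) : gen g ∈ ageing :=
  gen_mem_coordSub (by cases g <;> simp at hg ⊢)

lemma ageingOp_comm (g g' : Gen) (hg : g ≠ .f) (hg' : g' ≠ .f) :
    ageingOp V g * ageingOp V g' - ageingOp V g' * ageingOp V g =
      ∑ k, (⁅gen g, gen g'⁆ : Schr) k • ageingOp V k := by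
  have h1 := gen_mem_ageing_of_ne hg
  have h2 := gen_mem_ageing_of_ne hg'
  ext v
  simp only [LinearMap.sub_apply, Module.End.mul_apply, ageingOp_apply h1, ageingOp_apply h2,
    LinearMap.sum_apply, LinearMap.smul_apply]
  rw [← lie_lie, lie_eq_sum_attach ageing_coord gen_mem_ageing]
  rw [← Finset.sum_subset (Finset.subset_univ ({.e, .h, .p, .q, .z} : Finset Gen)),
    ← Finset.sum_attach _ (fun k => (⁅gen g, gen g'⁆ : Schr) k • ageingOp V k v)]
  · exact Finset.sum_congr rfl fun k _ => by rw [ageingOp_apply (gen_mem_ageing k k.2)]; rfl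
  · intro k _ hk
    have : (⁅gen g, gen g'⁆ : Schr) k = 0 := ageing_coord _ (ageing.lie_mem h1 h2) k hk
    rw [this, zero_smul]

open Polynomial in
/-- The module `ℂ[x] ⊗ V` over the Schrödinger algebra. -/
def pbwRep : Rep Schr (ℂ[X] ⊗[ℂ] V) :=
  schrRep (pbwOps (LinearMap.rTensor V weylT) (LinearMap.rTensor V weylD)
    (fun g => LinearMap.lTensor ℂ[X] (ageingOp V g))) (by
    refine pbwOps_comm ?_ ?_ ?_ ?_
    · rw [← LinearMap.rTensor_mul, weyl_comm, LinearMap.rTensor_add, LinearMap.rTensor_mul]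
      congr 1
      exact LinearMap.rTensor_id _ _
    · intro g
      ext; simp
    · intro g
      ext; simp
    · intro g g' hg hg'
      rw [← LinearMap.lTensor_mul, ← LinearMap.lTensor_mul, ← LinearMap.lTensor_sub,
        ageingOp_comm V g g' hg hg']
      have := map_sum (LinearMap.lTensorHom (R := ℂ) (M := ℂ[X]) (N := V) (P := V))
        (fun k => (⁅gen g, gen g'⁆ : Schr) k • ageingOp V k) Finset.univ
      refine this.trans ?_
      simp only [map_smul]
      rfl)

-- The map v ↦ 1 ⊗ v into ℂ[x] ⊗ V commutes with the ageing algebra, so it extends to the induced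
-- module. Evaluation at x = 0 then recovers v.
open Polynomial in
lemma ind_of_injective : Function.Injective (Ind.of ageing.incl : V → InducedSchr V) := by
  let g : V →ₗ[ℂ] (pbwRep V).Space := TensorProduct.mk ℂ ℂ[X] V 1
  have hg : ∀ (y : ageing) (v : V), g ⁅y, v⁆ = ⁅ageing.incl y, g v⁆ := by
    refine map_lie_of_gen (N := (pbwRep V).Space) ageing_coord gen_mem_ageing g ?_
    intro k hk v
    have hk' := gen_mem_ageing k hk
    change g _ = ⁅gen k, g v⁆
    have h0 : (weylD : Module.End ℂ ℂ[X]) 1 = 0 := Polynomial.derivative_one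
    have : ⁅gen k, g v⁆ = (pbwOps (LinearMap.rTensor V weylT) (LinearMap.rTensor V weylD)
      (fun g => LinearMap.lTensor ℂ[X] (ageingOp V g)) k) ((1 : ℂ[X]) ⊗ₜ[ℂ] v) := schrRep_gen _ _
    rw [this, ← ageingOp_apply hk']
    change (1 : ℂ[X]) ⊗ₜ[ℂ] _ = _
    cases k <;> simp at hk <;> simp [pbwOps, h0]
  let ev : ℂ[X] ⊗[ℂ] V →ₗ[ℂ] V :=
    (TensorProduct.lid ℂ V).toLinearMap ∘ₗ LinearMap.rTensor V (Polynomial.leval 0)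
  have hev : ∀ v, ev (indLift g hg (Ind.of ageing.incl v)) = v := by
    intro v
    rw [indLift_of]
    change ev (1 ⊗ₜ v) = v
    simp [ev]
  exact Function.LeftInverse.injective (g := fun m => ev (indLift g hg m)) hev

end PBW

/-! ## Highest weight modules -/

section HighestWeight

/-- A module generated by an eigenvector spanning its eigenspace has a largest proper submodule. -/
lemma sumProper_ne_top {L : Type*} [LieRing L] [LieAlgebra ℂ L] {M : Type*} [AddCommGroup M]
    [Module ℂ M] [LieRingModule L M] [LieModule ℂ L M] (t : L) {v : M} {μ : ℂ} (hv0 : v ≠ 0)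
    (hv : ⁅t, v⁆ = μ • v) (hgen : ∀ N : LieSubmodule ℂ L M, v ∈ N → N = ⊤)
    (hspan : ∀ m : M, ∃ a : ℂ,
      ∃ y ∈ ⨆ ν : {ν : ℂ // ν ≠ μ}, (LieModule.toEnd ℂ L M t).eigenspace ν, m = a • v + y) :
    sumProper L M ≠ ⊤ := by
  set Y := ⨆ ν : {ν : ℂ // ν ≠ μ}, (LieModule.toEnd ℂ L M t).eigenspace ν with hY
  intro h
  -- A submodule containing an element with nonzero `v`-component contains `v`, hence is not proper.
  -- So all proper submodules lie in `Y`.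
  have hle : (sumProper L M).toSubmodule ≤ Y := by
    rw [sumProper, LieSubmodule.sSup_toSubmodule]
    refine sSup_le ?_
    rintro _ ⟨N, hN, rfl⟩ n hn
    obtain ⟨a, y, hy, rfl⟩ := hspan n
    by_cases ha : a = 0
    · rwa [ha, zero_smul, zero_add]
    · refine absurd (hgen N ?_) hN
      have := mem_of_add_mem_of_eigenvector (T := LieModule.toEnd ℂ L M t)
        (W := N.toSubmodule) (fun w hw => N.lie_mem hw) (v := a • v) (μ := μ)
        (by rw [map_smul, LieModule.toEnd_apply_apply, hv, smul_comm]) hy hn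
      have := N.smul_mem a⁻¹ this
      rwa [smul_smul, inv_mul_cancel₀ ha, one_smul] at this
  have hvY : v ∈ Y := hle (by rw [h]; trivial)
  -- Eigenspaces are independent: the relation v + (-v) = 0, read in the zero subspace with -v in
  -- `Y`, forces v = 0.
  have := mem_of_add_mem_of_eigenvector (T := LieModule.toEnd ℂ L M t) (W := ⊥)
    (by rintro w hw; rw [Submodule.mem_bot] at *; rw [hw, map_zero]) hv (Y.neg_mem hvY) (by simp)
  exact hv0 ((Submodule.mem_bot ℂ).1 this)

section Schr

variable {M : Type*} [AddCommGroup M] [Module ℂ M] [LieRingModule Schr M] [LieModule ℂ Schr M]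

/-- The vectors obtained from `v` by applying `q` and `f`; the index counts `q` once and
`f` twice. -/
inductive LoweredVector (v : M) : ℕ → M → Prop
  | base : LoweredVector v 0 v
  | f {n : ℕ} {m : M} : LoweredVector v n m → LoweredVector v (n + 2) ⁅gen .f, m⁆
  | q {n : ℕ} {m : M} : LoweredVector v n m → LoweredVector v (n + 1) ⁅gen .q, m⁆

/-- The span of the vectors obtained from `v` by applying `q` and `f`. -/
def loweredSpan (v : M) : Submodule ℂ M := Submodule.span ℂ {m | ∃ n, LoweredVector v n m}

lemma LoweredVector.mem {v m : M} {n : ℕ} (h : LoweredVector v n m) : m ∈ loweredSpan v :=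
  Submodule.subset_span ⟨n, h⟩

lemma stable_of_stable_on_lowered {v : M} (g : Gen)
    (h : ∀ n m, LoweredVector v n m → ⁅gen g, m⁆ ∈ loweredSpan v) {m : M}
    (hm : m ∈ loweredSpan v) : ⁅gen g, m⁆ ∈ loweredSpan v := by
  induction hm using Submodule.span_induction with
  | mem x hx => obtain ⟨n, hx⟩ := hx; exact h n x hx
  | zero => rw [lie_zero]; exact Submodule.zero_mem _
  | add a b _ _ ha hb => rw [lie_add]; exact Submodule.add_mem _ ha hb
  | smul c a _ ha => rw [lie_smul]; exact Submodule.smul_mem _ _ ha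

variable {v : M} {μ ζ : ℂ} (he : ⁅gen .e, v⁆ = 0) (hp : ⁅gen .p, v⁆ = 0)
  (hh : ⁅gen .h, v⁆ = μ • v) (hz : ⁅gen .z, v⁆ = ζ • v)

include hh in
lemma LoweredVector.weight {n : ℕ} {m : M} (h : LoweredVector v n m) :
    ⁅gen .h, m⁆ = (μ - n) • m := by
  induction h with
  | base => simpa using hh
  | f _ ih =>
    rw [gen_lie_lie, ih, lie_relations.2.2.1, lie_smul, smul_lie, ← add_smul]
    congr 1; push_cast; ring
  | q _ ih =>
    rw [gen_lie_lie, ih, lie_relations.2.2.2.2.2.2.2.2.1, lie_smul, neg_lie, ← neg_one_smul ℂ,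
      ← add_smul]
    congr 1; push_cast; ring

include hz in
lemma LoweredVector.central {n : ℕ} {m : M} (h : LoweredVector v n m) :
    ⁅gen .z, m⁆ = ζ • m := by
  induction h with
  | base => exact hz
  | f _ ih => rw [gen_lie_lie, ih, lie_relations.2.2.2.2.2.2.2.2.2.2, zero_lie, add_zero, lie_smul]
  | q _ ih => rw [gen_lie_lie, ih, lie_relations.2.2.2.2.2.2.2.2.2.2, zero_lie, add_zero, lie_smul]

lemma f_lie_mem_loweredSpan {m : M} (hm : m ∈ loweredSpan v) : ⁅gen .f, m⁆ ∈ loweredSpan v :=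
  stable_of_stable_on_lowered _ (fun _ _ h => h.f.mem) hm

lemma q_lie_mem_loweredSpan {m : M} (hm : m ∈ loweredSpan v) : ⁅gen .q, m⁆ ∈ loweredSpan v :=
  stable_of_stable_on_lowered _ (fun _ _ h => h.q.mem) hm

include hp hz in
lemma LoweredVector.p_mem {n : ℕ} {m : M} (h : LoweredVector v n m) :
    ⁅gen .p, m⁆ ∈ loweredSpan v := by
  induction h with
  | base => rw [hp]; exact Submodule.zero_mem _
  | f hm ih =>
    rw [gen_lie_lie, ← lie_skew (gen .p) (gen .f), lie_relations.2.2.2.2.2.2.1, neg_lie]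
    exact Submodule.add_mem _ (f_lie_mem_loweredSpan ih) (Submodule.neg_mem _ hm.q.mem)
  | q hm ih =>
    rw [gen_lie_lie, lie_relations.2.2.2.2.2.2.2.2.2.1, hm.central hz]
    exact Submodule.add_mem _ (q_lie_mem_loweredSpan ih) (Submodule.smul_mem _ _ hm.mem)

include he hp hh hz in
lemma LoweredVector.e_mem {n : ℕ} {m : M} (h : LoweredVector v n m) :
    ⁅gen .e, m⁆ ∈ loweredSpan v := by
  induction h with
  | base => rw [he]; exact Submodule.zero_mem _
  | f hm ih =>
    rw [gen_lie_lie, lie_relations.2.1, hm.weight hh]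
    exact Submodule.add_mem _ (f_lie_mem_loweredSpan ih) (Submodule.smul_mem _ _ hm.mem)
  | q hm ih =>
    rw [gen_lie_lie, lie_relations.2.2.2.1]
    exact Submodule.add_mem _ (q_lie_mem_loweredSpan ih) (hm.p_mem hp hz)

-- The commutators of e and p with f and q are h, p, -q and z, so the span is stable under all basis
-- vectors.
include he hp hh hz in
lemma loweredSpan_eq_top (hgen : ∀ N : LieSubmodule ℂ Schr M, v ∈ N → N = ⊤) :
    loweredSpan v = ⊤ := by
  have h := hgen (schrSub (loweredSpan v) ?_) LoweredVector.base.mem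
  · exact congrArg LieSubmodule.toSubmodule h
  · intro g m hm
    refine stable_of_stable_on_lowered g (fun n m h => ?_) hm
    cases g
    · exact h.e_mem he hp hh hz
    · exact h.f.mem
    · rw [h.weight hh]; exact Submodule.smul_mem _ _ h.mem
    · exact h.p_mem hp hz
    · exact h.q.mem
    · rw [h.central hz]; exact Submodule.smul_mem _ _ h.mem

-- A vector lowered n times has weight `μ - n`, and for n = 0 it is `v` itself. So all other
-- spanning vectors have weights different from `μ`.
include he hp hh hz in
lemma sumProper_ne_top_of_highestWeight (hv : v ≠ 0)
    (hgen : ∀ N : LieSubmodule ℂ Schr M, v ∈ N → N = ⊤) : sumProper Schr M ≠ ⊤ := by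
  refine sumProper_ne_top (gen .h) hv hh hgen fun m => ?_
  have hm : m ∈ loweredSpan v := by rw [loweredSpan_eq_top he hp hh hz hgen]; trivial
  induction hm using Submodule.span_induction with
  | mem x hx =>
    obtain ⟨n, hx⟩ := hx
    rcases Nat.eq_zero_or_pos n with rfl | hn
    · cases hx
      exact ⟨1, 0, Submodule.zero_mem _, by simp⟩
    · refine ⟨0, x, ?_, by simp⟩
      refine Submodule.mem_iSup_of_mem ⟨μ - n, ?_⟩ ?_
      · simp [hn.ne']
      · exact Module.End.mem_eigenspace_iff.2 (hx.weight hh)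
  | zero => exact ⟨0, 0, Submodule.zero_mem _, by simp⟩
  | add a b _ _ ha hb =>
    obtain ⟨r, y, hy, rfl⟩ := ha
    obtain ⟨r', y', hy', rfl⟩ := hb
    exact ⟨r + r', y + y', Submodule.add_mem _ hy hy', by module⟩
  | smul c a _ ha =>
    obtain ⟨r, y, hy, rfl⟩ := ha
    exact ⟨c * r, c • y, Submodule.smul_mem _ _ hy, by module⟩

end Schr

variable {V : Type*} [AddCommGroup V] [Module ℂ V] [LieRingModule ageing V] [LieModule ℂ ageing V]

/-- The elements of `V` whose image in the induced module lies in a submodule. -/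
def ofPreimage (N : LieSubmodule ℂ Schr (InducedSchr V)) : LieSubmodule ℂ ageing V :=
  { N.toSubmodule.comap (indOf ageing.incl V) with
    lie_mem := by
      intro y v hv
      have := N.lie_mem (x := ageing.incl y) hv
      change ⁅ageing.incl y, Ind.of ageing.incl v⁆ ∈ N at this
      rwa [ind_of_lie] at this }

lemma mem_ofPreimage {N : LieSubmodule ℂ Schr (InducedSchr V)} {v : V} :
    v ∈ ofPreimage N ↔ Ind.of ageing.incl v ∈ N := Iff.rfl

lemma eq_top_of_ofPreimage_eq_top {N : LieSubmodule ℂ Schr (InducedSchr V)}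
    (h : ofPreimage N = ⊤) : N = ⊤ :=
  eq_top_of_ind_of_mem fun v => mem_ofPreimage.1 (by rw [h]; trivial)

/-- The image of the generator is nonzero because V embeds. It generates because a submodule
containing it meets V in a submodule containing the generator of V. -/
theorem induced_highestWeight (h : IsHighestWeightAgeing V) :
    IsHighestWeightSchr (InducedSchr V) ∧ HasUniqueSimpleQuotient Schr (InducedSchr V) := by
  obtain ⟨v, hv, he, hp, ⟨μ, hh⟩, ⟨ζ, hz⟩, hgen⟩ := h
  have hv' : Ind.of ageing.incl v ≠ 0 := by
    intro h0
    have h1 : Ind.of ageing.incl (0 : V) = 0 := map_zero (indOf ageing.incl V)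
    exact hv (ind_of_injective V (h0.trans h1.symm))
  have hgen' : ∀ N : LieSubmodule ℂ Schr (InducedSchr V), Ind.of ageing.incl v ∈ N → N = ⊤ := by
    intro N hN
    apply eq_top_of_ofPreimage_eq_top
    rw [eq_top_iff, ← hgen, LieSubmodule.lieSpan_le, Set.singleton_subset_iff]
    exact hN
  have hact : ∀ g (hg : gen g ∈ ageing), ⁅gen g, Ind.of ageing.incl v⁆ =
      Ind.of ageing.incl ⁅(⟨gen g, hg⟩ : ageing), v⁆ := fun g hg =>
    ind_of_lie ageing.incl V (⟨gen g, hg⟩ : ageing) v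
  have he' : ⁅gen .e, Ind.of ageing.incl v⁆ = 0 := by
    rw [hact _ e_mem_ageing, he]; exact map_zero (indOf ageing.incl V)
  have hp' : ⁅gen .p, Ind.of ageing.incl v⁆ = 0 := by
    rw [hact _ p_mem_ageing, hp]; exact map_zero (indOf ageing.incl V)
  have hh' : ⁅gen .h, Ind.of ageing.incl v⁆ = μ • Ind.of ageing.incl v := by
    rw [hact _ h_mem_ageing, hh, ind_of_smul]
  have hz' : ⁅gen .z, Ind.of ageing.incl v⁆ = ζ • Ind.of ageing.incl v := by
    rw [hact _ z_mem_ageing, hz, ind_of_smul]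
  refine ⟨⟨Ind.of ageing.incl v, hv', he', hp', ⟨μ, hh'⟩, ⟨ζ, hz'⟩, ?_⟩,
    hasUniqueSimpleQuotient_of_sumProper_ne_top
      (sumProper_ne_top_of_highestWeight he' hp' hh' hz' hv' hgen')⟩
  exact hgen' _ (LieSubmodule.subset_lieSpan (Set.mem_singleton _))

end HighestWeight

/-! ## Induced modules on which `p` acts trivially on the inducing module -/

section InducedElements

variable (V : Type*) [AddCommGroup V] [Module ℂ V] [LieRingModule ageing V] [LieModule ℂ ageing V]

/-- The map `∑ xᵏ ⊗ vₖ ↦ ∑ fᵏ vₖ` to the induced module. -/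
def fPowMap : (ℕ →₀ V) →ₗ[ℂ] InducedSchr V :=
  Finsupp.lsum ℂ fun k =>
    ((LieModule.toEnd ℂ Schr (InducedSchr V) (gen .f)) ^ k : Module.End ℂ (InducedSchr V)) ∘ₗ
      indOf ageing.incl V

lemma fPowMap_single (k : ℕ) (v : V) : fPowMap V (Finsupp.single k v) =
    ((LieModule.toEnd ℂ Schr (InducedSchr V) (gen .f)) ^ k) (Ind.of ageing.incl v) := by
  rw [fPowMap, Finsupp.lsum_single]
  rfl

lemma fPowMap_single_succ (k : ℕ) (v : V) : fPowMap V (Finsupp.single (k + 1) v) =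
    ⁅gen .f, fPowMap V (Finsupp.single k v)⁆ := by
  rw [fPowMap_single, fPowMap_single, pow_succ', Module.End.mul_apply, LieModule.toEnd_apply_apply]

lemma fPowMap_single_zero (v : V) : fPowMap V (Finsupp.single 0 v) = Ind.of ageing.incl v := by
  rw [fPowMap_single, pow_zero, Module.End.one_apply]

variable {V}

lemma gen_lie_ind_of {g : Gen} (hg : gen g ∈ ageing) (v : V) :
    ⁅gen g, (Ind.of ageing.incl v : InducedSchr V)⁆ =
      Ind.of ageing.incl ⁅(⟨gen g, hg⟩ : ageing), v⁆ :=
  ind_of_lie ageing.incl V (⟨gen g, hg⟩ : ageing) v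

lemma stable_range_fPowMap (g : Gen)
    (h : ∀ k v, ⁅gen g, fPowMap V (Finsupp.single k v)⁆ ∈ LinearMap.range (fPowMap V))
    {m : InducedSchr V} (hm : m ∈ LinearMap.range (fPowMap V)) :
    ⁅gen g, m⁆ ∈ LinearMap.range (fPowMap V) := by
  obtain ⟨x, rfl⟩ := hm
  induction x using Finsupp.induction_linear with
  | zero => rw [map_zero, lie_zero]; exact Submodule.zero_mem _
  | add a b ha hb => rw [map_add, lie_add]; exact Submodule.add_mem _ ha hb
  | single k v => exact h k v

lemma f_lie_mem_range {m : InducedSchr V} (hm : m ∈ LinearMap.range (fPowMap V)) :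
    ⁅gen .f, m⁆ ∈ LinearMap.range (fPowMap V) :=
  stable_range_fPowMap _ (fun _ _ => ⟨_, fPowMap_single_succ V _ _⟩) hm

/-- Induction on the power of f: g f m = f g m + [g, f] m, so only the bracket with f has to be
controlled. -/
lemma stable_range_of_comm_f {g : Gen} (hg : gen g ∈ ageing)
    (h : ∀ m ∈ LinearMap.range (fPowMap V),
      ⁅(⁅gen g, gen .f⁆ : Schr), m⁆ ∈ LinearMap.range (fPowMap V))
    {m : InducedSchr V} (hm : m ∈ LinearMap.range (fPowMap V)) :
    ⁅gen g, m⁆ ∈ LinearMap.range (fPowMap V) := by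
  refine stable_range_fPowMap g (fun k v => ?_) hm
  induction k with
  | zero =>
    rw [fPowMap_single_zero, gen_lie_ind_of hg, ← fPowMap_single_zero]
    exact ⟨_, rfl⟩
  | succ k ih =>
    rw [fPowMap_single_succ, gen_lie_lie]
    exact Submodule.add_mem _ (f_lie_mem_range ih) (h _ ⟨_, rfl⟩)

variable (V) in
lemma fPowMap_surjective : Function.Surjective (fPowMap V) := by
  -- Stability is needed for q and h first, since [e, f] = h and [p, f] = -q.
  have hq : ∀ m ∈ LinearMap.range (fPowMap V), ⁅gen .q, m⁆ ∈ LinearMap.range (fPowMap V) :=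
    fun m hm => stable_range_of_comm_f q_mem_ageing (fun m _ => by
      rw [← lie_skew (gen .q) (gen .f), lie_relations.2.2.2.2.2.2.2.1, neg_zero, zero_lie]
      exact Submodule.zero_mem _) hm
  have hh : ∀ m ∈ LinearMap.range (fPowMap V), ⁅gen .h, m⁆ ∈ LinearMap.range (fPowMap V) :=
    fun m hm => stable_range_of_comm_f h_mem_ageing (fun m hm => by
      rw [lie_relations.2.2.1, smul_lie]
      exact Submodule.smul_mem _ _ (f_lie_mem_range hm)) hm
  have h : (schrSub (LinearMap.range (fPowMap V)) ?_ : LieSubmodule ℂ Schr (InducedSchr V)) = ⊤ :=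
    eq_top_of_ind_of_mem fun v => ⟨Finsupp.single 0 v, fPowMap_single_zero V v⟩
  · exact LinearMap.range_eq_top.1 (congrArg LieSubmodule.toSubmodule h)
  · intro g m hm
    cases g
    · refine stable_range_of_comm_f e_mem_ageing (fun m hm => ?_) hm
      rw [lie_relations.2.1]
      exact hh m hm
    · exact f_lie_mem_range hm
    · exact hh m hm
    · refine stable_range_of_comm_f p_mem_ageing (fun m hm => ?_) hm
      rw [← lie_skew (gen .p) (gen .f), lie_relations.2.2.2.2.2.2.1, neg_lie]
      exact Submodule.neg_mem _ (hq m hm)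
    · exact hq m hm
    · refine stable_range_of_comm_f z_mem_ageing (fun m hm => ?_) hm
      rw [lie_relations.2.2.2.2.2.2.2.2.2.2, zero_lie]
      exact Submodule.zero_mem _

variable (hp : ∀ v : V, ⁅(⟨gen .p, p_mem_ageing⟩ : ageing), v⁆ = 0)

lemma q_lie_fPowMap_single (k : ℕ) (v : V) : ⁅gen .q, fPowMap V (Finsupp.single k v)⁆ =
    fPowMap V (Finsupp.single k ⁅(⟨gen .q, q_mem_ageing⟩ : ageing), v⁆) := by
  induction k with
  | zero => rw [fPowMap_single_zero, fPowMap_single_zero, gen_lie_ind_of q_mem_ageing]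
  | succ k ih =>
    rw [fPowMap_single_succ, fPowMap_single_succ, gen_lie_lie, ih,
      ← lie_skew (gen .q) (gen .f), lie_relations.2.2.2.2.2.2.2.1, neg_zero, zero_lie, add_zero]

-- Each passage of p across f costs -q, and q commutes with f. At `k = 0` the truncated `k - 1` is
-- harmless because the coefficient vanishes.
include hp in
lemma p_lie_fPowMap_single (k : ℕ) (v : V) : ⁅gen .p, fPowMap V (Finsupp.single k v)⁆ =
    (-k : ℂ) • fPowMap V (Finsupp.single (k - 1) ⁅(⟨gen .q, q_mem_ageing⟩ : ageing), v⁆) := by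
  induction k with
  | zero =>
    rw [fPowMap_single_zero, gen_lie_ind_of p_mem_ageing, hp]
    simp only [Nat.cast_zero, neg_zero, zero_smul]
    exact map_zero (indOf ageing.incl V)
  | succ k ih =>
    rw [fPowMap_single_succ, gen_lie_lie, ih, ← lie_skew (gen .p) (gen .f),
      lie_relations.2.2.2.2.2.2.1, neg_lie, q_lie_fPowMap_single, lie_smul, Nat.add_sub_cancel]
    rcases k with _ | k
    · simp
    · rw [Nat.add_sub_cancel, ← fPowMap_single_succ]
      push_cast
      module

-- For `n > k` the falling factorial is zero, so the truncated exponent plays no role.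
include hp in
lemma p_pow_fPowMap_single (n k : ℕ) (v : V) :
    ((LieModule.toEnd ℂ Schr (InducedSchr V) (gen .p)) ^ n) (fPowMap V (Finsupp.single k v)) =
      ((-1) ^ n * k.descFactorial n : ℂ) • fPowMap V (Finsupp.single (k - n)
        (((LieModule.toEnd ℂ ageing V ⟨gen .q, q_mem_ageing⟩) ^ n) v)) := by
  induction n with
  | zero => simp
  | succ n ih =>
    rw [pow_succ', Module.End.mul_apply, ih, map_smul, LieModule.toEnd_apply_apply,
      p_lie_fPowMap_single hp, smul_smul, pow_succ' (LieModule.toEnd ℂ ageing V _),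
      Module.End.mul_apply, LieModule.toEnd_apply_apply, Nat.descFactorial_succ, Nat.sub_sub]
    congr 1
    push_cast
    ring

-- Apply pᵏ to a nonzero element, where k is the highest power of f occurring in it: the result is a
-- nonzero multiple of qᵏ applied to the top coefficient. This is a nonzero vector of V, and V is
-- simple.
include hp in
lemma induced_isIrreducible [hV : LieModule.IsIrreducible ℂ ageing V]
    (hq : Function.Injective (LieModule.toEnd ℂ ageing V ⟨gen .q, q_mem_ageing⟩)) :
    LieModule.IsIrreducible ℂ Schr (InducedSchr V) := by
  have h0 : Ind.of ageing.incl (0 : V) = 0 := map_zero (indOf ageing.incl V)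
  have hne : ∀ v : V, v ≠ 0 → Ind.of ageing.incl v ≠ 0 := fun v hv h =>
    hv (ind_of_injective V (h.trans h0.symm))
  have hnt := LieModule.nontrivial_of_isIrreducible ℂ ageing V
  obtain ⟨v₀, hv₀⟩ := exists_ne (0 : V)
  have : Nontrivial (InducedSchr V) := ⟨_, _, hne v₀ hv₀⟩
  refine LieModule.IsIrreducible.mk fun N hN => ?_
  obtain ⟨m, hm, hm0⟩ : ∃ m ∈ N, m ≠ 0 := by
    by_contra! h
    exact hN ((LieSubmodule.eq_bot_iff N).2 h)
  obtain ⟨x, rfl⟩ := fPowMap_surjective V m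
  have hx : x.support.Nonempty := by
    rw [Finsupp.support_nonempty_iff]
    rintro rfl
    exact hm0 (map_zero _)
  set k := x.support.max' hx with hk
  have hxk : x k ≠ 0 := Finsupp.mem_support_iff.1 (x.support.max'_mem hx)
  set P := LieModule.toEnd ℂ Schr (InducedSchr V) (gen .p) with hP
  -- Terms with a power of f below `k` are killed, since their falling factorials vanish.
  have hPx : (P ^ k) (fPowMap V x) = ((-1) ^ k * k.descFactorial k : ℂ) • Ind.of ageing.incl
      (((LieModule.toEnd ℂ ageing V ⟨gen .q, q_mem_ageing⟩) ^ k) (x k)) := by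
    conv_lhs => rw [← x.sum_single]
    rw [Finsupp.sum, map_sum, map_sum, Finset.sum_eq_single k]
    · rw [p_pow_fPowMap_single hp, Nat.sub_self, fPowMap_single_zero]
    · intro j hj hjk
      have hlt : j < k := lt_of_le_of_ne (x.support.le_max' j hj) hjk
      rw [p_pow_fPowMap_single hp, Nat.descFactorial_eq_zero_iff_lt.2 hlt]
      simp
    · intro h
      rw [Finsupp.notMem_support_iff.1 h]
      simp
  have hPmem : (P ^ k) (fPowMap V x) ∈ N := by
    have : ∀ n, (P ^ n) (fPowMap V x) ∈ N := by
      intro n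
      induction n with
      | zero => simpa
      | succ n ih => rw [pow_succ', Module.End.mul_apply]; exact N.lie_mem ih
    exact this k
  rw [hPx] at hPmem
  have hc : ((-1) ^ k * k.descFactorial k : ℂ) ≠ 0 := by
    rw [Nat.descFactorial_self]
    exact mul_ne_zero (pow_ne_zero _ (by norm_num)) (Nat.cast_ne_zero.2 (Nat.factorial_ne_zero k))
  have hof := N.smul_mem ((-1) ^ k * k.descFactorial k : ℂ)⁻¹ hPmem
  rw [smul_smul, inv_mul_cancel₀ hc, one_smul] at hof
  apply eq_top_of_ofPreimage_eq_top
  refine (hV.eq_bot_or_eq_top _).resolve_left fun hbot => ?_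
  have h1 := mem_ofPreimage.2 hof
  rw [hbot, LieSubmodule.mem_bot] at h1
  have hinj : Function.Injective ((LieModule.toEnd ℂ ageing V ⟨gen .q, q_mem_ageing⟩) ^ k) := by
    rw [Module.End.coe_pow]
    exact hq.iterate k
  exact hxk (hinj (h1.trans (map_zero _).symm))

end InducedElements

/-! ### The modules Q(lam, η) -/

section Q

variable {V : Type*} [AddCommGroup V] [Module ℂ V] [LieRingModule ageing V] [LieModule ℂ ageing V]

lemma gradedOps_single {N : Type*} [AddCommGroup N] [Module ℂ N] (B : Gen → ℤ → Module.End ℂ N)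
    (g : Gen) (i : ℤ) (v : N) :
    gradedOps B g (Finsupp.single i v) = Finsupp.single (i + deg g) (B g i v) :=
  shiftOp_single _ _ _ _

/-- Here q merely shifts exponents by one. -/
lemma gradedOps_q_injective {N : Type*} [AddCommGroup N] [Module ℂ N]
    (B : Gen → ℤ → Module.End ℂ N) (hB : ∀ i, B .q i = 1) :
    Function.Injective (gradedOps B .q) := by
  have : ∀ x, gradedOps B .q x = Finsupp.mapDomain (· + 1) x := by
    intro x
    induction x using Finsupp.induction_linear with
    | zero => simp
    | add a b ha hb => rw [map_add, ha, hb, Finsupp.mapDomain_add]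
    | single i v => rw [gradedOps_single, hB, Finsupp.mapDomain_single]; rfl
  intro x y hxy
  rw [this, this] at hxy
  exact Finsupp.mapDomain_injective (add_left_injective 1) hxy

theorem induced_isIrreducible_of_equiv_modQ [LieModule.IsIrreducible ℂ ageing V] {lam η : ℂ}
    (φ : V ≃ₗ⁅ℂ, ageing⁆ (modQ lam η).Space) :
    LieModule.IsIrreducible ℂ Schr (InducedSchr V) := by
  refine induced_isIrreducible (fun v => ?_) ?_
  · apply φ.injective
    have hP : gradedOps (qOps lam η) .p = 0 := by
      refine Finsupp.lhom_ext fun i a => ?_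
      rw [gradedOps_single]
      simp [qOps]
    have := φ.toLieModuleHom.map_lie ⟨gen .p, p_mem_ageing⟩ v
    refine this.trans ((repOfOps_gen p_mem_ageing _).trans ?_)
    rw [hP]
    exact (map_zero φ.toLieModuleHom).symm
  · intro v w hvw
    apply φ.injective
    have h1 := φ.toLieModuleHom.map_lie ⟨gen .q, q_mem_ageing⟩ v
    have h2 := φ.toLieModuleHom.map_lie ⟨gen .q, q_mem_ageing⟩ w
    have h3 : φ.toLieModuleHom ⁅(⟨gen .q, q_mem_ageing⟩ : ageing), v⁆ =
      φ.toLieModuleHom ⁅(⟨gen .q, q_mem_ageing⟩ : ageing), w⁆ := congrArg _ hvw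
    refine gradedOps_q_injective (qOps lam η) (fun _ => rfl) ?_
    have h4 := (repOfOps_gen q_mem_ageing _).symm.trans (h1.symm.trans (h3.trans
      (h2.trans (repOfOps_gen q_mem_ageing _))))
    exact h4

end Q

/-! ## Spaces of representations -/

section RepEquiv

variable {L : Type*} [LieRing L] [LieAlgebra ℂ L] {V : Type*} [AddCommGroup V] [Module ℂ V]

/-- The identification of a vector space with the module defined by a representation on it. -/
def Rep.equiv (ρ : Rep L V) : V ≃ₗ[ℂ] ρ.Space := LinearEquiv.refl ℂ V

lemma Rep.lie_equiv (ρ : Rep L V) (x : L) (v : V) : ⁅x, ρ.equiv v⁆ = ρ.equiv (ρ.act x v) := rfl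

lemma Rep.equiv_symm_lie (ρ : Rep L V) (x : L) (v : ρ.Space) :
    ρ.equiv.symm ⁅x, v⁆ = ρ.act x (ρ.equiv.symm v) := rfl

lemma repOfOps_act_gen {K : LieSubalgebra ℂ Schr} {T : Finset Gen}
    {hφ : ∀ (x : K) k, k ∉ T → K.incl x k = 0} {A : Gen → Module.End ℂ V}
    {hA : ∀ i ∈ T, ∀ j ∈ T, A i * A j - A j * A i = ∑ k, (⁅gen i, gen j⁆ : Schr) k • A k}
    {g : Gen} (hg : gen g ∈ K) : (repOfOps K.incl T hφ A hA).act ⟨gen g, hg⟩ = A g :=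
  LinearMap.ext fun v => repOfOps_gen (hφ := hφ) (hA := hA) hg v

lemma schrRep_act_gen {A : Gen → Module.End ℂ V}
    {hA : ∀ i j, A i * A j - A j * A i = ∑ k, (⁅gen i, gen j⁆ : Schr) k • A k} (g : Gen) :
    (schrRep A hA).act (gen g) = A g :=
  LinearMap.ext fun v => schrRep_gen (hA := hA) g v

end RepEquiv

/-! ## Modules induced from one-dimensional modules -/

/-- The scalars by which the basis vectors act in `charOps μ ζ`. -/
def charVal (μ ζ : ℂ) : Gen → ℂ
  | .h => μ
  | .z => ζ
  | _ => 0

lemma charOps_eq (μ ζ : ℂ) (g : Gen) : charOps μ ζ g = charVal μ ζ g • 1 := by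
  cases g <;> simp [charOps, charVal]

lemma repOfOps_charOps_act {K : LieSubalgebra ℂ Schr} {T : Finset Gen}
    {hφ : ∀ (x : K) k, k ∉ T → K.incl x k = 0} {μ ζ : ℂ}
    {hA : ∀ i ∈ T, ∀ j ∈ T, charOps μ ζ i * charOps μ ζ j - charOps μ ζ j * charOps μ ζ i =
      ∑ k, (⁅gen i, gen j⁆ : Schr) k • charOps μ ζ k} (y : K) (v : ℂ) :
    (repOfOps K.incl T hφ (charOps μ ζ) hA).act y v =
      (∑ g, (y : Schr) g * charVal μ ζ g) * v := by
  change (∑ g, (y : Schr) g • charOps μ ζ g) v = _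
  rw [LinearMap.sum_apply, Finset.sum_mul]
  refine Finset.sum_congr rfl fun g _ => ?_
  rw [charOps_eq]
  simp [mul_assoc]

section CharInduced

variable {K L : LieSubalgebra ℂ Schr} (hKL : K ≤ L) {ρ : Rep K ℂ} {T : Finset Gen} {χ : Gen → ℂ}
  (hT : ∀ g ∈ T, gen g ∈ K) (hρ : ∀ (y : K) (v : ℂ), ρ.act y v = (∑ g, (y : Schr) g * χ g) * v)

/-- The generator of a module induced from a one-dimensional module. -/
def charOf (ρ : Rep K ℂ) : Ind (LieSubalgebra.inclusion hKL) ρ.Space :=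
  Ind.of (LieSubalgebra.inclusion hKL) (ρ.equiv 1)

lemma ind_of_eq_smul_charOf (c : ℂ) :
    Ind.of (LieSubalgebra.inclusion hKL) (ρ.equiv c) = c • charOf hKL ρ := by
  unfold charOf
  rw [← ind_of_smul, ← map_smul, smul_eq_mul, mul_one]

lemma eq_top_of_charOf_mem {N : LieSubmodule ℂ L (Ind (LieSubalgebra.inclusion hKL) ρ.Space)}
    (h : charOf hKL ρ ∈ N) : N = ⊤ :=
  eq_top_of_ind_of_mem fun v => by
    obtain ⟨c, rfl⟩ := ρ.equiv.surjective v
    rw [ind_of_eq_smul_charOf]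
    exact N.smul_mem _ h

include hρ in
lemma gen_lie_charOf {g : Gen} (hg : gen g ∈ K) :
    ⁅(⟨gen g, hKL hg⟩ : L), charOf hKL ρ⁆ = χ g • charOf hKL ρ := by
  have h1 := ind_of_lie (LieSubalgebra.inclusion hKL) ρ.Space ⟨gen g, hg⟩ (ρ.equiv 1)
  refine h1.trans ?_
  rw [ρ.lie_equiv, ind_of_eq_smul_charOf, hρ]
  congr 1
  rw [mul_one, Finset.sum_eq_single g]
  · simp [gen_coord]
  · intro b _ hb; simp [gen_coord, hb]
  · simp

variable {M : Type*} [AddCommGroup M] [Module ℂ M] [LieRingModule L M] [LieModule ℂ L M]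

/-- The universal property of a module induced from a one-dimensional module. -/
def charLift (hρ : ∀ (y : K) (v : ℂ), ρ.act y v = (∑ g, (y : Schr) g * χ g) * v)
    (hK : ∀ x ∈ K, ∀ k ∉ T, x k = 0) (m : M)
    (hm : ∀ g (hg : g ∈ T), ⁅(⟨gen g, hKL (hT g hg)⟩ : L), m⁆ = χ g • m) :
    Ind (LieSubalgebra.inclusion hKL) ρ.Space →ₗ⁅ℂ,L⁆ M :=
  indLift (LinearMap.toSpanSingleton ℂ M m ∘ₗ ρ.equiv.symm.toLinearMap) (by
    intro y v
    simp only [LinearMap.comp_apply, LinearEquiv.coe_coe, LinearMap.toSpanSingleton_apply]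
    rw [Rep.equiv_symm_lie, hρ, lie_smul,
      lie_eq_smul_of_gen (fun g hg => hKL (hT g hg)) (LieSubalgebra.inclusion hKL y)
      (fun k hk => hK y y.2 k hk) hm, smul_smul, mul_comm]
    rfl)

lemma charLift_charOf (hρ : ∀ (y : K) (v : ℂ), ρ.act y v = (∑ g, (y : Schr) g * χ g) * v)
    (hK : ∀ x ∈ K, ∀ k ∉ T, x k = 0) (m : M)
    (hm : ∀ g (hg : g ∈ T), ⁅(⟨gen g, hKL (hT g hg)⟩ : L), m⁆ = χ g • m) :
    charLift hKL hT hρ hK m hm (charOf hKL ρ) = m := by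
  refine (indLift_of _ _ _).trans ?_
  simp

end CharInduced

/-! ### Verma modules over sl₂ -/

section Sl2

variable (μ : ℂ)

lemma sl2BorelChar_act (y : sl2Borel) (v : ℂ) :
    (sl2BorelChar μ).act y v = (∑ g, (y : Schr) g * charVal μ 0 g) * v :=
  repOfOps_charOps_act y v

lemma sl2Borel_coord : ∀ x ∈ sl2Borel, ∀ k ∉ ({.e, .h} : Finset Gen), x k = 0 :=
  fun _ hx => hx

lemma gen_mem_sl2Borel : ∀ g ∈ ({.e, .h} : Finset Gen), gen g ∈ sl2Borel :=
  fun _ hg => gen_mem_coordSub hg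

/-- The generator of the Verma module over `sl₂`. -/
def sl2Vac : vermaSl2 μ := charOf sl2Borel_le (sl2BorelChar μ)

lemma sl2_eq_top {N : LieSubmodule ℂ sl2 (vermaSl2 μ)} (h : sl2Vac μ ∈ N) : N = ⊤ :=
  eq_top_of_charOf_mem sl2Borel_le h

lemma gen_lie_sl2Vac {g : Gen} (hg : g ∈ ({.e, .h} : Finset Gen)) :
    ⁅(⟨gen g, sl2Borel_le (gen_mem_sl2Borel g hg)⟩ : sl2), sl2Vac μ⁆ =
      charVal μ 0 g • sl2Vac μ :=
  gen_lie_charOf sl2Borel_le (sl2BorelChar_act μ) (gen_mem_sl2Borel g hg)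

section

variable {M : Type*} [AddCommGroup M] [Module ℂ M] [LieRingModule sl2 M] [LieModule ℂ sl2 M]

variable {μ} in
/-- The universal property of the Verma module over `sl₂`. -/
def sl2Lift (m : M) (hm : ∀ g (hg : g ∈ ({.e, .h} : Finset Gen)),
    ⁅(⟨gen g, sl2Borel_le (gen_mem_sl2Borel g hg)⟩ : sl2), m⁆ = charVal μ 0 g • m) :
    vermaSl2 μ →ₗ⁅ℂ,sl2⁆ M :=
  charLift sl2Borel_le gen_mem_sl2Borel (sl2BorelChar_act μ) sl2Borel_coord m hm

variable {μ} in
lemma sl2Lift_vac (m : M) (hm : ∀ g (hg : g ∈ ({.e, .h} : Finset Gen)),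
    ⁅(⟨gen g, sl2Borel_le (gen_mem_sl2Borel g hg)⟩ : sl2), m⁆ = charVal μ 0 g • m) :
    sl2Lift m hm (sl2Vac μ) = m :=
  charLift_charOf _ _ _ _ m hm

end

/-- The one-dimensional module over the ageing algebra on which `h` acts as `μ` and the other
basis vectors act as zero. -/
def ageingChar : Rep ageing ℂ :=
  repOfOps ageing.incl {.e, .h, .p, .q, .z} (fun x k hk => x.2 k hk) (charOps μ 0) (by
    intro i hi j hj
    rw [charOps_comm, sum_lie_gen]
    cases i <;> cases j <;> simp [charOps] at *)

/-- By the universal property the generator maps to the generator of the Schrödinger module induced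
from the character h ↦ μ of the ageing algebra. That generator is nonzero by `ind_of_injective`, so
no separate model over sl₂ is needed. -/
lemma sl2Vac_ne_zero : sl2Vac μ ≠ 0 := by
  let C := (ageingChar μ).Space
  let w : C := (ageingChar μ).equiv 1
  let m : InducedSchr C := Ind.of ageing.incl w
  have hm : ∀ g (hg : g ∈ ({.e, .h} : Finset Gen)),
      ⁅(⟨gen g, sl2Borel_le (gen_mem_sl2Borel g hg)⟩ : sl2), m⁆ = charVal μ 0 g • m := by
    intro g hg
    have hg' : gen g ∈ ageing := gen_mem_coordSub (by cases g <;> simp at hg ⊢)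
    change ⁅gen g, m⁆ = _
    rw [gen_lie_ind_of hg', ← ind_of_smul]
    have h1 : (ageingChar μ).act ⟨gen g, hg'⟩ = charOps μ 0 g := repOfOps_act_gen hg'
    rw [Rep.lie_equiv, h1, charOps_eq, ← map_smul]
    rfl
  intro h
  have h1 := sl2Lift_vac m hm
  rw [h, map_zero] at h1
  have h0 : Ind.of ageing.incl (0 : C) = 0 := map_zero (indOf ageing.incl C)
  have : (0 : C) = w := ind_of_injective C (h0.trans h1)
  exact zero_ne_one (α := ℂ) ((ageingChar μ).equiv.injective ((map_zero _).trans this))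

lemma sl2_gen_mem {g : Gen} (hg : g ∈ ({.e, .f, .h} : Finset Gen)) : gen g ∈ sl2 :=
  gen_mem_coordSub hg

/-- The weight vectors `fᵏ w` of the Verma module. -/
def sl2Vec (k : ℕ) : vermaSl2 μ :=
  ((LieModule.toEnd ℂ sl2 (vermaSl2 μ) ⟨gen .f, sl2_gen_mem (by decide)⟩) ^ k) (sl2Vac μ)

lemma sl2Vec_succ (k : ℕ) : sl2Vec μ (k + 1) =
    ⁅(⟨gen .f, sl2_gen_mem (by decide)⟩ : sl2), sl2Vec μ k⁆ := by
  rw [sl2Vec, pow_succ', Module.End.mul_apply, LieModule.toEnd_apply_apply]; rfl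

lemma h_lie_sl2Vec (k : ℕ) : ⁅(⟨gen .h, sl2_gen_mem (by decide)⟩ : sl2), sl2Vec μ k⁆ =
    (μ - 2 * k : ℂ) • sl2Vec μ k := by
  induction k with
  | zero => simpa [charVal, sl2Vec] using gen_lie_sl2Vac μ (g := .h) (by decide)
  | succ k ih =>
    have : (⁅(⟨gen .h, sl2_gen_mem (by decide)⟩ : sl2), (⟨gen .f, sl2_gen_mem (by decide)⟩ : sl2)⁆ :
        sl2) = (-2 : ℂ) • ⟨gen .f, sl2_gen_mem (by decide)⟩ :=
      Subtype.ext lie_relations.2.2.1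
    rw [sl2Vec_succ, leibniz_lie, this, ih, smul_lie, lie_smul, ← add_smul]
    congr 1
    push_cast
    ring

lemma span_sl2Vec : Submodule.span ℂ (Set.range (sl2Vec μ)) = ⊤ := by
  set S := Submodule.span ℂ (Set.range (sl2Vec μ)) with hS
  have hmem : ∀ k, sl2Vec μ k ∈ S := fun k => Submodule.subset_span ⟨k, rfl⟩
  have hstab : ∀ (y : sl2), (∀ k, ⁅y, sl2Vec μ k⁆ ∈ S) → ∀ m ∈ S, ⁅y, m⁆ ∈ S := by
    intro y h m hm
    induction hm using Submodule.span_induction with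
    | mem x hx => obtain ⟨k, rfl⟩ := hx; exact h k
    | zero => rw [lie_zero]; exact Submodule.zero_mem _
    | add a b _ _ ha hb => rw [lie_add]; exact Submodule.add_mem _ ha hb
    | smul c a _ ha => rw [lie_smul]; exact Submodule.smul_mem _ _ ha
  have hf := hstab ⟨gen .f, sl2_gen_mem (by decide)⟩
    (fun k => by rw [← sl2Vec_succ]; exact hmem _)
  have hh := hstab ⟨gen .h, sl2_gen_mem (by decide)⟩
    (fun k => by rw [h_lie_sl2Vec]; exact S.smul_mem _ (hmem _))
  -- Induction on k through e f = f e + h; this uses the stability under f and h already obtained.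
  have he := hstab ⟨gen .e, sl2_gen_mem (by decide)⟩ (fun k => by
    induction k with
    | zero =>
      have h0 : ⁅(⟨gen .e, sl2_gen_mem (by decide)⟩ : sl2), sl2Vec μ 0⁆ = 0 := by
        simpa [charVal, sl2Vec] using gen_lie_sl2Vac μ (g := .e) (by decide)
      rw [h0]
      exact S.zero_mem
    | succ k ih =>
      have : (⁅(⟨gen .e, sl2_gen_mem (by decide)⟩ : sl2),
          (⟨gen .f, sl2_gen_mem (by decide)⟩ : sl2)⁆ : sl2) =
          ⟨gen .h, sl2_gen_mem (by decide)⟩ := Subtype.ext lie_relations.2.1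
      rw [sl2Vec_succ, leibniz_lie, this]
      exact S.add_mem (hh _ (hmem _)) (hf _ ih))
  let N : LieSubmodule ℂ sl2 (vermaSl2 μ) :=
    { S with
      lie_mem := by
        intro y m hm
        refine lie_mem_of_gen sl2_coord gen_mem_sl2 S ?_ y hm
        intro g hg m hm
        cases g <;> simp at hg
        · exact he m hm
        · exact hf m hm
        · exact hh m hm }
  exact congrArg LieSubmodule.toSubmodule (sl2_eq_top μ (N := N) (hmem 0))

/-- The weights `μ - 2k` with k > 0 differ from `μ`, so the generator spans its weight space. -/
lemma sl2_sumProper_ne_top : sumProper sl2 (vermaSl2 μ) ≠ ⊤ := by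
  have hh0 : ⁅(⟨gen .h, sl2_gen_mem (by decide)⟩ : sl2), sl2Vac μ⁆ = μ • sl2Vac μ := by
    simpa [sl2Vec] using h_lie_sl2Vec μ 0
  refine sumProper_ne_top _ (sl2Vac_ne_zero μ) hh0 (fun N hN => sl2_eq_top μ hN) fun m => ?_
  have hm : m ∈ Submodule.span ℂ (Set.range (sl2Vec μ)) := by rw [span_sl2Vec]; trivial
  induction hm using Submodule.span_induction with
  | mem x hx =>
    obtain ⟨k, rfl⟩ := hx
    rcases Nat.eq_zero_or_pos k with rfl | hk
    · exact ⟨1, 0, Submodule.zero_mem _, by simp [sl2Vec]⟩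
    · refine ⟨0, _, ?_, by rw [zero_smul, zero_add]⟩
      refine Submodule.mem_iSup_of_mem ⟨μ - 2 * k, ?_⟩ ?_
      · simp [hk.ne']
      · exact Module.End.mem_eigenspace_iff.2 (h_lie_sl2Vec μ k)
  | zero => exact ⟨0, 0, Submodule.zero_mem _, by simp⟩
  | add a b _ _ ha hb =>
    obtain ⟨r, y, hy, rfl⟩ := ha
    obtain ⟨r', y', hy', rfl⟩ := hb
    exact ⟨r + r', y + y', Submodule.add_mem _ hy hy', by module⟩
  | smul c a _ ha =>
    obtain ⟨r, y, hy, rfl⟩ := ha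
    exact ⟨c * r, c • y, Submodule.smul_mem _ _ hy, by module⟩

end Sl2

/-! ## Extensions of `sl₂`-modules -/

section Sl2Ext

variable {W : Type*} [AddCommGroup W] [Module ℂ W] [LieRingModule sl2 W] [LieModule ℂ sl2 W]

lemma projSl2_coe (x : sl2) : projSl2 (x : Schr) = x := by
  apply Subtype.ext
  change (x : Schr) .e • gen .e + (x : Schr) .f • gen .f + (x : Schr) .h • gen .h = (x : Schr)
  ext g
  have := sl2_coord x x.2 g
  cases g <;> simp [gen_coord] at this ⊢ <;> exact this.symm

lemma sl2Ext_lie_coe (s : sl2) (y : W) :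
    ⁅(s : Schr), (sl2Ext W).equiv y⁆ = (sl2Ext W).equiv ⁅s, y⁆ := by
  have : (sl2Ext W).act (s : Schr) y = ⁅projSl2 (s : Schr), y⁆ := rfl
  rw [Rep.lie_equiv, this, projSl2_coe]

lemma projSl2_of_mem_heis {x : Schr} (hx : x ∈ heis) : projSl2 x = 0 := by
  apply Subtype.ext
  change x .e • gen .e + x .f • gen .f + x .h • gen .h = 0
  rw [heis_coord x hx .e (by decide), heis_coord x hx .f (by decide), heis_coord x hx .h (by decide)]
  simp

lemma sl2Ext_lie_of_mem_heis {x : Schr} (hx : x ∈ heis) (y : (sl2Ext W).Space) : ⁅x, y⁆ = 0 := by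
  obtain ⟨y, rfl⟩ := (sl2Ext W).equiv.surjective y
  have : (sl2Ext W).act x y = ⁅projSl2 x, y⁆ := rfl
  rw [Rep.lie_equiv, this, projSl2_of_mem_heis hx, zero_lie, map_zero]

lemma mem_of_gen_mem_coordSub {T : Finset Gen}
    {hT : ∀ i ∈ T, ∀ j ∈ T, ∀ k, k ∉ T → (⁅gen i, gen j⁆ : Schr) k = 0} {g : Gen}
    (h : gen g ∈ coordSub T hT) : g ∈ T := by
  by_contra hg
  have := h g hg
  simp [gen_coord] at this

/-- The Heisenberg algebra is an ideal: its elements have no e, f or h coordinate, and then neither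
does the bracket. -/
lemma lie_mem_heis (x : Schr) {u : Schr} (hu : u ∈ heis) : ⁅x, u⁆ ∈ heis := by
  have h1 := heis_coord u hu .e (by decide)
  have h2 := heis_coord u hu .f (by decide)
  have h3 := heis_coord u hu .h (by decide)
  intro k hk
  rw [lie_def]
  cases k <;> simp at hk <;> simp [bracket, h1, h2, h3]

/-- The basis vectors lie in `sl₂` or in the Heisenberg algebra. -/
lemma gen_mem_sl2_or_heis (g : Gen) : gen g ∈ sl2 ∨ gen g ∈ heis := by
  cases g
  · exact Or.inl (gen_mem_coordSub (by decide))
  · exact Or.inl (gen_mem_coordSub (by decide))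
  · exact Or.inl (gen_mem_coordSub (by decide))
  · exact Or.inr (gen_mem_coordSub (by decide))
  · exact Or.inr (gen_mem_coordSub (by decide))
  · exact Or.inr (gen_mem_coordSub (by decide))

end Sl2Ext

/-! ## Inducing the restriction of a Schrödinger module -/

section TensorIdentity

variable {X : Type*} [AddCommGroup X] [Module ℂ X] [LieRingModule Schr X] [LieModule ℂ Schr X]
  {V : Type*} [AddCommGroup V] [Module ℂ V] [LieRingModule ageing V] [LieModule ℂ ageing V]
  {μ : ℂ} (θ : X ≃ₗ[ℂ] V)

/-- `V` is the restriction of `X` to the ageing algebra, twisted by the character `h ↦ μ`. -/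
def IsTwist (μ : ℂ) (θ : X ≃ₗ[ℂ] V) : Prop :=
  ∀ g (hg : gen g ∈ ageing) (x : X),
    ⁅(⟨gen g, hg⟩ : ageing), θ x⁆ = θ ⁅gen g, x⁆ + charVal μ 0 g • θ x

variable {θ} (hθ : IsTwist μ θ)

variable (μ) in
/-- The generator of the Verma module over `sl₂`, in its extension to the Schrödinger algebra. -/
def extVac : (sl2Ext (vermaSl2 μ)).Space := (sl2Ext (vermaSl2 μ)).equiv (sl2Vac μ)

/-- The generator spans the character h ↦ μ of the ageing algebra. Tensoring X with it reproduces
the twist in `IsTwist`. -/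
lemma gen_lie_extVac {g : Gen} (hg : g ≠ .f) : ⁅gen g, extVac μ⁆ = charVal μ 0 g • extVac μ := by
  rcases gen_mem_sl2_or_heis g with h | h
  · have hg' : g ∈ ({.e, .h} : Finset Gen) := by
      have := mem_of_gen_mem_coordSub h
      simp only [Finset.mem_insert, Finset.mem_singleton] at this ⊢
      tauto
    unfold extVac
    rw [← map_smul, ← gen_lie_sl2Vac μ hg']
    exact sl2Ext_lie_coe (W := vermaSl2 μ) ⟨gen g, h⟩ _
  · rw [sl2Ext_lie_of_mem_heis h]
    have h1 := mem_of_gen_mem_coordSub h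
    have : charVal μ 0 g = 0 := by
      cases g <;> simp [charVal]
      simp at h1
    rw [this, zero_smul]

/-- The homomorphism from the induced module determined by `θ x ↦ x ⊗ w`. -/
def toTensor (hθ : IsTwist μ θ) :
    InducedSchr V →ₗ⁅ℂ,Schr⁆ X ⊗[ℂ] (sl2Ext (vermaSl2 μ)).Space :=
  indLift
    ((TensorProduct.mk ℂ X (sl2Ext (vermaSl2 μ)).Space).flip (extVac μ) ∘ₗ θ.symm.toLinearMap)
    (map_lie_of_gen (N := X ⊗[ℂ] (sl2Ext (vermaSl2 μ)).Space) ageing_coord gen_mem_ageing _ (by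
      intro g hg v
      have hg' : g ≠ .f := by rintro rfl; simp at hg
      obtain ⟨x, rfl⟩ := θ.surjective v
      change θ.symm _ ⊗ₜ[ℂ] extVac μ = ⁅gen g, θ.symm (θ x) ⊗ₜ[ℂ] extVac μ⁆
      rw [hθ, map_add, map_smul, θ.symm_apply_apply, θ.symm_apply_apply,
        TensorProduct.LieModule.lie_tmul_right, gen_lie_extVac hg', TensorProduct.add_tmul,
        TensorProduct.smul_tmul]))

lemma toTensor_of (x : X) : toTensor hθ (Ind.of ageing.incl (θ x)) = x ⊗ₜ[ℂ] extVac μ := by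
  refine (indLift_of _ _ _).trans ?_
  change θ.symm (θ x) ⊗ₜ[ℂ] _ = _
  rw [θ.symm_apply_apply]

/-- The `sl₂`-homomorphism from the Verma module sending the generator to `x ↦ θ x`. -/
def toHom (hθ : IsTwist μ θ) : vermaSl2 μ →ₗ⁅ℂ,sl2⁆ (X →ₗ[ℂ] InducedSchr V) :=
  sl2Lift (indOf ageing.incl V ∘ₗ θ.toLinearMap) (by
    intro g hg
    have hg' : gen g ∈ ageing := gen_mem_coordSub (by cases g <;> simp at hg ⊢)
    -- In the sl₂-module Hom(X, H(V)), being a highest weight vector of weight μ is exactly the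
    -- twist condition for e and h.
    ext x
    rw [LieHom.lie_apply]
    change ⁅gen g, Ind.of ageing.incl (θ x)⁆ - indOf ageing.incl V (θ ⁅gen g, x⁆) =
      charVal μ 0 g • indOf ageing.incl V (θ x)
    rw [gen_lie_ind_of hg']
    change indOf ageing.incl V _ - _ = _
    rw [← map_sub, ← map_smul, hθ, add_sub_cancel_left])

lemma toHom_vac (x : X) : toHom hθ (sl2Vac μ) x = Ind.of ageing.incl (θ x) := by
  unfold toHom
  rw [sl2Lift_vac]
  rfl

lemma toHom_lie_sl2 (s : sl2) (y : vermaSl2 μ) (x : X) :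
    toHom hθ ⁅s, y⁆ x = ⁅(s : Schr), toHom hθ y x⁆ - toHom hθ y ⁅(s : Schr), x⁆ := by
  rw [LieModuleHom.map_lie]
  rfl

/-- The `y` giving Heisenberg-linear maps form an sl₂-submodule, because brackets with sl₂ stay in
the Heisenberg algebra. It contains the generator, as the twisting character vanishes on p, q and z.
-/
lemma toHom_lie_heis (y : vermaSl2 μ) {u : Schr} (hu : u ∈ heis) (x : X) :
    toHom hθ y ⁅u, x⁆ = ⁅u, toHom hθ y x⁆ := by
  let N : LieSubmodule ℂ sl2 (vermaSl2 μ) :=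
    { carrier := {y | ∀ u ∈ heis, ∀ x, toHom hθ y ⁅u, x⁆ = ⁅u, toHom hθ y x⁆}
      add_mem' := by
        intro a b ha hb u hu x
        rw [map_add, LinearMap.add_apply, LinearMap.add_apply, ha u hu, hb u hu, lie_add]
      zero_mem' := by
        intro u hu x
        rw [map_zero, LinearMap.zero_apply, LinearMap.zero_apply, lie_zero]
      smul_mem' := by
        intro c a ha u hu x
        rw [map_smul, LinearMap.smul_apply, LinearMap.smul_apply, ha u hu, lie_smul]
      lie_mem := by
        intro s y hy u hu x
        change ∀ u ∈ heis, ∀ x, toHom hθ y ⁅u, x⁆ = ⁅u, toHom hθ y x⁆ at hy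
        rw [toHom_lie_sl2, toHom_lie_sl2, leibniz_lie (s : Schr) u x, map_add, hy u hu,
          hy u hu, hy _ (lie_mem_heis s hu), lie_sub, leibniz_lie (s : Schr) u]
        abel }
  have hN : N = ⊤ := by
    refine sl2_eq_top μ (N := N) ?_
    intro u hu x
    rw [toHom_vac, toHom_vac]
    have hu' : u ∈ ageing := fun k hk => hu k (fun h => hk (by cases k <;> simp at h ⊢))
    have h1 := ind_of_lie ageing.incl V ⟨u, hu'⟩ (θ x)
    refine Eq.trans ?_ h1.symm
    congr 1
    have h2 : ⁅u, x⁆ = _ := lie_eq_sum_attach_of_coord gen_mem_heis (⟨u, hu⟩ : heis)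
      (heis_coord u hu) x
    rw [h2, lie_eq_sum_attach_of_coord (K := ageing) (T := {.p, .q, .z}) (fun g hg => gen_mem_coordSub
      (by cases g <;> simp at hg ⊢)) (⟨u, hu'⟩ : ageing) (heis_coord u hu) (θ x), map_sum]
    refine Finset.sum_congr rfl fun g _ => ?_
    obtain ⟨g, hg⟩ := g
    have hg' : gen g ∈ ageing := gen_mem_coordSub (by cases g <;> simp at hg ⊢)
    have hχ : charVal μ 0 g = 0 := by cases g <;> simp at hg <;> rfl
    have key : ⁅(⟨gen g, hg'⟩ : ageing), θ x⁆ = θ ⁅gen g, x⁆ := by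
      rw [hθ, hχ, zero_smul, add_zero]
    rw [map_smul]
    exact congrArg (u g • ·) key.symm
  have hy : y ∈ N := by rw [hN]; trivial
  exact hy u hu x

/-- The homomorphism to the induced module determined by `x ⊗ w ↦ θ x`. -/
def ofTensor (hθ : IsTwist μ θ) :
    X ⊗[ℂ] (sl2Ext (vermaSl2 μ)).Space →ₗ⁅ℂ,Schr⁆ InducedSchr V :=
  schrHom (TensorProduct.lift (((toHom hθ : vermaSl2 μ →ₗ[ℂ] X →ₗ[ℂ] InducedSchr V) ∘ₗ
    (sl2Ext (vermaSl2 μ)).equiv.symm.toLinearMap).flip)) (by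
    intro g t
    induction t using TensorProduct.induction_on with
    | zero => rw [lie_zero, map_zero, lie_zero]
    | add a b ha hb => rw [lie_add, map_add, map_add, lie_add, ha, hb]
    | tmul x y =>
      obtain ⟨y, rfl⟩ := (sl2Ext (vermaSl2 μ)).equiv.surjective y
      have hlift : ∀ x y, TensorProduct.lift
          (((toHom hθ : vermaSl2 μ →ₗ[ℂ] X →ₗ[ℂ] InducedSchr V) ∘ₗ
          (sl2Ext (vermaSl2 μ)).equiv.symm.toLinearMap).flip)
          (x ⊗ₜ[ℂ] (sl2Ext (vermaSl2 μ)).equiv y) = toHom hθ y x := fun _ _ => rfl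
      rw [TensorProduct.LieModule.lie_tmul_right, map_add, hlift, hlift]
      rcases gen_mem_sl2_or_heis g with h | h
      · have h1 := sl2Ext_lie_coe (W := vermaSl2 μ) ⟨gen g, h⟩ y
        have h2 := toHom_lie_sl2 hθ ⟨gen g, h⟩ y x
        dsimp only at h1 h2
        rw [h1, hlift, h2]
        exact add_sub_cancel _ _
      · rw [sl2Ext_lie_of_mem_heis h, toHom_lie_heis hθ _ h, TensorProduct.tmul_zero, map_zero,
          add_zero])

lemma ofTensor_tmul (x : X) (y : vermaSl2 μ) :
    ofTensor hθ (x ⊗ₜ[ℂ] (sl2Ext (vermaSl2 μ)).equiv y) = toHom hθ y x := rfl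

/-- Both homomorphisms agree on the inducing module: θx ↦ x ⊗ w ↦ θx. -/
lemma ofTensor_toTensor (m : InducedSchr V) : ofTensor hθ (toTensor hθ m) = m := by
  have : (ofTensor hθ).comp (toTensor hθ) = LieModuleHom.id := ind_hom_ext fun v => by
    obtain ⟨x, rfl⟩ := θ.surjective v
    rw [LieModuleHom.comp_apply, toTensor_of, extVac, ofTensor_tmul, toHom_vac]
    rfl
  exact DFunLike.congr_fun this m

/-- The `y` for which all x ⊗ y are fixed form an sl₂-submodule containing the generator of the
Verma module. -/
lemma toTensor_ofTensor (t : X ⊗[ℂ] (sl2Ext (vermaSl2 μ)).Space) :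
    toTensor hθ (ofTensor hθ t) = t := by
  set E := (sl2Ext (vermaSl2 μ)).equiv with hE
  let N : LieSubmodule ℂ sl2 (vermaSl2 μ) :=
    { carrier := {y | ∀ x : X, toTensor hθ (ofTensor hθ (x ⊗ₜ[ℂ] E y)) = x ⊗ₜ[ℂ] E y}
      add_mem' := by
        intro a b ha hb x
        rw [map_add, TensorProduct.tmul_add, map_add, map_add, ha, hb]
      zero_mem' := by
        intro x
        rw [map_zero, TensorProduct.tmul_zero, map_zero, map_zero]
      smul_mem' := by
        intro c a ha x
        rw [map_smul, TensorProduct.tmul_smul, map_smul, map_smul, ha]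
      lie_mem := by
        intro s y hy x
        change ∀ x : X, toTensor hθ (ofTensor hθ (x ⊗ₜ[ℂ] E y)) = x ⊗ₜ[ℂ] E y at hy
        -- Leibniz rule: x ⊗ sy = s(x ⊗ y) - sx ⊗ y reduces the claim for `⁅s, y⁆` to that for `y`,
        -- at x and at sx.
        have h1 : x ⊗ₜ[ℂ] E ⁅s, y⁆ = ⁅(s : Schr), x ⊗ₜ[ℂ] E y⁆ - ⁅(s : Schr), x⁆ ⊗ₜ[ℂ] E y := by
          rw [TensorProduct.LieModule.lie_tmul_right, add_sub_cancel_left, hE, sl2Ext_lie_coe]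
        rw [h1, map_sub, map_sub, LieModuleHom.map_lie, LieModuleHom.map_lie, hy, hy] }
  have hN : N = ⊤ := by
    refine sl2_eq_top μ (N := N) ?_
    intro x
    rw [hE, ofTensor_tmul, toHom_vac, toTensor_of]
    rfl
  induction t using TensorProduct.induction_on with
  | zero => rw [map_zero, map_zero]
  | add a b ha hb => rw [map_add, map_add, ha, hb]
  | tmul x y =>
    obtain ⟨y, rfl⟩ := E.surjective y
    have hy : y ∈ N := by rw [hN]; trivial
    exact hy x

-- The tensor identity: inducing the restriction of X, twisted by h ↦ μ, amounts to tensoring X with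
-- the module induced from that character. The second factor is here the Verma module over sl₂ with
-- the Heisenberg algebra acting as zero.
include hθ in
theorem induced_equiv_tensor :
    Nonempty (InducedSchr V ≃ₗ⁅ℂ,Schr⁆ X ⊗[ℂ] (sl2Ext (vermaSl2 μ)).Space) :=
  ⟨lieModuleEquivOfBijective (toTensor hθ)
    ⟨Function.LeftInverse.injective (g := ofTensor hθ) (ofTensor_toTensor hθ),
      Function.RightInverse.surjective (g := ofTensor hθ) (toTensor_ofTensor hθ)⟩⟩

end TensorIdentity

/-! ## Tensor products of Heisenberg modules with `sl₂`-modules -/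

section TensorQuotient

variable {X : Type*} [AddCommGroup X] [Module ℂ X] [LieRingModule Schr X] [LieModule ℂ Schr X]

/-- Stability of a subspace under the Heisenberg algebra. -/
def HeisStable (S : Submodule ℂ X) : Prop :=
  ∀ g ∈ ({.p, .q, .z} : Finset Gen), ∀ x ∈ S, ⁅gen g, x⁆ ∈ S

/-- A module on which only the trivial subspaces are stable under the Heisenberg algebra. -/
def HeisSimple (X : Type*) [AddCommGroup X] [Module ℂ X] [LieRingModule Schr X]
    [LieModule ℂ Schr X] : Prop :=
  ∀ S : Submodule ℂ X, HeisStable S → S = ⊥ ∨ S = ⊤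

variable {ι : Type*} {x : ι → X} (hspan : Submodule.span ℂ (Set.range x) = ⊤) {α : ι → ℂ}
  (hα : Function.Injective α) (hx : ∀ i, ⁅gen .p, ⁅gen .q, x i⁆⁆ = α i • x i)

-- A nonzero stable subspace contains some `x i`, because pq separates the spanning vectors by its
-- eigenvalues. The chain condition then gives all the others.
include hspan hα hx in
lemma heisSimple_of_chain (hchain : ∀ S : Submodule ℂ X, HeisStable S → ∀ i j, x i ∈ S → x j ∈ S) :
    HeisSimple X := by
  intro S hS
  by_contra! h
  apply h.2
  obtain ⟨m, hm, hm0⟩ := S.ne_bot_iff.1 h.1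
  have hms : m ∈ Submodule.span ℂ (Set.range x) := by rw [hspan]; trivial
  obtain ⟨c, rfl⟩ := Finsupp.mem_span_range_iff_exists_finsupp.1 hms
  obtain ⟨i, hi, hci⟩ := Finset.exists_ne_zero_of_sum_ne_zero hm0
  have hmem := mem_of_sum_eigenvectors_mem
    (T := LieModule.toEnd ℂ Schr X (gen .p) * LieModule.toEnd ℂ Schr X (gen .q)) (W := S)
    (fun w hw => hS .p (by decide) _ (hS .q (by decide) _ hw)) c.support α hα (fun i => c i • x i)
    (fun i _ => by
      rw [map_smul, Module.End.mul_apply, LieModule.toEnd_apply_apply,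
        LieModule.toEnd_apply_apply, hx, smul_comm]) hm hi
  have hc : c i ≠ 0 := fun h => hci (by simp [h])
  have hxi : x i ∈ S := by
    have := S.smul_mem (c i)⁻¹ hmem
    rwa [smul_smul, inv_mul_cancel₀ hc, one_smul] at this
  rw [eq_top_iff, ← hspan, Submodule.span_le]
  rintro _ ⟨j, rfl⟩
  exact hchain S hS i j hxi

variable {W : Type*} [AddCommGroup W] [Module ℂ W] [LieRingModule sl2 W] [LieModule ℂ sl2 W]

lemma heis_lie_tmul {g : Gen} (hg : g ∈ ({.p, .q, .z} : Finset Gen)) (a : X)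
    (y : (sl2Ext W).Space) : ⁅gen g, a ⊗ₜ[ℂ] y⁆ = ⁅gen g, a⁆ ⊗ₜ[ℂ] y := by
  rw [TensorProduct.LieModule.lie_tmul_right, sl2Ext_lie_of_mem_heis (gen_mem_heis g hg),
    TensorProduct.tmul_zero, add_zero]

-- The `x i` only have to span; no uniqueness of the expansion is needed, since the eigenvalues of
-- pq separate the terms.
include hspan in
lemma exists_finsupp_tensor (t : X ⊗[ℂ] (sl2Ext W).Space) :
    ∃ y : ι →₀ (sl2Ext W).Space, t = ∑ i ∈ y.support, x i ⊗ₜ[ℂ] y i := by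
  let Ψ : (ι →₀ (sl2Ext W).Space) →ₗ[ℂ] X ⊗[ℂ] (sl2Ext W).Space :=
    Finsupp.lsum ℂ fun i => TensorProduct.mk ℂ X (sl2Ext W).Space (x i)
  have hΨ : ∀ y, Ψ y = ∑ i ∈ y.support, x i ⊗ₜ[ℂ] y i := fun y => rfl
  have hmem : t ∈ LinearMap.range Ψ := by
    induction t using TensorProduct.induction_on with
    | zero => exact Submodule.zero_mem _
    | add a b ha hb => exact Submodule.add_mem _ ha hb
    | tmul a y =>
      have ha : a ∈ Submodule.span ℂ (Set.range x) := by rw [hspan]; trivial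
      induction ha using Submodule.span_induction with
      | mem a ha =>
        obtain ⟨i, rfl⟩ := ha
        refine ⟨Finsupp.single i y, ?_⟩
        simp [Ψ]
      | zero => rw [TensorProduct.zero_tmul]; exact Submodule.zero_mem _
      | add a b _ _ ha hb => rw [TensorProduct.add_tmul]; exact Submodule.add_mem _ ha hb
      | smul c a _ ha => rw [← TensorProduct.smul_tmul']; exact Submodule.smul_mem _ _ ha
  obtain ⟨y, rfl⟩ := hmem
  exact ⟨y, hΨ y⟩

variable (W) in
/-- The quotient map to the simple quotient, extended to the Schrödinger algebra. -/
def extMk : (sl2Ext W).Space →ₗ⁅ℂ,Schr⁆ (sl2Ext (SimpleTop sl2 W)).Space :=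
  { (sl2Ext (SimpleTop sl2 W)).equiv.toLinearMap ∘ₗ
      (LieSubmodule.Quotient.mk' (sumProper sl2 W) : W →ₗ[ℂ] SimpleTop sl2 W) ∘ₗ
      (sl2Ext W).equiv.symm.toLinearMap with
    map_lie' := fun {s y} =>
      (LieSubmodule.Quotient.mk' (sumProper sl2 W)).map_lie (projSl2 s) ((sl2Ext W).equiv.symm y) }

lemma extMk_equiv (y : W) : extMk W ((sl2Ext W).equiv y) =
    (sl2Ext (SimpleTop sl2 W)).equiv (LieSubmodule.Quotient.mk' (sumProper sl2 W) y) := rfl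

lemma extMk_surjective : Function.Surjective (extMk W) := by
  intro y
  obtain ⟨y, rfl⟩ := (sl2Ext (SimpleTop sl2 W)).equiv.surjective y
  obtain ⟨y, rfl⟩ := LieSubmodule.Quotient.surjective_mk' _ y
  exact ⟨_, extMk_equiv y⟩

variable (X W) in
/-- The tensor product of the identity with the quotient map. -/
def tensorMk : X ⊗[ℂ] (sl2Ext W).Space →ₗ⁅ℂ,Schr⁆ X ⊗[ℂ] (sl2Ext (SimpleTop sl2 W)).Space :=
  TensorProduct.LieModule.map LieModuleHom.id (extMk W)

lemma tensorMk_tmul (a : X) (y : (sl2Ext W).Space) :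
    tensorMk X W (a ⊗ₜ[ℂ] y) = a ⊗ₜ[ℂ] extMk W y := TensorProduct.LieModule.map_tmul _ _ _ _

lemma tensorMk_surjective : Function.Surjective (tensorMk X W) := by
  intro t
  change t ∈ LinearMap.range (tensorMk X W).toLinearMap
  induction t using TensorProduct.induction_on with
  | zero => exact Submodule.zero_mem _
  | add a b ha hb => exact Submodule.add_mem _ ha hb
  | tmul a y =>
    obtain ⟨y, rfl⟩ := extMk_surjective y
    exact ⟨a ⊗ₜ y, tensorMk_tmul a y⟩

/-- The elements `y` such that `X ⊗ y` lies in a submodule of the tensor product. -/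
def rightPart (N : LieSubmodule ℂ Schr (X ⊗[ℂ] (sl2Ext W).Space)) : LieSubmodule ℂ sl2 W where
  carrier := {y | ∀ a : X, a ⊗ₜ[ℂ] (sl2Ext W).equiv y ∈ N}
  add_mem' := by
    intro y y' hy hy' a
    rw [map_add, TensorProduct.tmul_add]
    exact N.add_mem (hy a) (hy' a)
  zero_mem' := by
    intro a
    rw [map_zero, TensorProduct.tmul_zero]
    exact N.zero_mem
  smul_mem' := by
    intro c y hy a
    rw [map_smul, TensorProduct.tmul_smul]
    exact N.smul_mem c (hy a)
  lie_mem := by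
    intro s y hy a
    have h1 : a ⊗ₜ[ℂ] (sl2Ext W).equiv ⁅s, y⁆ = ⁅(s : Schr), a ⊗ₜ[ℂ] (sl2Ext W).equiv y⁆ -
        ⁅(s : Schr), a⁆ ⊗ₜ[ℂ] (sl2Ext W).equiv y := by
      rw [TensorProduct.LieModule.lie_tmul_right, add_sub_cancel_left, sl2Ext_lie_coe]
    rw [h1]
    exact N.sub_mem (N.lie_mem (hy a)) (hy _)

lemma rightPart_ne_top {N : LieSubmodule ℂ Schr (X ⊗[ℂ] (sl2Ext W).Space)} (hN : N ≠ ⊤) :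
    rightPart N ≠ ⊤ := by
  intro h
  apply hN
  rw [eq_top_iff]
  intro t _
  induction t using TensorProduct.induction_on with
  | zero => exact N.zero_mem
  | add a b ha hb => exact N.add_mem (ha trivial) (hb trivial)
  | tmul a y =>
    obtain ⟨y, rfl⟩ := (sl2Ext W).equiv.surjective y
    have : y ∈ rightPart N := by rw [h]; trivial
    exact this a

-- As pq acts on the left factor only, each term xᵢ ⊗ yᵢ of an element of N lies in N. If xᵢ is
-- nonzero, Heisenberg-simplicity upgrades this to X ⊗ yᵢ ⊆ N, so yᵢ lies in the right part of N, a
-- proper submodule of W.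
include hspan hα hx in
lemma le_ker_tensorMk (hX : HeisSimple X) {N : LieSubmodule ℂ Schr (X ⊗[ℂ] (sl2Ext W).Space)}
    (hN : N ≠ ⊤) : N ≤ (tensorMk X W).ker := by
  intro t ht
  obtain ⟨y, rfl⟩ := exists_finsupp_tensor hspan t
  rw [LieModuleHom.mem_ker, map_sum]
  refine Finset.sum_eq_zero fun i hi => ?_
  have hmem := mem_of_sum_eigenvectors_mem
    (T := LieModule.toEnd ℂ Schr (X ⊗[ℂ] (sl2Ext W).Space) (gen .p) *
      LieModule.toEnd ℂ Schr (X ⊗[ℂ] (sl2Ext W).Space) (gen .q)) (W := N.toSubmodule)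
    (fun w hw => N.lie_mem (N.lie_mem hw)) y.support α hα (fun i => x i ⊗ₜ[ℂ] y i)
    (fun i _ => by
      rw [Module.End.mul_apply, LieModule.toEnd_apply_apply,
        LieModule.toEnd_apply_apply, heis_lie_tmul (by decide), heis_lie_tmul (by decide), hx,
        TensorProduct.smul_tmul']) ht hi
  rw [tensorMk_tmul]
  obtain ⟨w, hw⟩ := (sl2Ext W).equiv.surjective (y i)
  simp only [← hw] at hmem ⊢
  -- The left factors a with a ⊗ w in N form a Heisenberg-stable subspace, which is therefore zero
  -- or all of X.
  let S : Submodule ℂ X :=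
    { carrier := {a | a ⊗ₜ[ℂ] (sl2Ext W).equiv w ∈ N}
      add_mem' := by
        intro a b ha hb
        change (a + b) ⊗ₜ[ℂ] _ ∈ N
        rw [TensorProduct.add_tmul]
        exact N.add_mem ha hb
      zero_mem' := by
        change (0 : X) ⊗ₜ[ℂ] _ ∈ N
        rw [TensorProduct.zero_tmul]
        exact N.zero_mem
      smul_mem' := by
        intro c a ha
        change (c • a) ⊗ₜ[ℂ] _ ∈ N
        rw [← TensorProduct.smul_tmul']
        exact N.smul_mem c ha }
  have hS : HeisStable S := by
    intro g hg a ha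
    change ⁅gen g, a⁆ ⊗ₜ[ℂ] _ ∈ N
    rw [← heis_lie_tmul hg]
    exact N.lie_mem ha
  have hxi : x i ∈ S := hmem
  rcases hX S hS with h | h
  · rw [h, Submodule.mem_bot] at hxi
    rw [hxi, TensorProduct.zero_tmul]
  · have hwr : w ∈ rightPart N := fun a => by
      have : a ∈ S := by rw [h]; trivial
      exact this
    have hws : w ∈ sumProper sl2 W := le_sumProper (rightPart_ne_top hN) hwr
    rw [extMk_equiv, (LieSubmodule.Quotient.mk_eq_zero _).2 hws, map_zero, TensorProduct.tmul_zero]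

-- The kernel of the quotient map is the largest proper submodule. It is proper because both factors
-- of the target are nonzero.
include hspan hα hx in
theorem tensor_hasUniqueSimpleQuotientIso [Nontrivial X] (hX : HeisSimple X)
    (hW : sumProper sl2 W ≠ ⊤) :
    HasUniqueSimpleQuotientIso Schr (X ⊗[ℂ] (sl2Ext W).Space)
      (X ⊗[ℂ] (sl2Ext (SimpleTop sl2 W)).Space) := by
  refine ⟨(tensorMk X W).ker, isIrreducible_quotient_iff_eq ?_
    (fun _ => le_ker_tensorMk hspan hα hx hX),
    nonempty_quotient_ker_equiv _ tensorMk_surjective⟩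
  have hirr := (isIrreducible_quotient_iff_eq hW (fun _ => le_sumProper) _).2 rfl
  have : Nontrivial (SimpleTop sl2 W) := LieModule.nontrivial_of_isIrreducible ℂ sl2 _
  have : Nontrivial (sl2Ext (SimpleTop sl2 W)).Space :=
    (sl2Ext (SimpleTop sl2 W)).equiv.symm.toEquiv.nontrivial
  obtain ⟨t, ht⟩ := exists_ne (0 : X ⊗[ℂ] (sl2Ext (SimpleTop sl2 W)).Space)
  obtain ⟨m, rfl⟩ := tensorMk_surjective t
  exact ker_ne_top ⟨m, ht⟩

end TensorQuotient

/-! ## The lowest weight modules over the Heisenberg algebra -/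

section HeisLow

variable (ζ : ℂ)

section HeisExt

variable {ζ} (hζ : ζ ≠ 0) {V : Type*} [AddCommGroup V] [Module ℂ V] [LieRingModule heis V]
  [LieModule ℂ heis V] (hV : ∀ v : V, ⁅(⟨gen .z, z_mem_heis⟩ : heis), v⁆ = ζ • v)

lemma heisExt_p (v : V) : ⁅gen .p, (heisExt ζ hζ V hV).equiv v⁆ =
    (heisExt ζ hζ V hV).equiv ⁅(⟨gen .p, p_mem_heis⟩ : heis), v⁆ := schrRep_gen _ _

lemma heisExt_q (v : V) : ⁅gen .q, (heisExt ζ hζ V hV).equiv v⁆ =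
    (heisExt ζ hζ V hV).equiv ⁅(⟨gen .q, q_mem_heis⟩ : heis), v⁆ := schrRep_gen _ _

lemma heisExt_z (v : (heisExt ζ hζ V hV).Space) : ⁅gen .z, v⁆ = ζ • v :=
  (schrRep_gen _ _).trans (hV v)

lemma heisExt_h (v : (heisExt ζ hζ V hV).Space) : ⁅gen .h, v⁆ =
    (-(1 / ζ)) • ⁅gen .p, ⁅gen .q, v⁆⁆ + (1 / 2 : ℂ) • v := by
  refine (schrRep_gen _ _).trans (Eq.symm ?_)
  refine congrArg (fun u => (-(1 / ζ)) • u + (1 / 2 : ℂ) • v) ?_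
  exact (schrRep_gen _ _).trans (congrArg _ (schrRep_gen _ _))

lemma heisExt_e (v : (heisExt ζ hζ V hV).Space) : ⁅gen .e, v⁆ =
    (1 / (2 * ζ)) • ⁅gen .p, ⁅gen .p, v⁆⁆ := by
  refine (schrRep_gen _ _).trans (Eq.symm ?_)
  refine congrArg (fun u => (1 / (2 * ζ)) • u) ?_
  exact (schrRep_gen _ _).trans (congrArg _ (schrRep_gen _ _))

end HeisExt

lemma heisLowChar_act (y : heisLow) (v : ℂ) :
    (heisLowChar ζ).act y v = (∑ g, (y : Schr) g * charVal 0 ζ g) * v :=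
  repOfOps_charOps_act y v

lemma gen_mem_heisLow : ∀ g ∈ ({.q, .z} : Finset Gen), gen g ∈ heisLow :=
  fun _ hg => gen_mem_coordSub hg

lemma heisLow_coord : ∀ x ∈ heisLow, ∀ k ∉ ({.q, .z} : Finset Gen), x k = 0 :=
  fun _ hx => hx

/-- The generator of the lowest weight module over the Heisenberg algebra. -/
def heisVac : vermaHeisLow ζ := charOf heisLow_le (heisLowChar ζ)

/-- The operators `p = x`, `q = -ζ d/dx`, `z = ζ` on `ℂ[x]`. -/
def polyOps : Gen → Module.End ℂ (Polynomial ℂ)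
  | .p => weylT
  | .q => (-ζ) • weylD
  | .z => ζ • 1
  | _ => 0

/-- The module `ℂ[x]` over the Heisenberg algebra. -/
def polyRep : Rep heis (Polynomial ℂ) :=
  repOfOps heis.incl {.p, .q, .z} (fun x k hk => x.2 k hk) (polyOps ζ) (by
    intro g hg g' hg'
    refine Eq.trans ?_ (sum_lie_gen _ g g').symm
    cases g <;> cases g' <;> simp at hg hg' <;>
      simp only [polyOps, smul_mul_assoc, mul_smul_comm, weyl_comm, mul_one, one_mul] <;> module)

/-- In ℂ[x] with p = x and q = -ζ d/dx the constant 1 satisfies the defining relations of the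
generator, so the generator maps to 1. -/
lemma heisVac_ne_zero : heisVac ζ ≠ 0 := by
  let m := (polyRep ζ).equiv 1
  have hm : ∀ g (hg : g ∈ ({.q, .z} : Finset Gen)),
      ⁅(⟨gen g, heisLow_le (gen_mem_heisLow g hg)⟩ : heis), m⁆ = charVal 0 ζ g • m := by
    intro g hg
    have h1 : (polyRep ζ).act ⟨gen g, heisLow_le (gen_mem_heisLow g hg)⟩ = polyOps ζ g :=
      repOfOps_act_gen _
    rw [Rep.lie_equiv, h1, ← map_smul]
    congr 1
    cases g <;> simp at hg <;> simp [polyOps, charVal, weylD]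
  intro h
  have h1 := charLift_charOf heisLow_le gen_mem_heisLow (heisLowChar_act ζ) heisLow_coord m hm
  change charLift heisLow_le gen_mem_heisLow (heisLowChar_act ζ) heisLow_coord m hm
    (heisVac ζ) = m at h1
  rw [h, map_zero] at h1
  exact one_ne_zero ((polyRep ζ).equiv.injective (h1.symm.trans (map_zero _).symm))

variable {ζ} (hζ : ζ ≠ 0)

/-- The lowest weight module over the Heisenberg algebra, extended to the Schrödinger algebra. -/
abbrev HeisLowExt : Type := (heisExt ζ hζ (vermaHeisLow ζ) (vermaHeisLow_central ζ)).Space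

/-- The generator of the extended lowest weight module. -/
def heisExtVac : HeisLowExt hζ := (heisExt ζ hζ _ (vermaHeisLow_central ζ)).equiv (heisVac ζ)

lemma heisExtVac_ne_zero : heisExtVac hζ ≠ 0 := fun h =>
  heisVac_ne_zero ζ
    ((heisExt ζ hζ _ (vermaHeisLow_central ζ)).equiv.injective (h.trans (map_zero _).symm))

instance : Nontrivial (HeisLowExt hζ) := ⟨_, _, heisExtVac_ne_zero hζ⟩

lemma q_lie_heisExtVac : ⁅gen .q, heisExtVac hζ⁆ = 0 := by
  unfold heisExtVac
  rw [heisExt_q]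
  have : ⁅(⟨gen .q, q_mem_heis⟩ : heis), heisVac ζ⁆ = charVal 0 ζ .q • heisVac ζ :=
    gen_lie_charOf heisLow_le (heisLowChar_act ζ) (gen_mem_heisLow .q (by decide))
  have hχ : charVal 0 ζ .q = 0 := rfl
  rw [this, hχ, zero_smul, map_zero]

/-- The vectors `pᵏ w` of the lowest weight module. -/
def heisVec (k : ℕ) : HeisLowExt hζ :=
  ((LieModule.toEnd ℂ Schr (HeisLowExt hζ) (gen .p)) ^ k) (heisExtVac hζ)

lemma heisVec_zero : heisVec hζ 0 = heisExtVac hζ := rfl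

lemma heisVec_succ (k : ℕ) : heisVec hζ (k + 1) = ⁅gen .p, heisVec hζ k⁆ := by
  rw [heisVec, pow_succ', Module.End.mul_apply, LieModule.toEnd_apply_apply]; rfl

lemma q_lie_heisVec_succ (k : ℕ) :
    ⁅gen .q, heisVec hζ (k + 1)⁆ = (-(k + 1) * ζ : ℂ) • heisVec hζ k := by
  have key : ∀ v : HeisLowExt hζ, ⁅gen .q, ⁅gen .p, v⁆⁆ = ⁅gen .p, ⁅gen .q, v⁆⁆ - ζ • v := by
    intro v
    rw [gen_lie_lie .p .q, lie_relations.2.2.2.2.2.2.2.2.2.1, heisExt_z, add_sub_cancel_right]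
  induction k with
  | zero =>
    rw [heisVec_succ, key, heisVec_zero, q_lie_heisExtVac, lie_zero]
    simp
  | succ k ih =>
    rw [heisVec_succ, key, ih, lie_smul, ← heisVec_succ]
    push_cast
    module

/-- This is the diagonal operator used to separate components; for ζ ≠ 0 its eigenvalues are
distinct. -/
lemma pq_lie_heisVec (k : ℕ) :
    ⁅gen .p, ⁅gen .q, heisVec hζ k⁆⁆ = (-k * ζ : ℂ) • heisVec hζ k := by
  cases k with
  | zero => rw [heisVec_zero, q_lie_heisExtVac, lie_zero]; simp
  | succ k => rw [q_lie_heisVec_succ, lie_smul, ← heisVec_succ]; push_cast; rfl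

lemma span_heisVec : Submodule.span ℂ (Set.range (heisVec hζ)) = ⊤ := by
  set S := Submodule.span ℂ (Set.range (heisVec hζ)) with hS
  set E := (heisExt ζ hζ _ (vermaHeisLow_central ζ)).equiv with hE
  have hmem : ∀ k, heisVec hζ k ∈ S := fun k => Submodule.subset_span ⟨k, rfl⟩
  have hstab : ∀ g, (∀ k, ⁅gen g, heisVec hζ k⁆ ∈ S) → ∀ m ∈ S, ⁅gen g, m⁆ ∈ S := by
    intro g h m hm
    induction hm using Submodule.span_induction with
    | mem x hx => obtain ⟨k, rfl⟩ := hx; exact h k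
    | zero => rw [lie_zero]; exact Submodule.zero_mem _
    | add a b _ _ ha hb => rw [lie_add]; exact Submodule.add_mem _ ha hb
    | smul c a _ ha => rw [lie_smul]; exact Submodule.smul_mem _ _ ha
  let N : LieSubmodule ℂ heis (vermaHeisLow ζ) :=
    { S.comap E.toLinearMap with
      lie_mem := by
        intro y m hm
        refine lie_mem_of_gen heis_coord gen_mem_heis (S.comap E.toLinearMap) ?_ y hm
        intro g hg m hm
        change E m ∈ S at hm
        cases g <;> simp at hg
        · change E ⁅(⟨gen .p, p_mem_heis⟩ : heis), m⁆ ∈ S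
          rw [hE, ← heisExt_p]
          exact hstab .p (fun k => by rw [← heisVec_succ]; exact hmem _) _ hm
        · change E ⁅(⟨gen .q, q_mem_heis⟩ : heis), m⁆ ∈ S
          rw [hE, ← heisExt_q]
          refine hstab .q (fun k => ?_) _ hm
          cases k with
          | zero => rw [heisVec_zero, q_lie_heisExtVac]; exact S.zero_mem
          | succ k => rw [q_lie_heisVec_succ]; exact S.smul_mem _ (hmem _)
        · change E ⁅(⟨gen .z, z_mem_heis⟩ : heis), m⁆ ∈ S
          rw [vermaHeisLow_central, map_smul]
          exact S.smul_mem _ hm }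
  have hN : N = ⊤ := eq_top_of_charOf_mem heisLow_le (N := N) (hmem 0)
  rw [eq_top_iff]
  intro m _
  obtain ⟨m, rfl⟩ := E.surjective m
  have : m ∈ N := by rw [hN]; trivial
  exact this

include hζ in
lemma heisVec_eigenvalue_injective : Function.Injective fun k : ℕ => (-k * ζ : ℂ) := by
  intro a b hab
  have := mul_right_cancel₀ hζ hab
  exact_mod_cast neg_injective this

/-- From pᵏw the operator q descends to w, with nonzero factors -(k + 1)ζ, and p climbs back to
every power. -/
lemma heisLowExt_heisSimple : HeisSimple (HeisLowExt hζ) := by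
  refine heisSimple_of_chain (span_heisVec hζ) (heisVec_eigenvalue_injective hζ)
    (pq_lie_heisVec hζ) fun S hS i j hi => ?_
  have hdown : ∀ k, heisVec hζ k ∈ S → heisVec hζ 0 ∈ S := by
    intro k
    induction k with
    | zero => exact id
    | succ k ih =>
      intro h
      apply ih
      have h1 := hS .q (by decide) _ h
      rw [q_lie_heisVec_succ] at h1
      have hc : (-(k + 1) * ζ : ℂ) ≠ 0 :=
        mul_ne_zero (neg_ne_zero.2 (Nat.cast_add_one_ne_zero k)) hζ
      have h2 := S.smul_mem (-(k + 1) * ζ : ℂ)⁻¹ h1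
      rwa [smul_smul, inv_mul_cancel₀ hc, one_smul] at h2
  have hup : ∀ k, heisVec hζ k ∈ S := by
    intro k
    induction k with
    | zero => exact hdown i hi
    | succ k ih => rw [heisVec_succ]; exact hS .p (by decide) _ ih
  exact hup j

theorem heisLow_tensor_hasUniqueSimpleQuotientIso (μ : ℂ) :
    HasUniqueSimpleQuotientIso Schr (HeisLowExt hζ ⊗[ℂ] (sl2Ext (vermaSl2 μ)).Space)
      (HeisLowExt hζ ⊗[ℂ] (sl2Ext (simpleSl2 μ)).Space) :=
  tensor_hasUniqueSimpleQuotientIso (span_heisVec hζ) (heisVec_eigenvalue_injective hζ)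
    (pq_lie_heisVec hζ) (heisLowExt_heisSimple hζ) (sl2_sumProper_ne_top μ)

end HeisLow

/-! ## Twists by characters of the ageing algebra -/

section Twist

variable (X : Type*) [AddCommGroup X] [Module ℂ X] [LieRingModule Schr X] [LieModule ℂ Schr X]

/-- The h-coordinate of a bracket involves f, which is absent here. So h ↦ μ defines a character of
the ageing algebra. -/
lemma ageing_lie_h (x y : ageing) : (⁅x, y⁆ : ageing).1 .h = 0 := by
  have h1 := ageing_coord x x.2 .f (by decide)
  have h2 := ageing_coord y y.2 .f (by decide)
  change bracket x.1 y.1 .h = 0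
  simp [bracket, h1, h2]

/-- The restriction of a Schrödinger module to the ageing algebra, twisted by the character
`h ↦ μ`. -/
def twistRep (μ : ℂ) : Rep ageing X where
  act :=
    { toFun := fun y => LieModule.toEnd ℂ Schr X y + (y.1 .h * μ) • 1
      map_add' := by
        intro a b
        have : (a + b : ageing).1 .h = a.1 .h + b.1 .h := rfl
        have h2 : ((a + b : ageing) : Schr) = a + b := rfl
        rw [this, h2, map_add]
        module
      map_smul' := by
        intro c a
        have : (c • a : ageing).1 .h = c * a.1 .h := rfl
        have h2 : ((c • a : ageing) : Schr) = c • (a : Schr) := rfl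
        rw [this, h2, map_smul, RingHom.id_apply]
        module }
  map_lie x y := by
    ext v
    change ⁅(⁅x, y⁆ : ageing).1, v⁆ + ((⁅x, y⁆ : ageing).1 .h * μ) • v =
      (⁅x.1, ⁅y.1, v⁆ + (y.1 .h * μ) • v⁆ + (x.1 .h * μ) • (⁅y.1, v⁆ + (y.1 .h * μ) • v)) -
      (⁅y.1, ⁅x.1, v⁆ + (x.1 .h * μ) • v⁆ + (y.1 .h * μ) • (⁅x.1, v⁆ + (x.1 .h * μ) • v))
    rw [ageing_lie_h, LieSubalgebra.coe_bracket, lie_lie, lie_add, lie_add, lie_smul, lie_smul]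
    module

lemma twistRep_gen (μ : ℂ) {g : Gen} (hg : gen g ∈ ageing) (x : X) :
    ⁅(⟨gen g, hg⟩ : ageing), (twistRep X μ).equiv x⁆ =
      (twistRep X μ).equiv ⁅gen g, x⁆ + charVal μ 0 g • (twistRep X μ).equiv x := by
  rw [Rep.lie_equiv]
  change (twistRep X μ).equiv (⁅gen g, x⁆ + (gen g .h * μ) • x) = _
  rw [map_add, map_smul]
  cases g <;> simp [gen_coord, charVal]

lemma isTwist_equiv (μ : ℂ) {V : Type*} [AddCommGroup V] [Module ℂ V] [LieRingModule ageing V]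
    [LieModule ℂ ageing V] (φ : (twistRep X μ).Space ≃ₗ⁅ℂ,ageing⁆ V) :
    IsTwist μ ((twistRep X μ).equiv.trans φ.toLinearEquiv) := by
  intro g hg x
  have h1 := φ.toLieModuleHom.map_lie ⟨gen g, hg⟩ ((twistRep X μ).equiv x)
  rw [twistRep_gen, map_add, map_smul] at h1
  exact h1.symm

end Twist

/-! ## Simple lowest weight modules over the ageing algebra -/

section AgeingLow

variable {ζ : ℂ} (hζ : ζ ≠ 0) (η : ℂ)

lemma ageingLowChar_act (y : ageingLow) (v : ℂ) :
    (ageingLowChar ζ η).act y v = (∑ g, (y : Schr) g * charVal η ζ g) * v :=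
  repOfOps_charOps_act y v

lemma gen_mem_ageingLow : ∀ g ∈ ({.h, .q, .z} : Finset Gen), gen g ∈ ageingLow :=
  fun _ hg => gen_mem_coordSub hg

lemma ageingLow_coord : ∀ x ∈ ageingLow, ∀ k ∉ ({.h, .q, .z} : Finset Gen), x k = 0 :=
  fun _ hx => hx

/-- The character vanishes on p, q and z, so submodules of the twist are Heisenberg-stable subspaces
of X. -/
lemma twist_isIrreducible {X : Type*} [AddCommGroup X] [Module ℂ X] [LieRingModule Schr X]
    [LieModule ℂ Schr X] [Nontrivial X] (hX : HeisSimple X) (μ : ℂ) :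
    LieModule.IsIrreducible ℂ ageing (twistRep X μ).Space := by
  have : Nontrivial (twistRep X μ).Space := (twistRep X μ).equiv.symm.toEquiv.nontrivial
  refine LieModule.IsIrreducible.mk fun N hN => ?_
  have hS : HeisStable (N.toSubmodule.comap (twistRep X μ).equiv.toLinearMap) := by
    intro g hg x hx
    have hg' : gen g ∈ ageing := gen_mem_coordSub (by cases g <;> simp at hg ⊢)
    have h1 := N.lie_mem (x := ⟨gen g, hg'⟩) hx
    have hχ : charVal μ 0 g = 0 := by cases g <;> simp at hg <;> rfl
    have h2 := twistRep_gen X μ hg' x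
    rw [hχ, zero_smul, add_zero] at h2
    change (twistRep X μ).equiv ⁅gen g, x⁆ ∈ N
    rw [← h2]
    exact h1
  rcases hX _ hS with h | h
  · exfalso
    apply hN
    rw [LieSubmodule.eq_bot_iff]
    intro m hm
    obtain ⟨x, rfl⟩ := (twistRep X μ).equiv.surjective m
    have hx : x ∈ N.toSubmodule.comap (twistRep X μ).equiv.toLinearMap := hm
    rw [h, Submodule.mem_bot] at hx
    rw [hx, map_zero]
  · rw [eq_top_iff]
    intro m _
    obtain ⟨x, rfl⟩ := (twistRep X μ).equiv.surjective m
    have hx : x ∈ N.toSubmodule.comap (twistRep X μ).equiv.toLinearMap := by rw [h]; trivial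
    exact hx

/-- The image of the sum of proper submodules in the simple module is zero or everything. In the
latter case the sum, which contains the kernel, would be all of M. -/
lemma sumProper_eq_ker {L : Type*} [LieRing L] [LieAlgebra ℂ L] {M : Type*} [AddCommGroup M]
    [Module ℂ M] [LieRingModule L M] [LieModule ℂ L M] {X : Type*} [AddCommGroup X] [Module ℂ X]
    [LieRingModule L X] [LieModule ℂ L X] [hX : LieModule.IsIrreducible ℂ L X] {φ : M →ₗ⁅ℂ,L⁆ X}
    (hφ : ∃ m, φ m ≠ 0) (hM : sumProper L M ≠ ⊤) : sumProper L M = φ.ker := by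
  have hle : φ.ker ≤ sumProper L M := le_sumProper (ker_ne_top hφ)
  refine le_antisymm ?_ hle
  rcases hX.eq_bot_or_eq_top ((sumProper L M).map φ) with h | h
  · intro m hm
    have : φ m ∈ (sumProper L M).map φ := (LieSubmodule.mem_map _).2 ⟨m, hm, rfl⟩
    rwa [h, LieSubmodule.mem_bot] at this
  · exfalso
    apply hM
    rw [eq_top_iff]
    intro m _
    have : φ m ∈ (sumProper L M).map φ := by rw [h]; trivial
    obtain ⟨n, hn, hmn⟩ := (LieSubmodule.mem_map _).1 this
    have hker : m - n ∈ φ.ker := by rw [LieModuleHom.mem_ker, map_sub, hmn, sub_self]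
    have := (sumProper L M).add_mem (hle hker) hn
    rwa [sub_add_cancel] at this

/-- On the lowest vector qw = 0, so h = -pq/ζ + 1/2 acts there as 1/2, and the twist by η - 1/2
gives it weight η. The resulting map from the Verma module has simple target. -/
lemma nonempty_simpleAgeingLow_equiv (h : Nontrivial (simpleAgeingLow ζ η)) :
    Nonempty (simpleAgeingLow ζ η ≃ₗ⁅ℂ,ageing⁆
      (twistRep (HeisLowExt hζ) (η - 1 / 2)).Space) := by
  set E := (twistRep (HeisLowExt hζ) (η - 1 / 2)).equiv with hE
  have hirr := twist_isIrreducible (heisLowExt_heisSimple hζ) (η - 1 / 2)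
  have hm : ∀ g (hg : g ∈ ({.h, .q, .z} : Finset Gen)),
      ⁅(⟨gen g, ageingLow_le (gen_mem_ageingLow g hg)⟩ : ageing), E (heisExtVac hζ)⁆ =
        charVal η ζ g • E (heisExtVac hζ) := by
    intro g hg
    rw [hE, twistRep_gen, ← map_smul, ← map_smul, ← map_add]
    congr 1
    cases g <;> simp at hg
    · rw [heisExt_h, q_lie_heisExtVac, lie_zero]
      simp only [charVal]
      module
    · rw [q_lie_heisExtVac]
      simp [charVal]
    · rw [heisExt_z]
      simp [charVal]
  let φ : vermaAgeingLow ζ η →ₗ⁅ℂ,ageing⁆ (twistRep (HeisLowExt hζ) (η - 1 / 2)).Space :=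
    charLift ageingLow_le gen_mem_ageingLow (ageingLowChar_act η) ageingLow_coord _ hm
  have hφ : ∃ m, φ m ≠ 0 := by
    refine ⟨charOf ageingLow_le (ageingLowChar ζ η), ?_⟩
    have h1 : φ (charOf ageingLow_le (ageingLowChar ζ η)) = _ :=
      charLift_charOf ageingLow_le gen_mem_ageingLow (ageingLowChar_act η) ageingLow_coord _ hm
    rw [h1]
    exact fun h0 => heisExtVac_ne_zero hζ (E.injective (h0.trans (map_zero _).symm))
  -- If the proper submodules summed to everything, the quotient would be zero.
  have hne : sumProper ageing (vermaAgeingLow ζ η) ≠ ⊤ := by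
    intro htop
    obtain ⟨a, ha⟩ := exists_ne (0 : simpleAgeingLow ζ η)
    obtain ⟨a, rfl⟩ := LieSubmodule.Quotient.surjective_mk' _ a
    apply ha
    rw [LieSubmodule.Quotient.mk_eq_zero, htop]
    trivial
  unfold simpleAgeingLow SimpleTop
  rw [sumProper_eq_ker hφ hne]
  exact nonempty_quotient_ker_equiv φ (surjective_of_isIrreducible hφ)

theorem induced_equiv_of_lowestWeight {V : Type*} [AddCommGroup V] [Module ℂ V]
    [LieRingModule ageing V] [LieModule ℂ ageing V] [LieModule.IsIrreducible ℂ ageing V]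
    (φ : V ≃ₗ⁅ℂ,ageing⁆ simpleAgeingLow ζ η) :
    Nonempty (InducedSchr V ≃ₗ⁅ℂ,Schr⁆
      HeisLowExt hζ ⊗[ℂ] (sl2Ext (vermaSl2 (η - 1 / 2))).Space) := by
  have hV := LieModule.nontrivial_of_isIrreducible ℂ ageing V
  have hnt : Nontrivial (simpleAgeingLow ζ η) := φ.symm.toLinearEquiv.toEquiv.nontrivial
  obtain ⟨ψ⟩ := nonempty_simpleAgeingLow_equiv hζ η hnt
  exact induced_equiv_tensor (isTwist_equiv _ _ (ψ.symm.trans φ.symm))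

end AgeingLow

/-! ## The modules `G(ζ, lam)` and `Q'(ζ, η, lam)` -/

section LaurentHeis

variable {ζ : ℂ} (hζ : ζ ≠ 0) (lam η : ℂ)

/-- The module `G(ζ, lam)`, extended to the Schrödinger algebra. -/
abbrev GExt : Type := (heisExt ζ hζ (modG ζ lam).Space (modG_central ζ lam)).Space

/-- The basis vectors of `G(ζ, lam)`, with coefficients. -/
def gExtSingle (i : ℤ) (a : ℂ) : GExt hζ lam :=
  (heisExt ζ hζ _ (modG_central ζ lam)).equiv ((modG ζ lam).equiv (Finsupp.single i a))

lemma p_lie_gExtSingle (i : ℤ) (a : ℂ) : ⁅gen .p, gExtSingle hζ lam i a⁆ =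
    (ζ * (lam + i) : ℂ) • gExtSingle hζ lam (i - 1) a := by
  have h1 : (modG ζ lam).act ⟨gen .p, p_mem_heis⟩ = gradedOps (qOps' ζ 0 lam) .p :=
    repOfOps_act_gen _
  unfold gExtSingle
  rw [heisExt_p, Rep.lie_equiv, h1, gradedOps_single, ← map_smul, ← map_smul,
    Finsupp.smul_single]
  rfl

lemma q_lie_gExtSingle (i : ℤ) (a : ℂ) : ⁅gen .q, gExtSingle hζ lam i a⁆ =
    gExtSingle hζ lam (i + 1) a := by
  have h1 : (modG ζ lam).act ⟨gen .q, q_mem_heis⟩ = gradedOps (qOps' ζ 0 lam) .q :=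
    repOfOps_act_gen _
  unfold gExtSingle
  rw [heisExt_q, Rep.lie_equiv, h1, gradedOps_single]
  rfl

lemma pq_lie_gExtSingle (i : ℤ) (a : ℂ) : ⁅gen .p, ⁅gen .q, gExtSingle hζ lam i a⁆⁆ =
    (ζ * (lam + i + 1) : ℂ) • gExtSingle hζ lam i a := by
  rw [q_lie_gExtSingle, p_lie_gExtSingle, add_sub_cancel_right]
  push_cast
  rw [add_assoc]

lemma smul_gExtSingle (c : ℂ) (i : ℤ) (a : ℂ) :
    c • gExtSingle hζ lam i a = gExtSingle hζ lam i (c * a) := by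
  unfold gExtSingle
  rw [← map_smul, ← map_smul, Finsupp.smul_single, smul_eq_mul]

lemma gExtSingle_eq (i : ℤ) (a : ℂ) : gExtSingle hζ lam i a = a • gExtSingle hζ lam i 1 := by
  rw [smul_gExtSingle, mul_one]

lemma gExt_induction {p : GExt hζ lam → Prop} (h0 : p 0) (hadd : ∀ a b, p a → p b → p (a + b))
    (hs : ∀ i a, p (gExtSingle hζ lam i a)) (x : GExt hζ lam) : p x := by
  obtain ⟨x, rfl⟩ := (heisExt ζ hζ _ (modG_central ζ lam)).equiv.surjective x
  obtain ⟨x, rfl⟩ := (modG ζ lam).equiv.surjective x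
  induction x using Finsupp.induction_linear with
  | zero => rw [map_zero, map_zero]; exact h0
  | add a b ha hb => rw [map_add, map_add]; exact hadd _ _ ha hb
  | single i a => exact hs i a

lemma span_gExtSingle :
    Submodule.span ℂ (Set.range fun i => gExtSingle hζ lam i 1) = ⊤ := by
  rw [eq_top_iff]
  intro x _
  refine gExt_induction hζ lam (Submodule.zero_mem _) (fun _ _ => Submodule.add_mem _)
    (fun i a => ?_) x
  rw [gExtSingle_eq]
  exact Submodule.smul_mem _ _ (Submodule.subset_span ⟨i, rfl⟩)

instance : Nontrivial (GExt hζ lam) :=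
  ((modG ζ lam).equiv.trans
    (heisExt ζ hζ _ (modG_central ζ lam)).equiv).symm.toEquiv.nontrivial

include hζ in
lemma gExt_eigenvalue_injective : Function.Injective fun i : ℤ => (ζ * (lam + i + 1) : ℂ) := by
  intro a b hab
  have := mul_left_cancel₀ hζ hab
  have h2 : (a : ℂ) = b := by linear_combination this
  exact_mod_cast h2

variable {lam} (hlam : ∀ n : ℤ, lam ≠ n)

-- q raises the exponent with coefficient 1, and p lowers it with coefficient ζ(lam + k), nonzero
-- because `lam` is not an integer.
include hlam in
lemma gExt_heisSimple : HeisSimple (GExt hζ lam) := by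
  refine heisSimple_of_chain (span_gExtSingle hζ lam) (gExt_eigenvalue_injective hζ lam)
    (fun i => pq_lie_gExtSingle hζ lam i 1) fun S hS i j hi => ?_
  induction j using Int.inductionOn' (b := i) with
  | zero => exact hi
  | succ k _ ih => rw [← q_lie_gExtSingle]; exact hS .q (by decide) _ ih
  | pred k _ ih =>
    have h1 := hS .p (by decide) _ ih
    rw [p_lie_gExtSingle] at h1
    have hc : (ζ * (lam + k) : ℂ) ≠ 0 := by
      refine mul_ne_zero hζ fun h => hlam (-k) ?_
      push_cast
      linear_combination h
    have h2 := S.smul_mem (ζ * (lam + k) : ℂ)⁻¹ h1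
    rwa [smul_smul, inv_mul_cancel₀ hc, one_smul] at h2

include hlam in
theorem gExt_tensor_hasUniqueSimpleQuotientIso (μ : ℂ) :
    HasUniqueSimpleQuotientIso Schr (GExt hζ lam ⊗[ℂ] (sl2Ext (vermaSl2 μ)).Space)
      (GExt hζ lam ⊗[ℂ] (sl2Ext (simpleSl2 μ)).Space) :=
  tensor_hasUniqueSimpleQuotientIso (span_gExtSingle hζ lam) (gExt_eigenvalue_injective hζ lam)
    (fun i => pq_lie_gExtSingle hζ lam i 1) (gExt_heisSimple hζ hlam) (sl2_sumProper_ne_top μ)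

variable (lam) in
/-- The identification of `G(ζ, lam)` with `Q'(ζ, η, lam)`. -/
def gExtEquiv : GExt hζ lam ≃ₗ[ℂ] (modQ' ζ η lam).Space :=
  (heisExt ζ hζ _ (modG_central ζ lam)).equiv.symm.trans
    ((modG ζ lam).equiv.symm.trans (modQ' ζ η lam).equiv)

lemma gExtEquiv_single (i : ℤ) (a : ℂ) : gExtEquiv hζ lam η (gExtSingle hζ lam i a) =
    (modQ' ζ η lam).equiv (Finsupp.single i a) := rfl

/-- Both modules have the same e, p, q, z. On xⁱ the extension of G has h = -(lam + i + 1) + 1/2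
against η - i on Q', and the difference is lam + η + 1/2 for every i. -/
lemma isTwist_gExtEquiv : IsTwist (lam + η + 1 / 2) (gExtEquiv hζ lam η) := by
  intro g hg x
  induction x using gExt_induction with
  | h0 => rw [map_zero, lie_zero, lie_zero, map_zero, smul_zero, add_zero]
  | hadd a b ha hb => rw [map_add, lie_add, lie_add, ha, hb, map_add, smul_add]; abel
  | hs i a =>
    have h1 : (modQ' ζ η lam).act ⟨gen g, hg⟩ = gradedOps (qOps' ζ η lam) g := repOfOps_act_gen hg
    have h2 : ∀ j b c, gExtEquiv hζ lam η (gExtSingle hζ lam j b) +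
        c • gExtEquiv hζ lam η (gExtSingle hζ lam j a) =
          (modQ' ζ η lam).equiv (Finsupp.single j (b + c * a)) := by
      intro j b c
      rw [gExtEquiv_single, gExtEquiv_single, ← map_smul, ← map_add, Finsupp.smul_single,
        ← Finsupp.single_add, smul_eq_mul]
    have h3 := mem_of_gen_mem_coordSub hg
    have hχ : g ≠ .h → charVal (lam + η + 1 / 2) 0 g = 0 := by cases g <;> simp [charVal]
    cases g <;> simp at h3
    · rw [heisExt_e, p_lie_gExtSingle, lie_smul, p_lie_gExtSingle, smul_gExtSingle,
        smul_gExtSingle, smul_gExtSingle, gExtEquiv_single, gExtEquiv_single, Rep.lie_equiv, h1,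
        gradedOps_single, hχ (by decide), zero_smul, add_zero]
      have : i + deg .e = i - 1 - 1 := by simp [deg]; ring
      rw [this]
      congr 2
      simp [qOps']
      field_simp
      ring
    · rw [heisExt_h, pq_lie_gExtSingle, smul_gExtSingle, smul_gExtSingle, smul_gExtSingle, map_add,
        add_assoc, h2, gExtEquiv_single, gExtEquiv_single, ← map_add, ← Finsupp.single_add,
        Rep.lie_equiv, h1, gradedOps_single]
      have : i + deg .h = i := by simp [deg]
      rw [this]
      congr 2
      simp [qOps', charVal]
      field_simp
      ring
    · rw [p_lie_gExtSingle, smul_gExtSingle, gExtEquiv_single, gExtEquiv_single, Rep.lie_equiv, h1,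
        gradedOps_single, hχ (by decide), zero_smul, add_zero]
      rfl
    · rw [q_lie_gExtSingle, gExtEquiv_single, gExtEquiv_single, Rep.lie_equiv, h1,
        gradedOps_single, hχ (by decide), zero_smul, add_zero]
      rfl
    · rw [heisExt_z, smul_gExtSingle, gExtEquiv_single, gExtEquiv_single, Rep.lie_equiv, h1,
        gradedOps_single, hχ (by decide), zero_smul, add_zero]
      have : i + deg .z = i := by simp [deg]
      rw [this]
      rfl

theorem induced_equiv_of_equiv_modQ' {V : Type*} [AddCommGroup V] [Module ℂ V]
    [LieRingModule ageing V] [LieModule ℂ ageing V]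
    (φ : V ≃ₗ⁅ℂ,ageing⁆ (modQ' ζ η lam).Space) :
    Nonempty (InducedSchr V ≃ₗ⁅ℂ,Schr⁆
      GExt hζ lam ⊗[ℂ] (sl2Ext (vermaSl2 (lam + η + 1 / 2))).Space) := by
  refine induced_equiv_tensor (θ := (gExtEquiv hζ lam η).trans φ.symm.toLinearEquiv) ?_
  intro g hg x
  have h1 := φ.symm.toLieModuleHom.map_lie ⟨gen g, hg⟩ (gExtEquiv hζ lam η x)
  rw [isTwist_gExtEquiv, map_add, map_smul] at h1
  exact h1.symm

end LaurentHeis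

/-! ## Endomorphisms of simple modules -/

section Schur

variable {M : Type*} [AddCommGroup M] [Module ℂ M]

/-- Over ℂ a nonzero polynomial splits into linear factors, each acting injectively. -/
lemma aeval_injective_of_sub_injective {T : Module.End ℂ M}
    (h : ∀ a : ℂ, Function.Injective (T - algebraMap ℂ (Module.End ℂ M) a)) {P : Polynomial ℂ}
    (hP : P ≠ 0) : Function.Injective (Polynomial.aeval T P) := by
  induction hn : P.natDegree generalizing P with
  | zero =>
    rw [Polynomial.eq_C_of_natDegree_eq_zero hn] at hP ⊢
    rw [Polynomial.aeval_C, Algebra.algebraMap_eq_smul_one]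
    exact smul_right_injective M (fun h0 => hP (by rw [h0, Polynomial.C_0]))
  | succ n ih =>
    obtain ⟨a, ha⟩ := IsAlgClosed.exists_root P
      (fun h0 => by rw [Polynomial.natDegree_eq_of_degree_eq_some h0] at hn; simp at hn)
    obtain ⟨Q, rfl⟩ := Polynomial.dvd_iff_isRoot.2 ha
    have hQ : Q ≠ 0 := right_ne_zero_of_mul hP
    rw [Polynomial.natDegree_mul (left_ne_zero_of_mul hP) hQ, Polynomial.natDegree_X_sub_C] at hn
    have hinj := ih hQ (by omega)
    rw [map_mul, Module.End.mul_eq_comp, LinearMap.coe_comp, map_sub, Polynomial.aeval_X,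
      Polynomial.aeval_C]
    exact (h a).comp hinj

/-- The `u a` play the role of m/(T - a). Clearing denominators turns a linear relation into a
polynomial in T killing m, as in the linear independence of the functions 1/(X - a). -/
lemma linearIndependent_of_sub_apply_eq {T : Module.End ℂ M}
    (h : ∀ a : ℂ, Function.Injective (T - algebraMap ℂ (Module.End ℂ M) a)) {m : M} (hm : m ≠ 0)
    {u : ℂ → M} (hu : ∀ a, (T - algebraMap ℂ (Module.End ℂ M) a) (u a) = m) :
    LinearIndependent ℂ u := by
  classical
  rw [linearIndependent_iff']
  intro s g hg i hi
  -- `P` is the numerator of ∑ g(a)/(X - a) over the common denominator ∏ (X - b).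
  let F : ℂ → Polynomial ℂ := fun a => ∏ b ∈ s.erase a, (Polynomial.X - Polynomial.C b)
  let P : Polynomial ℂ := ∑ a ∈ s, Polynomial.C (g a) * F a
  have hF : ∀ a ∈ s, Polynomial.aeval T (∏ b ∈ s, (Polynomial.X - Polynomial.C b)) (u a) =
      Polynomial.aeval T (F a) m := by
    intro a ha
    rw [← Finset.prod_erase_mul s _ ha, map_mul, Module.End.mul_apply, map_sub, Polynomial.aeval_X,
      Polynomial.aeval_C, hu]
  have hPm : Polynomial.aeval T P m = 0 := by
    have h1 := congrArg (Polynomial.aeval T (∏ b ∈ s, (Polynomial.X - Polynomial.C b))) hg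
    rw [map_zero, map_sum] at h1
    rw [← h1, map_sum, LinearMap.sum_apply]
    refine Finset.sum_congr rfl fun a ha => ?_
    rw [map_smul, hF a ha, map_mul, Polynomial.aeval_C, Module.End.mul_apply,
      Module.algebraMap_end_apply]
  have hP : P = 0 := by
    by_contra hne
    exact hm (aeval_injective_of_sub_injective h hne (hPm.trans (map_zero _).symm))
  -- At the node `i` only the i-th summand survives, with a nonzero factor, so g(i) = 0.
  have hev := congrArg (Polynomial.eval i) hP
  rw [Polynomial.eval_finsetSum, Finset.sum_eq_single i] at hev
  · simp only [F, Polynomial.eval_mul, Polynomial.eval_C, Polynomial.eval_prod, Polynomial.eval_sub,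
      Polynomial.eval_X, Polynomial.eval_zero] at hev
    refine (mul_eq_zero.1 hev).resolve_right (Finset.prod_ne_zero_iff.2 fun b hb => ?_)
    exact sub_ne_zero.2 (Finset.ne_of_mem_erase hb).symm
  · intro a ha hai
    simp only [F, Polynomial.eval_mul, Polynomial.eval_prod]
    rw [Finset.prod_eq_zero (Finset.mem_erase.2 ⟨hai.symm, hi⟩), mul_zero]
    simp
  · exact fun h => absurd hi h

/-- Otherwise the vectors (T - a)⁻¹m, a ∈ ℂ, would be linearly independent: continuum many in a
space of countable dimension. -/
lemma exists_not_bijective_sub [Nontrivial M] (hM : Module.rank ℂ M ≤ Cardinal.aleph0)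
    (T : Module.End ℂ M) :
    ∃ a : ℂ, ¬ Function.Bijective (T - algebraMap ℂ (Module.End ℂ M) a) := by
  by_contra! h
  obtain ⟨m, hm⟩ := exists_ne (0 : M)
  choose u hu using fun a => (h a).2 m
  have h1 := (linearIndependent_of_sub_apply_eq (fun a => (h a).1) hm hu).cardinal_lift_le_rank
  rw [Cardinal.mk_complex, Cardinal.lift_continuum] at h1
  have h2 := h1.trans (Cardinal.lift_le.2 hM)
  rw [Cardinal.lift_aleph0] at h2
  exact h2.not_gt Cardinal.aleph0_lt_continuum

variable [LieRingModule Schr M] [LieModule ℂ Schr M]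

/-- Words in the six basis vectors, applied to one nonzero vector, span the module, and there are
countably many words. -/
lemma rank_le_aleph0_of_isIrreducible [hM : LieModule.IsIrreducible ℂ Schr M] :
    Module.rank ℂ M ≤ Cardinal.aleph0 := by
  have := LieModule.nontrivial_of_isIrreducible ℂ Schr M
  obtain ⟨m, hm⟩ := exists_ne (0 : M)
  let w : List Gen → M := fun l => l.foldr (fun g x => ⁅gen g, x⁆) m
  have hmem : ∀ l, w l ∈ Submodule.span ℂ (Set.range w) := fun l => Submodule.subset_span ⟨l, rfl⟩
  have hstab : ∀ g, ∀ x ∈ Submodule.span ℂ (Set.range w),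
      ⁅gen g, x⁆ ∈ Submodule.span ℂ (Set.range w) := by
    intro g x hx
    induction hx using Submodule.span_induction with
    | mem x hx => obtain ⟨l, rfl⟩ := hx; exact hmem (g :: l)
    | zero => rw [lie_zero]; exact Submodule.zero_mem _
    | add a b _ _ ha hb => rw [lie_add]; exact Submodule.add_mem _ ha hb
    | smul c a _ ha => rw [lie_smul]; exact Submodule.smul_mem _ _ ha
  have htop : Submodule.span ℂ (Set.range w) = ⊤ := by
    rcases hM.eq_bot_or_eq_top (schrSub _ hstab) with h | h
    · exfalso
      have h1 : m ∈ schrSub _ hstab := hmem []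
      rw [h, LieSubmodule.mem_bot] at h1
      exact hm h1
    · exact congrArg LieSubmodule.toSubmodule h
  rw [← rank_top, ← htop]
  refine (rank_span_le _).trans ?_
  have := (Set.countable_range w).to_subtype
  exact Cardinal.mk_le_aleph0

/-- Schur's lemma in Dixmier's form: some T - a is not bijective, and an endomorphism of a simple
module that is not bijective is zero. -/
lemma exists_eq_smul_of_commute [hM : LieModule.IsIrreducible ℂ Schr M] (T : Module.End ℂ M)
    (hT : ∀ g m, T ⁅gen g, m⁆ = ⁅gen g, T m⁆) : ∃ c : ℂ, ∀ m, T m = c • m := by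
  have := LieModule.nontrivial_of_isIrreducible ℂ Schr M
  obtain ⟨a, ha⟩ := exists_not_bijective_sub rank_le_aleph0_of_isIrreducible T
  refine ⟨a, fun m => ?_⟩
  let φ : M →ₗ⁅ℂ,Schr⁆ M := schrHom (T - algebraMap ℂ (Module.End ℂ M) a) (by
    intro g m
    rw [LinearMap.sub_apply, LinearMap.sub_apply, Module.algebraMap_end_apply,
      Module.algebraMap_end_apply, hT, lie_sub, lie_smul])
  have hφ : ∀ m, φ m = T m - a • m := fun _ => rfl
  by_contra hne
  have h0 : ∃ m, φ m ≠ 0 := ⟨m, by rw [hφ]; exact sub_ne_zero.2 hne⟩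
  exact ha ⟨injective_of_isIrreducible h0, surjective_of_isIrreducible h0⟩

end Schur

/-! ## The cubic Casimir element -/

section Casimir

variable {A : Type*} [Ring A] [Algebra ℂ A]

/-- The cubic Casimir element `f p² - e q² - h p q - 2z (f e) - (z / 2) (h² + h)`, with `z = ζ`. -/
def casimir (ζ : ℂ) (B : Gen → A) : A :=
  B .f * (B .p * B .p) - B .e * (B .q * B .q) - B .h * (B .p * B .q) - (2 * ζ) • (B .f * B .e)
    - (ζ / 2) • (B .h * B .h + B .h)

/-- The commutators with f are oriented to bring all products into the order f, e, h, p, q, and z is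
a scalar; the two sides then agree term by term. -/
lemma casimir_comm {ζ : ℂ} {B : Gen → A} (hz : B .z = ζ • 1)
    (hB : ∀ g g', B g * B g' - B g' * B g = ∑ k, (⁅gen g, gen g'⁆ : Schr) k • B k) (g : Gen) :
    casimir ζ B * B g = B g * casimir ζ B := by
  have key : ∀ g g', B g * B g' = B g' * B g + ∑ k, (⁅gen g, gen g'⁆ : Schr) k • B k :=
    fun g g' => by rw [← hB g g']; abel
  simp only [sum_lie_gen] at key
  have h1 := key .e .f
  have h2 := key .h .f
  have h3 := key .h .e
  have h4 := key .p .f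
  have h5 := key .p .e
  have h6 := key .p .h
  have h7 := key .q .f
  have h8 := key .q .e
  have h9 := key .q .h
  have h10 := key .q .p
  clear key hB
  dsimp only at h1 h2 h3 h4 h5 h6 h7 h8 h9 h10
  rw [hz] at h10
  have assoc : ∀ {x y w : A}, x * y = w → ∀ X, x * (y * X) = w * X := fun h X => by
    rw [← mul_assoc, h]
  have k1 := assoc h1
  have k2 := assoc h2
  have k3 := assoc h3
  have k4 := assoc h4
  have k5 := assoc h5
  have k6 := assoc h6
  have k7 := assoc h7
  have k8 := assoc h8
  have k9 := assoc h9
  have k10 := assoc h10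
  cases g <;>
    simp only [casimir, mul_add, add_mul, mul_sub, sub_mul, smul_mul_assoc, mul_smul_comm,
      mul_assoc, h1, h2, h3, h4, h5, h6, h7, h8, h9, h10, k1, k2, k3, k4, k5, k6, k7, k8, k9, k10,
      hz, mul_one, one_mul, mul_zero, add_zero, mul_neg, neg_mul, smul_add, smul_sub, smul_neg] <;>
    match_scalars <;> ring

lemma weyl_zero_mul_sq {a b d : A} (hba : b * a = 1) (hda : d * a = a * d + 1) (η c : ℂ) :
    (d + (η - 2) • b + c • (b * b)) * (a * a) = c • 1 + a * (a * d) + η • a := by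
  have hba' : ∀ X, b * (a * X) = X := fun X => by rw [← mul_assoc, hba, one_mul]
  have hda' : ∀ X, d * (a * X) = a * (d * X) + X := fun X => by
    rw [← mul_assoc, hda, add_mul, mul_assoc, one_mul]
  simp only [mul_add, add_mul, smul_mul_assoc, mul_assoc, hba, hda, hba', hda', mul_one]
  match_scalars <;> ring

/-- The Casimir equation for f when ζ ≠ 0, where p² - 2ze becomes -2ζt. -/
lemma weyl_nonzero_mul {a b d : A} (hba : b * a = 1) (hda : d * a = a * d + 1) {ζ : ℂ}
    (hζ : ζ ≠ 0) (η c : ℂ) :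
    (-((1 / (2 * ζ)) • (1 : A)) - (η - 1 / 2) • d - a * (d * d)
      - ((η - 1) * (η - 2) / 4 + c / (2 * ζ)) • b) * ((-2 * ζ) • a) =
    c • 1 + (a + ζ • (a * d) + (2 * ζ) • (a * d * (a * d))) + η • ((2 * ζ) • (a * d))
      + (ζ / 2 * (η ^ 2 + η)) • 1 := by
  have hda' : ∀ X, d * (a * X) = a * (d * X) + X := fun X => by
    rw [← mul_assoc, hda, add_mul, mul_assoc, one_mul]
  simp only [mul_add, add_mul, sub_mul, neg_mul, smul_mul_assoc, mul_smul_comm, mul_assoc, hba,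
    hda, hda', mul_one, one_mul]
  match_scalars <;> field_simp <;> ring

end Casimir

/-! ## Simple quotients of the modules induced from `N_{ζ,η}` -/

section WeylQuotients

variable (ζ η : ℂ) {N : Type*} [AddCommGroup N] [Module ℂ N] [Module (R ζ) N]
  [IsScalarTower ℂ (R ζ) N]

variable (N) in
/-- The operator representing `p² - 2z e`. -/
def nDisc : Module.End ℂ N :=
  opN ζ N (R.pq ζ) * opN ζ N (R.pq ζ) + ζ • opN ζ N (R.pq ζ) - (2 * ζ) • opN ζ N (R.eqq ζ)

lemma opN_pq : opN ζ N (R.pq ζ) =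
    if ζ = 0 then opN ζ N (R.t ζ) else (2 * ζ) • opN ζ N (R.s ζ) := by
  unfold R.pq; split_ifs <;> simp

lemma opN_eqq : opN ζ N (R.eqq ζ) = if ζ = 0 then opN ζ N (R.s ζ) else
    opN ζ N (R.t ζ) + ζ • opN ζ N (R.s ζ) +
      (2 * ζ) • (opN ζ N (R.s ζ) * opN ζ N (R.s ζ)) := by
  unfold R.eqq; split_ifs <;> simp [pow_two]

/-- For ζ ≠ 0 the terms in s = t d/dt and s² cancel, leaving a multiple of t. So the operator is
invertible whenever t is. -/
lemma nDisc_eq : nDisc ζ N =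
    if ζ = 0 then opN ζ N (R.t ζ) * opN ζ N (R.t ζ) else (-2 * ζ) • opN ζ N (R.t ζ) := by
  rw [nDisc, opN_pq, opN_eqq]
  split_ifs with h
  · have h0 : ∀ (k : ℂ) (Z : Module.End ℂ N), (k * ζ) • Z = 0 := by simp [h]
    have h1 := h0 1
    rw [one_mul] at h1
    rw [h0, h1, add_zero, sub_zero]
  · simp only [smul_mul_assoc, mul_smul_comm]
    match_scalars <;> ring

variable [IsSimpleModule (R ζ) N] (hN : ¬ Module.Finite ℂ N)

include hN in
lemma nDisc_surjective : Function.Surjective (nDisc ζ N) := by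
  have ht := (t_bijective ζ hN).2
  rw [nDisc_eq]
  split_ifs with h
  · exact ht.comp ht
  · intro w
    obtain ⟨v, hv⟩ := ht ((-2 * ζ)⁻¹ • w)
    refine ⟨v, ?_⟩
    rw [LinearMap.smul_apply, hv, smul_inv_smul₀]
    simpa using h

/-- The right side represents c + eq² + hpq + (z/2)(h² + h). The i-dependent terms of its summands
on v ⊗ xⁱ cancel, so one operator on N serves all degrees. -/
lemma fOp_mul_nDisc (c : ℂ) : fOp ζ η N hN c * nDisc ζ N =
    c • 1 + opN ζ N (R.eqq ζ) + η • opN ζ N (R.pq ζ) + (ζ / 2 * (η ^ 2 + η)) • 1 := by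
  rw [nDisc_eq, fOp, opN_eqq, opN_pq, opN_s ζ N hN]
  split_ifs with h
  · rw [pow_two, weyl_zero_mul_sq (tInv_mul_t ζ N hN) (dN_mul_t ζ N hN)]
    have h0 : ζ / 2 * (η ^ 2 + η) = 0 := by simp [h]
    rw [h0, zero_smul, add_zero]
  · rw [pow_two, weyl_nonzero_mul (tInv_mul_t ζ N hN) (dN_mul_t ζ N hN) h]

variable {M : Type*} [AddCommGroup M] [Module ℂ M] [LieRingModule Schr M] [LieModule ℂ Schr M]

/-- z is central, hence a scalar by Schur's lemma, and one eigenvector determines it. -/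
lemma z_lie_eq_smul [hM : LieModule.IsIrreducible ℂ Schr M] {m : M} (hm : m ≠ 0)
    (hz : ⁅gen .z, m⁆ = ζ • m) (x : M) : ⁅gen .z, x⁆ = ζ • x := by
  have hcomm : ∀ g, ∀ y : M, ⁅gen .z, ⁅gen g, y⁆⁆ = ⁅gen g, ⁅gen .z, y⁆⁆ := fun g y => by
    rw [gen_lie_lie, lie_relations.2.2.2.2.2.2.2.2.2.2, zero_lie, add_zero]
  obtain ⟨c, hc⟩ := exists_eq_smul_of_commute (LieModule.toEnd ℂ Schr M (gen .z)) hcomm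
  have hc' : ∀ y : M, ⁅gen .z, y⁆ = c • y := hc
  have : c = ζ := smul_left_injective ℂ hm ((hc' m).symm.trans hz)
  rw [hc', this]

lemma casimir_apply (B : Gen → Module.End ℂ M) (m : M) : casimir ζ B m =
    B .f (B .p (B .p m)) - B .e (B .q (B .q m)) - B .h (B .p (B .q m)) - (2 * ζ) • B .f (B .e m)
      - (ζ / 2) • (B .h (B .h m) + B .h m) := rfl

/-- The Casimir scalar c forces the action of f on the image of `ρ`, so `ρ` becomes a Schrödinger
homomorphism from the extension with parameter c. It is onto because M is simple. -/
theorem exists_equiv_modNC [hM : LieModule.IsIrreducible ℂ Schr M] (ρ : (ℤ →₀ N) →ₗ[ℂ] M)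
    (hinj : Function.Injective ρ)
    (hρ : ∀ g, g ≠ .f → ∀ x, ⁅gen g, ρ x⁆ = ρ (gradedOps (nOps ζ η N) g x)) :
    ∃ c : ℂ, Nonempty (M ≃ₗ⁅ℂ,Schr⁆ (modNC ζ η N hN c).Space) := by
  have hnt : Nontrivial N := IsSimpleModule.nontrivial (R ζ) N
  obtain ⟨v₀, hv₀⟩ := exists_ne (0 : N)
  have hne : ρ (Finsupp.single 0 v₀) ≠ 0 := fun h => hv₀
    (Finsupp.single_eq_zero.1 (hinj (h.trans (map_zero ρ).symm)))
  have hsing : ∀ g, g ≠ .f → ∀ i v, ⁅gen g, ρ (Finsupp.single i v)⁆ =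
      ρ (Finsupp.single (i + deg g) (nOps ζ η N g i v)) := fun g hg i v => by
    rw [hρ g hg, gradedOps_single]
  have hz : ∀ x : M, ⁅gen .z, x⁆ = ζ • x := z_lie_eq_smul ζ hne (by
    rw [hsing .z (by decide), ← map_smul, Finsupp.smul_single]
    rfl)
  let B : Gen → Module.End ℂ M := fun g => LieModule.toEnd ℂ Schr M (gen g)
  have hB : ∀ g m, B g m = ⁅gen g, m⁆ := fun _ _ => rfl
  have hcomm := casimir_comm (ζ := ζ) (B := B) (LinearMap.ext fun m => hz m) (by
    intro g g'
    refine LinearMap.ext fun m => ?_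
    rw [LinearMap.sub_apply, Module.End.mul_apply, Module.End.mul_apply, hB, hB, hB, hB, ← lie_lie,
      schr_lie_eq_sum, LinearMap.sum_apply]
    rfl)
  obtain ⟨c, hc⟩ := exists_eq_smul_of_commute (casimir ζ B)
    (fun g m => DFunLike.congr_fun (hcomm g) m)
  have hf : ∀ i v, ⁅gen .f, ρ (Finsupp.single i v)⁆ =
      ρ (Finsupp.single (i + deg .f) (fOp ζ η N hN c v)) := by
    intro i v
    -- Writing v as the image of u under the operator of p² - 2ze puts f v into the Casimir equation
    -- evaluated at u ⊗ x^(i+2).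
    obtain ⟨u, rfl⟩ := nDisc_surjective ζ hN v
    have h1 := hc (ρ (Finsupp.single (i + 2) u))
    rw [casimir_apply] at h1
    simp only [hB] at h1
    set x := ρ (Finsupp.single (i + 2) u) with hx
    have hD : ⁅gen .p, ⁅gen .p, x⁆⁆ - (2 * ζ) • ⁅gen .e, x⁆ =
        ρ (Finsupp.single i (nDisc ζ N u)) := by
      rw [hx, hsing .p (by decide), hsing .p (by decide), hsing .e (by decide), ← map_smul,
        Finsupp.smul_single, ← map_sub]
      have e1 : i + 2 + deg .p + deg .p = i := by simp only [deg]; ring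
      have e2 : i + 2 + deg .e = i := by simp only [deg]; ring
      rw [e1, e2, ← Finsupp.single_sub]
      congr 2
      simp only [nOps, laurentOps, nDisc, deg, LinearMap.add_apply, LinearMap.sub_apply,
        LinearMap.smul_apply, Module.End.mul_apply, Module.End.one_apply, map_add, map_smul]
      push_cast
      module
    have hE : c • x + ⁅gen .e, ⁅gen .q, ⁅gen .q, x⁆⁆⁆ + ⁅gen .h, ⁅gen .p, ⁅gen .q, x⁆⁆⁆
        + (ζ / 2) • (⁅gen .h, ⁅gen .h, x⁆⁆ + ⁅gen .h, x⁆) =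
        ρ (Finsupp.single (i + 2) (fOp ζ η N hN c (nDisc ζ N u))) := by
      have h2 := DFunLike.congr_fun (fOp_mul_nDisc ζ η hN c) u
      rw [Module.End.mul_apply] at h2
      rw [h2, hx]
      simp only [hsing .q (by decide), hsing .e (by decide), hsing .h (by decide),
        hsing .p (by decide), ← map_smul, ← map_add]
      have e1 : i + 2 + deg .q + deg .q + deg .e = i + 2 := by simp only [deg]; ring
      have e2 : i + 2 + deg .q + deg .p + deg .h = i + 2 := by simp only [deg]; ring
      have e3 : i + 2 + deg .h + deg .h = i + 2 := by simp only [deg]; ring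
      have e4 : i + 2 + deg .h = i + 2 := by simp only [deg]; ring
      rw [e1, e2, e3, e4]
      simp only [Finsupp.smul_single, ← Finsupp.single_add]
      congr 2
      simp only [nOps, laurentOps, deg, LinearMap.add_apply, LinearMap.sub_apply,
        LinearMap.smul_apply, Module.End.mul_apply, Module.End.one_apply, map_add, map_smul]
      push_cast
      module
    have hdeg : i + deg .f = i + 2 := rfl
    rw [← hD, hdeg, ← hE, lie_sub, lie_smul, ← h1]
    abel
  let φ : (modNC ζ η N hN c).Space →ₗ⁅ℂ,Schr⁆ M :=
    schrHom (ρ ∘ₗ (modNC ζ η N hN c).equiv.symm.toLinearMap) (by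
      intro g x
      obtain ⟨x, rfl⟩ := (modNC ζ η N hN c).equiv.surjective x
      have hact : (modNC ζ η N hN c).act (gen g) = gradedOps (nOpsC ζ η N hN c) g :=
        schrRep_act_gen g
      rw [Rep.lie_equiv, hact]
      change ρ (gradedOps (nOpsC ζ η N hN c) g x) = ⁅gen g, ρ x⁆
      induction x using Finsupp.induction_linear with
      | zero => rw [map_zero, map_zero, lie_zero]
      | add a b ha hb => rw [map_add, map_add, map_add, lie_add, ha, hb]
      | single i v =>
        rw [gradedOps_single]
        by_cases hg : g = .f
        · subst hg; exact (hf i v).symm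
        · rw [hsing g hg]
          cases g <;> first | rfl | exact absurd rfl hg)
  have hφ : Function.Bijective φ :=
    ⟨hinj.comp (modNC ζ η N hN c).equiv.symm.injective,
      surjective_of_isIrreducible ⟨(modNC ζ η N hN c).equiv (Finsupp.single 0 v₀), hne⟩⟩
  exact ⟨c, ⟨(lieModuleEquivOfBijective φ hφ).symm⟩⟩

end WeylQuotients

/-! ### The embedding of N_{ζ,η} in simple quotients of its induced module -/

section InducedQuotients

theorem exists_quotient_equiv_modNC {V : Type*} [AddCommGroup V] [Module ℂ V]
    [LieRingModule ageing V] [LieModule ℂ ageing V] [hV : LieModule.IsIrreducible ℂ ageing V]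
    {ζ η : ℂ} {N : Type*} [AddCommGroup N] [Module ℂ N] [Module (R ζ) N] [IsScalarTower ℂ (R ζ) N]
    [IsSimpleModule (R ζ) N] (hN : ¬ Module.Finite ℂ N)
    (φ : V ≃ₗ⁅ℂ,ageing⁆ (modN ζ η N).Space) (K : LieSubmodule ℂ Schr (InducedSchr V))
    [hK : LieModule.IsIrreducible ℂ Schr (InducedSchr V ⧸ K)] :
    ∃ c : ℂ, Nonempty ((InducedSchr V ⧸ K) ≃ₗ⁅ℂ,Schr⁆ (modNC ζ η N hN c).Space) := by
  let π := LieSubmodule.Quotient.mk' K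
  let ρ : (ℤ →₀ N) →ₗ[ℂ] (InducedSchr V ⧸ K) :=
    (π : InducedSchr V →ₗ[ℂ] _) ∘ₗ indOf ageing.incl V ∘ₗ
      (φ.symm.toLinearEquiv : (modN ζ η N).Space →ₗ[ℂ] V) ∘ₗ (modN ζ η N).equiv.toLinearMap
  have hρapp : ∀ x, ρ x = π (Ind.of ageing.incl (φ.symm ((modN ζ η N).equiv x))) := fun _ => rfl
  refine exists_equiv_modNC ζ η hN ρ ?_ ?_
  -- V meets K in a submodule of the simple module V. It is not all of V, as V generates the induced
  -- module and K is proper; so V embeds in the quotient.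
  · have hof : ofPreimage K = ⊥ := by
      refine (hV.eq_bot_or_eq_top (ofPreimage K)).resolve_right fun h => ?_
      exact ((isIrreducible_quotient_iff K).1 hK).1 (eq_top_of_ofPreimage_eq_top h)
    rw [injective_iff_map_eq_zero]
    intro x hx
    rw [hρapp, LieSubmodule.Quotient.mk_eq_zero] at hx
    have hx' : φ.symm ((modN ζ η N).equiv x) ∈ ofPreimage K := mem_ofPreimage.2 hx
    rw [hof, LieSubmodule.mem_bot] at hx'
    exact (modN ζ η N).equiv.injective (φ.symm.injective
      (hx'.trans (map_zero φ.symm.toLieModuleHom).symm) |>.trans (map_zero _).symm)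
  · intro g hg x
    have hmem := gen_mem_ageing_of_ne hg
    have hact : (modN ζ η N).act ⟨gen g, hmem⟩ = gradedOps (nOps ζ η N) g := repOfOps_act_gen hmem
    have h1 := φ.symm.toLieModuleHom.map_lie ⟨gen g, hmem⟩ ((modN ζ η N).equiv x)
    rw [Rep.lie_equiv, hact] at h1
    have h2 := gen_lie_ind_of hmem (φ.symm ((modN ζ η N).equiv x))
    rw [hρapp, hρapp, ← π.map_lie, h2]
    exact congrArg (fun v => π (Ind.of ageing.incl v)) h1.symm

end InducedQuotients

end Schroedinger

end

open Schroedinger in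
theorem theorem2 (V : Type*) [AddCommGroup V] [Module ℂ V] [LieRingModule ageing V]
    [LieModule ℂ ageing V] (hsimple : LieModule.IsIrreducible ℂ ageing V)
    (hweight : IsWeightModule V) :
    -- highest weight modules
    (IsHighestWeightAgeing V →
      IsHighestWeightSchr (InducedSchr V) ∧ HasUniqueSimpleQuotient Schr (InducedSchr V)) ∧
    -- simple lowest weight modules with nonzero central charge
    (∀ (ζ η : ℂ) (hζ : ζ ≠ 0), Nonempty (V ≃ₗ⁅ℂ, ageing⁆ simpleAgeingLow ζ η) →
      Nonempty (InducedSchr V ≃ₗ⁅ℂ, Schr⁆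
        (heisExt ζ hζ (vermaHeisLow ζ) (vermaHeisLow_central ζ)).Space ⊗[ℂ]
          (sl2Ext (vermaSl2 (η - 1 / 2))).Space) ∧
      HasUniqueSimpleQuotientIso Schr
        ((heisExt ζ hζ (vermaHeisLow ζ) (vermaHeisLow_central ζ)).Space ⊗[ℂ]
          (sl2Ext (vermaSl2 (η - 1 / 2))).Space)
        ((heisExt ζ hζ (vermaHeisLow ζ) (vermaHeisLow_central ζ)).Space ⊗[ℂ]
          (sl2Ext (simpleSl2 (η - 1 / 2))).Space)) ∧
    -- the modules `Q(lam, η)`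
    (∀ (lam η : ℂ), lam ≠ 0 → Nonempty (V ≃ₗ⁅ℂ, ageing⁆ (modQ lam η).Space) →
      LieModule.IsIrreducible ℂ Schr (InducedSchr V)) ∧
    -- the modules `Q'(ζ, η, lam)`
    (∀ (ζ η lam : ℂ) (hζ : ζ ≠ 0), (∀ n : ℤ, lam ≠ n) →
      Nonempty (V ≃ₗ⁅ℂ, ageing⁆ (modQ' ζ η lam).Space) →
      Nonempty (InducedSchr V ≃ₗ⁅ℂ, Schr⁆
        (heisExt ζ hζ (modG ζ lam).Space (modG_central ζ lam)).Space ⊗[ℂ]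
          (sl2Ext (vermaSl2 (lam + η + 1 / 2))).Space) ∧
      HasUniqueSimpleQuotientIso Schr
        ((heisExt ζ hζ (modG ζ lam).Space (modG_central ζ lam)).Space ⊗[ℂ]
          (sl2Ext (vermaSl2 (lam + η + 1 / 2))).Space)
        ((heisExt ζ hζ (modG ζ lam).Space (modG_central ζ lam)).Space ⊗[ℂ]
          (sl2Ext (simpleSl2 (lam + η + 1 / 2))).Space)) ∧
    -- the modules `N_{ζ,η}`
    (∀ (ζ η : ℂ) (N : Type*) [AddCommGroup N] [Module ℂ N] [Module (R ζ) N]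
      [IsScalarTower ℂ (R ζ) N] [IsSimpleModule (R ζ) N] (hN : ¬ Module.Finite ℂ N),
      Nonempty (V ≃ₗ⁅ℂ, ageing⁆ (modN ζ η N).Space) →
      ∀ K : LieSubmodule ℂ Schr (InducedSchr V),
        LieModule.IsIrreducible ℂ Schr (InducedSchr V ⧸ K) →
        ∃ c : ℂ, Nonempty ((InducedSchr V ⧸ K) ≃ₗ⁅ℂ, Schr⁆ (modNC ζ η N hN c).Space)) := by
  refine ⟨induced_highestWeight, fun ζ η hζ ⟨φ⟩ => ⟨induced_equiv_of_lowestWeight hζ η φ,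
    heisLow_tensor_hasUniqueSimpleQuotientIso hζ _⟩,
    fun lam η _ ⟨φ⟩ => induced_isIrreducible_of_equiv_modQ φ,
    fun ζ η lam hζ hlam ⟨φ⟩ => ⟨induced_equiv_of_equiv_modQ' hζ η φ,
      gExt_tensor_hasUniqueSimpleQuotientIso hζ hlam _⟩,
    fun ζ η N _ _ _ _ _ hN ⟨φ⟩ K hK => exists_quotient_equiv_modNC hN φ K⟩
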